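/- Conventions. All vector bundles are complex, locally trivial and of finite, possibly non-constant, rank. For a topological group $H$ and a compact Hausdorff $H$-space $X$, an $H$-vector bundle over $X$ is a vector bundle $E\to X$ with a continuous action of $H$ on $E$ that covers the action on $X$ and is linear on the fibres. $K_H^0(X)$ is the Grothendieck group of the monoid (under $\oplus$) of isomorphism classes of $H$-vector bundles over $X$. For $H$ finite and $n\ge 1$, $K_H^n(X):=\widetilde K{}_H^0(\Sigma^nX_+)$, the kernel of the restriction $K_H^0(\Sigma^nX_+)\to K_H^0(\mathrm{pt})$ to the base point, where $\Sigma^nX_+=S^n\wedge X_+$ (the one-point compactification of $\mathbb R^n\times X$, with $H$ acting through $X$). For a finite group $Q$ and a normalised 2-cocycle $\alpha:Q\times Q\to\mathbb S^1$ let $\widetilde Q_\alpha$ be the set $Q\times\mathbb S^1$ with the product $(q_1,z_1)(q_2,z_2)=(q_1q_2,\alpha(q_1,q_2)z_1z_2)$. For a compact Hausdorff $Q$-space $X$, ${}^{\alpha}K_Q^0(X)$ is the Grothendieck group of the monoid of isomorphism classes of those $\widetilde Q_\alpha$-vector bundles over $X$ on which the central $\mathbb S^1$ acts by multiplication by scalars,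 and ${}^{\alpha}K_Q^n(X):={}^{\alpha}\widetilde K{}_Q^0(\Sigma^nX_+)$ for $n\ge1$. Let $A$ be a normal subgroup of a finite group $G$, and let $Q=G/A$. Let $\mathrm{Irr}(A)$ be the set of isomorphism classes of complex irreducible representations of $A$, on which $G$ acts by $(g\cdot\tau)(a)=\tau(g^{-1}ag)$. For each orbit in $G\backslash\mathrm{Irr}(A)$ fix an irreducible unitary representation $\tau:A\to U(V_\tau)$ whose class $[\tau]$ lies in that orbit. Let $G_{[\tau]}$ be the isotropy group of $[\tau]$ and $Q_{[\tau]}=G_{[\tau]}/A\subset Q$. Choose a map $\sigma:Q_{[\tau]}\to G_{[\tau]}$ with $\sigma(q)A=q$ and $\sigma(1)=1$, and $M_q\in U(V_\tau)$ for $q\in Q_{[\tau]}$ with $M_1=1$ and $\tau(\sigma(q)^{-1}a\sigma(q))=M_q^{-1}\tau(a)M_q$ for all $a\in A$ (such choices exist). Let $\alpha_\tau:Q_{[\tau]}\times Q_{[\tau]}\to\mathbb S^1$ be the normalised 2-cocycle given by the scalars $$\alpha_\tau(q_1,q_2)=\tau\big(\sigma(q_1q_2)^{-1}\sigma(q_1)\sigma(q_2)\big)M_{q_2}^{-1}M_{q_1}^{-1}M_{q_1q_2}.$$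 Let $X$ be a compact Hausdorff $G$-space on which $A$ acts trivially. For a $G$-vector bundle $E$ over $X$ let $\mathrm{Hom}_A(\mathbb V_\tau,E)$ be the bundle over $X$ with fibres $\mathrm{Hom}_A(V_\tau,E_x)$, on which $(q,z)$ in the central extension of $Q_{[\tau]}$ given by $\alpha_\tau$ acts by $((q,z)f)(v)=z\,\sigma(q)f(M_q^{-1}v)$. Theorem. For every such $X$ and $E$, $\mathrm{Hom}_A(\mathbb V_\tau,E)$ is an $\alpha_\tau$-twisted $Q_{[\tau]}$-equivariant vector bundle over $X$, and there are isomorphisms of abelian groups $$\Psi_X:K_G^n(X)\longrightarrow\bigoplus_{[\tau]\in G\backslash\mathrm{Irr}(A)}{}^{\alpha_\tau}K^n_{Q_{[\tau]}}(X)\qquad(n\ge0)$$ which in degree $0$ satisfy $\Psi_X([E])=\bigoplus_{[\tau]}[\mathrm{Hom}_A(\mathbb V_\tau,E)]$ and in degree $n\ge1$ are the restrictions of the degree-$0$ isomorphisms $\Psi_{\Sigma^nX_+}$ to the reduced groups. They are functorial: for every continuous $G$-map $f:X\to Y$ of compact Hausdorff $G$-spaces on which $A$ acts trivially, $\Psi_X\circ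 f^*=f^*\circ\Psi_Y$ in every degree. -/

import Mathlib

open Topology DirectSum

universe u v

noncomputable section

namespace EqK

/-! ## Compact Hausdorff spaces with a group action -/

/-- A compact Hausdorff space with a continuous left action of the topological group `H`. -/
structure GSpace (H : Type v) [Group H] [TopologicalSpace H] where
  carrier : Type u
  [top : TopologicalSpace carrier]
  [compact : CompactSpace carrier]
  [t2 : T2Space carrier]
  [act : MulAction H carrier]
  [cont : ContinuousSMul H carrier]

attribute [instance] GSpace.top GSpace.compact GSpace.t2 GSpace.act GSpace.cont

instance {H : Type v} [Group H] [TopologicalSpace H] : CoeSort (GSpace.{u, v} H) (Type u) :=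
  ⟨GSpace.carrier⟩

section Spaces

variable {H : Type v} [Group H] [TopologicalSpace H]

/-- A continuous equivariant map. -/
structure GMap (X Y : GSpace.{u, v} H) where
  toFun : X → Y
  continuous : Continuous toFun
  map_smul : ∀ (h : H) (x : X), toFun (h • x) = h • toFun x

def GMap.comp {X Y Z : GSpace.{u, v} H} (f : GMap Y X) (g : GMap Z Y) : GMap Z X where
  toFun := f.toFun ∘ g.toFun
  continuous := f.continuous.comp g.continuous
  map_smul h z := by simp only [Function.comp_apply, g.map_smul, f.map_smul]

/-- Restriction of the action along a continuous homomorphism. -/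
def GSpace.comap {H' : Type*} [Group H'] [TopologicalSpace H'] (φ : H' →* H) (hφ : Continuous φ)
    (X : GSpace.{u, v} H) : GSpace.{u} H' :=
  letI : MulAction H' X := MulAction.compHom X φ
  { carrier := X
    cont := ⟨(hφ.comp continuous_fst).smul continuous_snd⟩ }

def GMap.comap {H' : Type*} [Group H'] [TopologicalSpace H'] (φ : H' →* H) (hφ : Continuous φ)
    {X Y : GSpace.{u, v} H} (f : GMap X Y) : GMap (X.comap φ hφ) (Y.comap φ hφ) where
  toFun := f.toFun
  continuous := f.continuous
  map_smul h x := f.map_smul (φ h) x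

/-- The one-point space. -/
def GSpace.point (H : Type v) [Group H] [TopologicalSpace H] : GSpace.{u, v} H :=
  letI : MulAction H PUnit.{u + 1} :=
    { smul := fun _ x => x, one_smul := fun _ => rfl, mul_smul := fun _ _ _ => rfl }
  { carrier := PUnit
    cont := ⟨continuous_snd⟩ }

theorem continuous_onePoint_map {X Y : Type*} [TopologicalSpace X] [TopologicalSpace Y]
    [CompactSpace X] [T2Space X] [CompactSpace Y] [T2Space Y] (n : ℕ) {f : X → Y}
    (hf : Continuous f) :
    Continuous (OnePoint.map (Prod.map id f :
      EuclideanSpace ℝ (Fin n) × X → EuclideanSpace ℝ (Fin n) × Y)) := by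
  have hp : IsProperMap (Prod.map id f :
      EuclideanSpace ℝ (Fin n) × X → EuclideanSpace ℝ (Fin n) × Y) :=
    isProperMap_id.prodMap hf.isProperMap
  refine OnePoint.continuous_map hp.continuous ?_
  rw [Filter.coclosedCompact_eq_cocompact, Filter.coclosedCompact_eq_cocompact]
  exact (isProperMap_iff_tendsto_cocompact.1 hp).2

/-- The iterated reduced suspension `Σⁿ(X₊) = Sⁿ ∧ X₊`, realised as the one-point compactification
of `ℝⁿ × X`, on which the group acts through `X`; the base point is `∞`. (Since `X` is compact,
collapsing `{∞} × X` in `(ℝⁿ)⁺ × X` gives this space. For `n = 0` it is `X₊`, as `X` is compact.) -/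
def GSpace.susp [DiscreteTopology H] (n : ℕ) (X : GSpace.{u, v} H) : GSpace.{u, v} H :=
  letI : MulAction H (OnePoint (EuclideanSpace ℝ (Fin n) × X)) :=
    { smul := fun h => OnePoint.map (Prod.map id (fun x => h • x))
      one_smul := fun t => by
        cases t using OnePoint.rec with
        | infty => rfl
        | coe p => exact congrArg (fun y => OnePoint.some (p.1, y)) (one_smul H p.2)
      mul_smul := fun g h t => by
        cases t using OnePoint.rec with
        | infty => rfl
        | coe p => exact congrArg (fun y => OnePoint.some (p.1, y)) (mul_smul g h p.2) }
  { carrier := OnePoint (EuclideanSpace ℝ (Fin n) × X)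
    cont := ⟨continuous_prod_of_discrete_left.2 fun h =>
      continuous_onePoint_map n (continuous_const_smul h)⟩ }

def GMap.susp [DiscreteTopology H] (n : ℕ) {X Y : GSpace.{u, v} H} (f : GMap X Y) :
    GMap (X.susp n) (Y.susp n) where
  toFun := OnePoint.map (Prod.map id f.toFun)
  continuous := continuous_onePoint_map n f.continuous
  map_smul h t := by
    cases t using OnePoint.rec with
    | infty => rfl
    | coe p => exact congrArg (fun y => OnePoint.some (p.1, y)) (f.map_smul h p.2)

/-- The inclusion of the base point of `Σⁿ(X₊)`. -/
def GSpace.base [DiscreteTopology H] (n : ℕ) (X : GSpace.{u, v} H) :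
    GMap (GSpace.point.{u, v} H) (X.susp n) where
  toFun _ := OnePoint.infty
  continuous := continuous_const
  map_smul _ _ := rfl

end Spaces

/-! ## Equivariant complex vector bundles -/

section Bundles

variable {H : Type v} [Group H] [TopologicalSpace H]

/-- A family of complex vector spaces over `X`, with a topology on the total space, and with a
fibrewise linear action of `H` on the total space covering the action on `X`. The action of `h` is
given by linear maps `E_x → E_y`, one for each `x, y` with `h • x = y`. -/
structure EqFamily (X : GSpace.{u, v} H) where
  Fib : X → Type u
  [acg : ∀ x, AddCommGroup (Fib x)]
  [mod : ∀ x, Module ℂ (Fib x)]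
  [top : TopologicalSpace (Bundle.TotalSpace Unit Fib)]
  act : ∀ (h : H) {x y : X}, h • x = y → (Fib x →ₗ[ℂ] Fib y)
  act_one : ∀ {x : X} (e : (1 : H) • x = x) (v : Fib x), act 1 e v = v
  act_mul : ∀ (g h : H) {x y z : X} (hxy : h • x = y) (hyz : g • y = z) (hxz : (g * h) • x = z)
    (v : Fib x), act (g * h) hxz v = act g hyz (act h hxy v)

attribute [instance] EqFamily.acg EqFamily.mod EqFamily.top

namespace EqFamily

variable {X Y Z : GSpace.{u, v} H}

/-- The total space. -/
abbrev Tot (E : EqFamily X) : Type u := Bundle.TotalSpace Unit E.Fib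

/-- An `H`-equivariant family is an `H`-equivariant complex vector bundle if the projection and the
action are continuous and each point has an open neighbourhood `U` over which the family is
isomorphic to `U × ℂⁿ`, for some `n`, by a fibrewise linear homeomorphism. -/
structure IsBundle (E : EqFamily X) : Prop where
  continuous_proj : Continuous fun t : E.Tot => t.proj
  continuous_act : Continuous fun p : H × E.Tot =>
    (⟨p.1 • p.2.proj, E.act p.1 rfl p.2.snd⟩ : E.Tot)
  locally_trivial : ∀ x₀ : X, ∃ (U : Set X) (n : ℕ) (φ : ∀ x : U, E.Fib x ≃ₗ[ℂ] (Fin n → ℂ)),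
    IsOpen U ∧ x₀ ∈ U ∧
      IsHomeomorph fun t : {t : E.Tot // t.proj ∈ U} =>
        ((⟨t.1.proj, t.2⟩ : U), φ ⟨t.1.proj, t.2⟩ t.1.snd)

/-- Isomorphisms of equivariant families over `X`: fibrewise linear equivariant homeomorphisms of
the total spaces over `X`. -/
structure Iso (E F : EqFamily X) where
  toEquiv : ∀ x, E.Fib x ≃ₗ[ℂ] F.Fib x
  comm : ∀ (h : H) {x y : X} (e : h • x = y) (v : E.Fib x),
    toEquiv y (E.act h e v) = F.act h e (toEquiv x v)
  continuous_toFun : Continuous fun t : E.Tot => (⟨t.proj, toEquiv t.proj t.snd⟩ : F.Tot)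
  continuous_invFun : Continuous fun t : F.Tot => (⟨t.proj, (toEquiv t.proj).symm t.snd⟩ : E.Tot)

def Iso.refl (E : EqFamily X) : Iso E E where
  toEquiv _ := LinearEquiv.refl ℂ _
  comm _ _ _ _ _ := rfl
  continuous_toFun := continuous_id
  continuous_invFun := continuous_id

def Iso.symm {E F : EqFamily X} (i : Iso E F) : Iso F E where
  toEquiv x := (i.toEquiv x).symm
  comm h x y e v := by
    rw [LinearEquiv.symm_apply_eq, i.comm, LinearEquiv.apply_symm_apply]
  continuous_toFun := i.continuous_invFun
  continuous_invFun := i.continuous_toFun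

def Iso.trans {E F D : EqFamily X} (i : Iso E F) (j : Iso F D) : Iso E D where
  toEquiv x := (i.toEquiv x).trans (j.toEquiv x)
  comm h x y e v := by simp [i.comm, j.comm]
  continuous_toFun := j.continuous_toFun.comp i.continuous_toFun
  continuous_invFun := i.continuous_invFun.comp j.continuous_invFun

/-- The direct sum; its total space is the fibre product of the total spaces. -/
def sum (E F : EqFamily X) : EqFamily X where
  Fib x := E.Fib x × F.Fib x
  top := TopologicalSpace.induced
    (fun t => ((⟨t.proj, t.snd.1⟩ : E.Tot), (⟨t.proj, t.snd.2⟩ : F.Tot))) inferInstance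
  act h _ _ e := (E.act h e).prodMap (F.act h e)
  act_one e v := Prod.ext (E.act_one e v.1) (F.act_one e v.2)
  act_mul g h _ _ _ e e' e'' v := Prod.ext (E.act_mul g h e e' e'' v.1) (F.act_mul g h e e' e'' v.2)

/-- The zero bundle `X × 0`. -/
def zero (X : GSpace.{u, v} H) : EqFamily X where
  Fib _ := PUnit
  top := TopologicalSpace.induced (fun t => t.proj) inferInstance
  act _ _ _ _ := 0
  act_one _ _ := rfl
  act_mul _ _ _ _ _ _ _ _ _ := rfl

/-- The pullback `f^*E`; its total space is the fibre product of `Y` and the total space of `E`. -/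
def pullback (f : GMap Y X) (E : EqFamily X) : EqFamily Y where
  Fib y := E.Fib (f.toFun y)
  top := TopologicalSpace.induced
    (fun t => (t.proj, (⟨f.toFun t.proj, t.snd⟩ : E.Tot))) inferInstance
  act h y y' e := E.act h (x := f.toFun y) (y := f.toFun y') (by rw [← f.map_smul, e])
  act_one _ v := E.act_one _ v
  act_mul g h _ _ _ _ _ _ v := E.act_mul g h _ _ _ v

theorem act_heq (E : EqFamily X) (h : H) {x y y' : X} (e : h • x = y) (e' : h • x = y')
    (v : E.Fib x) : (⟨y, E.act h e v⟩ : E.Tot) = ⟨y', E.act h e' v⟩ := by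
  subst e; subst e'; rfl

theorem act_congr (E : EqFamily X) {g g' : H} (hg : g = g') {x y : X} (e : g • x = y)
    (e' : g' • x = y) (v : E.Fib x) : E.act g e v = E.act g' e' v := by
  subst hg; rfl

theorem continuous_sum_fst (E F : EqFamily X) :
    Continuous fun t : (E.sum F).Tot => (⟨t.proj, t.snd.1⟩ : E.Tot) :=
  continuous_fst.comp (continuous_induced_dom (t := instTopologicalSpaceProd)
    (f := fun t : (E.sum F).Tot => ((⟨t.proj, t.snd.1⟩ : E.Tot), (⟨t.proj, t.snd.2⟩ : F.Tot))))

theorem continuous_sum_snd (E F : EqFamily X) :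
    Continuous fun t : (E.sum F).Tot => (⟨t.proj, t.snd.2⟩ : F.Tot) :=
  continuous_snd.comp (continuous_induced_dom (t := instTopologicalSpaceProd)
    (f := fun t : (E.sum F).Tot => ((⟨t.proj, t.snd.1⟩ : E.Tot), (⟨t.proj, t.snd.2⟩ : F.Tot))))

theorem continuous_sum_mk {Z : Type*} [TopologicalSpace Z] {E F : EqFamily X}
    {f : Z → (E.sum F).Tot}
    (h₁ : Continuous fun z => (⟨(f z).proj, (f z).snd.1⟩ : E.Tot))
    (h₂ : Continuous fun z => (⟨(f z).proj, (f z).snd.2⟩ : F.Tot)) : Continuous f :=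
  continuous_induced_rng.2 (h₁.prodMk h₂)

theorem continuous_pullback_proj (f : GMap Y X) (E : EqFamily X) :
    Continuous fun t : (E.pullback f).Tot => t.proj :=
  continuous_fst.comp (continuous_induced_dom (t := instTopologicalSpaceProd)
    (f := fun t : (E.pullback f).Tot => (t.proj, (⟨f.toFun t.proj, t.snd⟩ : E.Tot))))

theorem continuous_pullback_lift (f : GMap Y X) (E : EqFamily X) :
    Continuous fun t : (E.pullback f).Tot => (⟨f.toFun t.proj, t.snd⟩ : E.Tot) :=
  continuous_snd.comp (continuous_induced_dom (t := instTopologicalSpaceProd)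
    (f := fun t : (E.pullback f).Tot => (t.proj, (⟨f.toFun t.proj, t.snd⟩ : E.Tot))))

theorem continuous_pullback_mk {Z : Type*} [TopologicalSpace Z] {f : GMap Y X} {E : EqFamily X}
    {g : Z → (E.pullback f).Tot} (h₁ : Continuous fun z => (g z).proj)
    (h₂ : Continuous fun z => (⟨f.toFun (g z).proj, (g z).snd⟩ : E.Tot)) : Continuous g :=
  continuous_induced_rng.2 (h₁.prodMk h₂)

theorem isHomeomorph_of_isInducing (E : EqFamily X) {U : Set X} {n : ℕ}
    (φ : ∀ x : U, E.Fib x ≃ₗ[ℂ] (Fin n → ℂ))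
    (h : IsInducing fun t : {t : E.Tot // t.proj ∈ U} =>
      ((⟨t.1.proj, t.2⟩ : U), φ ⟨t.1.proj, t.2⟩ t.1.snd)) :
    IsHomeomorph fun t : {t : E.Tot // t.proj ∈ U} =>
      ((⟨t.1.proj, t.2⟩ : U), φ ⟨t.1.proj, t.2⟩ t.1.snd) := by
  refine isHomeomorph_iff_isEmbedding_surjective.2 ⟨⟨h, ?_⟩, ?_⟩
  · rintro ⟨⟨x, v⟩, hx⟩ ⟨⟨y, w⟩, hy⟩ hvw
    have hxy : x = y := congrArg (fun p => (p.1 : X)) hvw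
    subst hxy
    have h2 : φ ⟨x, hx⟩ v = φ ⟨x, hx⟩ w := congrArg Prod.snd hvw
    rw [(φ ⟨x, hx⟩).injective h2]
  · rintro ⟨x, w⟩
    exact ⟨⟨⟨x, (φ x).symm w⟩, x.2⟩, Prod.ext rfl ((φ x).apply_symm_apply w)⟩

theorem IsBundle.sum {E F : EqFamily X} (hE : E.IsBundle) (hF : F.IsBundle) :
    (E.sum F).IsBundle where
  continuous_proj := hE.continuous_proj.comp (continuous_sum_fst E F)
  continuous_act := by
    refine continuous_sum_mk ?_ ?_
    · exact hE.continuous_act.comp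
        (continuous_fst.prodMk ((continuous_sum_fst E F).comp continuous_snd))
    · exact hF.continuous_act.comp
        (continuous_fst.prodMk ((continuous_sum_snd E F).comp continuous_snd))
  locally_trivial x₀ := by
    obtain ⟨U, n, φ, hU, hxU, hφ⟩ := hE.locally_trivial x₀
    obtain ⟨V, m, ψ, hV, hxV, hψ⟩ := hF.locally_trivial x₀
    let L : ((Fin n → ℂ) × (Fin m → ℂ)) ≃L[ℂ] (Fin (n + m) → ℂ) :=
      ContinuousLinearEquiv.ofFinrankEq (by simp)
    let χ : ∀ x : (U ∩ V : Set X), (E.sum F).Fib x ≃ₗ[ℂ] (Fin (n + m) → ℂ) := fun x =>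
      ((φ ⟨x, x.2.1⟩).prodCongr (ψ ⟨x, x.2.2⟩)).trans L.toLinearEquiv
    refine ⟨U ∩ V, n + m, χ, hU.inter hV, ⟨hxU, hxV⟩, isHomeomorph_of_isInducing (E.sum F) χ ?_⟩
    let j : {t : (E.sum F).Tot // t.proj ∈ U ∩ V} →
        {t : E.Tot // t.proj ∈ U} × {t : F.Tot // t.proj ∈ V} :=
      fun t => (⟨⟨t.1.proj, t.1.snd.1⟩, t.2.1⟩, ⟨⟨t.1.proj, t.1.snd.2⟩, t.2.2⟩)
    have hj₁ : Continuous fun t => (j t).1 :=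
      ((continuous_sum_fst E F).comp continuous_subtype_val).subtype_mk _
    have hj₂ : Continuous fun t => (j t).2 :=
      ((continuous_sum_snd E F).comp continuous_subtype_val).subtype_mk _
    have hj : IsInducing j := by
      refine IsInducing.of_comp (hj₁.prodMk hj₂)
        (continuous_subtype_val.prodMap continuous_subtype_val) ?_
      have h1 : IsInducing (fun t : (E.sum F).Tot =>
        ((⟨t.proj, t.snd.1⟩ : E.Tot), (⟨t.proj, t.snd.2⟩ : F.Tot))) := ⟨rfl⟩
      exact h1.comp IsInducing.subtypeVal
    have hk := (hφ.isEmbedding.isInducing.prodMap hψ.isEmbedding.isInducing).comp hj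
    let g : (U ∩ V : Set X) × (Fin (n + m) → ℂ) → (U × (Fin n → ℂ)) × (V × (Fin m → ℂ)) :=
      fun p => ((⟨p.1, p.1.2.1⟩, (L.symm p.2).1), (⟨p.1, p.1.2.2⟩, (L.symm p.2).2))
    have hg : Continuous g := by
      have := L.symm.continuous
      have h1 : Continuous fun p : (U ∩ V : Set X) × (Fin (n + m) → ℂ) => (p.1 : X) :=
        continuous_subtype_val.comp continuous_fst
      exact ((h1.subtype_mk _).prodMk (this.comp continuous_snd).fst).prodMk
        ((h1.subtype_mk _).prodMk (this.comp continuous_snd).snd)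
    refine IsInducing.of_comp ?_ hg ?_
    · refine Continuous.prodMk ?_ ?_
      · exact ((hE.continuous_proj.comp (continuous_sum_fst E F)).comp
          continuous_subtype_val).subtype_mk _
      · exact L.continuous.comp
          ((hφ.continuous.comp hj₁).snd.prodMk (hψ.continuous.comp hj₂).snd)
    · convert hk using 1
      funext t
      have hL : L.symm (χ ⟨t.1.proj, t.2⟩ t.1.snd) =
          (φ ⟨t.1.proj, t.2.1⟩ t.1.snd.1, ψ ⟨t.1.proj, t.2.2⟩ t.1.snd.2) := L.symm_apply_apply _
      refine Prod.ext (Prod.ext rfl ?_) (Prod.ext rfl ?_)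
      · exact congrArg (fun p => p.1) hL
      · exact congrArg (fun p => p.2) hL

theorem isBundle_zero (X : GSpace.{u, v} H) : (zero X).IsBundle where
  continuous_proj := continuous_induced_dom
  continuous_act := continuous_induced_rng.2 <|
    continuous_fst.smul (continuous_induced_dom.comp continuous_snd)
  locally_trivial x₀ := by
    let χ : ∀ x : (Set.univ : Set X), (zero X).Fib x ≃ₗ[ℂ] (Fin 0 → ℂ) := fun x =>
      ⟨0, fun _ => PUnit.unit, fun _ => rfl, fun _ => Subsingleton.elim _ _⟩
    refine ⟨Set.univ, 0, χ, isOpen_univ, trivial, isHomeomorph_of_isInducing (zero X) χ ?_⟩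
    have h1 : IsInducing (fun t : (zero X).Tot => t.proj) := ⟨rfl⟩
    let g : ((Set.univ : Set X) : Type u) × (Fin 0 → ℂ) → X := fun p => p.1.1
    refine IsInducing.of_comp (g := g) ?_ (continuous_subtype_val.comp continuous_fst)
      (h1.comp IsInducing.subtypeVal)
    exact ((h1.continuous.comp continuous_subtype_val).subtype_mk _).prodMk continuous_const

theorem IsBundle.pullback (f : GMap Y X) {E : EqFamily X} (hE : E.IsBundle) :
    (E.pullback f).IsBundle where
  continuous_proj := continuous_pullback_proj f E
  continuous_act := by
    refine continuous_pullback_mk ?_ ?_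
    · exact continuous_fst.smul ((continuous_pullback_proj f E).comp continuous_snd)
    · refine (hE.continuous_act.comp (continuous_fst.prodMk
        ((continuous_pullback_lift f E).comp continuous_snd))).congr fun p => ?_
      exact E.act_heq _ _ _ _
  locally_trivial y₀ := by
    obtain ⟨U, n, φ, hU, hxU, hφ⟩ := hE.locally_trivial (f.toFun y₀)
    let χ : ∀ y : (f.toFun ⁻¹' U), (E.pullback f).Fib y ≃ₗ[ℂ] (Fin n → ℂ) := fun y =>
      φ ⟨f.toFun y, y.2⟩
    refine ⟨f.toFun ⁻¹' U, n, χ, hU.preimage f.continuous, hxU,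
      isHomeomorph_of_isInducing (E.pullback f) χ ?_⟩
    let j : {t : (E.pullback f).Tot // t.proj ∈ f.toFun ⁻¹' U} → Y × {t : E.Tot // t.proj ∈ U} :=
      fun t => (t.1.proj, ⟨⟨f.toFun t.1.proj, t.1.snd⟩, t.2⟩)
    have hj₁ : Continuous fun t => (j t).1 :=
      (continuous_pullback_proj f E).comp continuous_subtype_val
    have hj₂ : Continuous fun t => (j t).2 :=
      ((continuous_pullback_lift f E).comp continuous_subtype_val).subtype_mk _
    have hj : IsInducing j := by
      refine IsInducing.of_comp (hj₁.prodMk hj₂)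
        (continuous_id.prodMap continuous_subtype_val) ?_
      have h1 : IsInducing (fun t : (E.pullback f).Tot =>
        (t.proj, (⟨f.toFun t.proj, t.snd⟩ : E.Tot))) := ⟨rfl⟩
      exact h1.comp IsInducing.subtypeVal
    have hk := (IsInducing.id.prodMap hφ.isEmbedding.isInducing).comp hj
    let g : (f.toFun ⁻¹' U) × (Fin n → ℂ) → Y × (U × (Fin n → ℂ)) :=
      fun p => (p.1, (⟨f.toFun p.1, p.1.2⟩, p.2))
    have hg : Continuous g := by
      have h1 : Continuous fun p : (f.toFun ⁻¹' U) × (Fin n → ℂ) => (p.1 : Y) :=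
        continuous_subtype_val.comp continuous_fst
      exact h1.prodMk (((f.continuous.comp h1).subtype_mk _).prodMk continuous_snd)
    refine IsInducing.of_comp ?_ hg hk
    exact (hj₁.subtype_mk _).prodMk (hφ.continuous.comp hj₂).snd


/-- Direct sums of isomorphisms, and the isomorphisms that make isomorphism classes of bundles a
commutative monoid and pullback a homomorphism of monoids. -/
def Iso.sum {E E' F F' : EqFamily X} (i : Iso E E') (j : Iso F F') : Iso (E.sum F) (E'.sum F') where
  toEquiv x := (i.toEquiv x).prodCongr (j.toEquiv x)
  comm h _ _ e v := Prod.ext (i.comm h e v.1) (j.comm h e v.2)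
  continuous_toFun := continuous_sum_mk (i.continuous_toFun.comp (continuous_sum_fst E F))
    (j.continuous_toFun.comp (continuous_sum_snd E F))
  continuous_invFun := continuous_sum_mk (i.continuous_invFun.comp (continuous_sum_fst E' F'))
    (j.continuous_invFun.comp (continuous_sum_snd E' F'))

def sumComm (E F : EqFamily X) : Iso (E.sum F) (F.sum E) where
  toEquiv x := LinearEquiv.prodComm ℂ (E.Fib x) (F.Fib x)
  comm _ _ _ _ _ := rfl
  continuous_toFun := continuous_sum_mk (continuous_sum_snd E F) (continuous_sum_fst E F)
  continuous_invFun := continuous_sum_mk (continuous_sum_snd F E) (continuous_sum_fst F E)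

def sumAssoc (E F D : EqFamily X) : Iso ((E.sum F).sum D) (E.sum (F.sum D)) where
  toEquiv x := LinearEquiv.prodAssoc ℂ (E.Fib x) (F.Fib x) (D.Fib x)
  comm _ _ _ _ _ := rfl
  continuous_toFun := continuous_sum_mk
    ((continuous_sum_fst E F).comp (continuous_sum_fst (E.sum F) D))
    (continuous_sum_mk ((continuous_sum_snd E F).comp (continuous_sum_fst (E.sum F) D))
      (continuous_sum_snd (E.sum F) D))
  continuous_invFun := continuous_sum_mk
    (continuous_sum_mk (continuous_sum_fst E (F.sum D))
      ((continuous_sum_fst F D).comp (continuous_sum_snd E (F.sum D))))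
    ((continuous_sum_snd F D).comp (continuous_sum_snd E (F.sum D)))

def sumZero (E : EqFamily X) (hE : E.IsBundle) : Iso E (E.sum (zero X)) where
  toEquiv _ :=
    { toFun := fun v => (v, PUnit.unit)
      invFun := fun v => v.1
      map_add' := fun _ _ => rfl
      map_smul' := fun _ _ => rfl
      left_inv := fun _ => rfl
      right_inv := fun _ => rfl }
  comm _ _ _ _ _ := rfl
  continuous_toFun := continuous_sum_mk continuous_id (continuous_induced_rng.2 hE.continuous_proj)
  continuous_invFun := continuous_sum_fst E (zero X)

def Iso.pullback (f : GMap Y X) {E F : EqFamily X} (i : Iso E F) :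
    Iso (E.pullback f) (F.pullback f) where
  toEquiv y := i.toEquiv (f.toFun y)
  comm h _ _ _ v := i.comm h _ v
  continuous_toFun := continuous_pullback_mk (continuous_pullback_proj f E)
    (i.continuous_toFun.comp (continuous_pullback_lift f E))
  continuous_invFun := continuous_pullback_mk (continuous_pullback_proj f F)
    (i.continuous_invFun.comp (continuous_pullback_lift f F))

def pullbackSum (f : GMap Y X) (E F : EqFamily X) :
    Iso ((E.sum F).pullback f) ((E.pullback f).sum (F.pullback f)) where
  toEquiv y := LinearEquiv.refl ℂ (E.Fib (f.toFun y) × F.Fib (f.toFun y))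
  comm _ _ _ _ _ := rfl
  continuous_toFun := continuous_sum_mk
    (continuous_pullback_mk (continuous_pullback_proj f (E.sum F))
      ((continuous_sum_fst E F).comp (continuous_pullback_lift f (E.sum F))))
    (continuous_pullback_mk (continuous_pullback_proj f (E.sum F))
      ((continuous_sum_snd E F).comp (continuous_pullback_lift f (E.sum F))))
  continuous_invFun := continuous_pullback_mk
    ((continuous_pullback_proj f E).comp (continuous_sum_fst (E.pullback f) (F.pullback f)))
    (continuous_sum_mk
      ((continuous_pullback_lift f E).comp (continuous_sum_fst (E.pullback f) (F.pullback f)))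
      ((continuous_pullback_lift f F).comp (continuous_sum_snd (E.pullback f) (F.pullback f))))

def pullbackZero (f : GMap Y X) : Iso ((zero X).pullback f) (zero Y) where
  toEquiv _ := LinearEquiv.refl ℂ PUnit.{u + 1}
  comm _ _ _ _ _ := rfl
  continuous_toFun := continuous_induced_rng.2 (continuous_pullback_proj f (zero X))
  continuous_invFun := continuous_pullback_mk continuous_induced_dom
    (continuous_induced_rng.2 (f.continuous.comp continuous_induced_dom))

def pullbackComp (f : GMap Y X) (g : GMap Z Y) (E : EqFamily X) :
    Iso ((E.pullback f).pullback g) (E.pullback (f.comp g)) where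
  toEquiv z := LinearEquiv.refl ℂ (E.Fib (f.toFun (g.toFun z)))
  comm _ _ _ _ _ := rfl
  continuous_toFun := continuous_pullback_mk (continuous_pullback_proj g (E.pullback f))
    ((continuous_pullback_lift f E).comp (continuous_pullback_lift g (E.pullback f)))
  continuous_invFun := continuous_pullback_mk (continuous_pullback_proj (f.comp g) E)
    (continuous_pullback_mk (g.continuous.comp (continuous_pullback_proj (f.comp g) E))
      (continuous_pullback_lift (f.comp g) E))

end EqFamily

/-- An `H`-equivariant complex vector bundle over `X`. -/
structure EqBundle (X : GSpace.{u, v} H) where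
  fam : EqFamily X
  isBundle : fam.IsBundle

instance EqBundle.setoid (X : GSpace.{u, v} H) : Setoid (EqBundle X) where
  r E F := Nonempty (E.fam.Iso F.fam)
  iseqv := ⟨fun E => ⟨EqFamily.Iso.refl E.fam⟩, fun ⟨i⟩ => ⟨i.symm⟩, fun ⟨i⟩ ⟨j⟩ => ⟨i.trans j⟩⟩

/-- The set of isomorphism classes of `H`-equivariant complex vector bundles over `X`. -/
def Vec (X : GSpace.{u, v} H) : Type _ := Quotient (EqBundle.setoid X)

variable {X Y : GSpace.{u, v} H}

/-- The isomorphism class of a bundle. -/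
def Vec.mk (E : EqBundle X) : Vec X := Quotient.mk _ E

instance : Add (Vec X) where
  add := Quotient.map₂ (fun E F => ⟨E.fam.sum F.fam, E.isBundle.sum F.isBundle⟩)
    (by rintro E E' ⟨i⟩ F F' ⟨j⟩; exact ⟨i.sum j⟩)

instance : Zero (Vec X) where
  zero := Vec.mk ⟨EqFamily.zero X, EqFamily.isBundle_zero X⟩

/-- Isomorphism classes of bundles form a commutative monoid under direct sum. -/
instance : AddCommMonoid (Vec X) where
  add_assoc := by
    rintro ⟨E⟩ ⟨F⟩ ⟨D⟩
    exact Quotient.sound ⟨EqFamily.sumAssoc E.fam F.fam D.fam⟩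
  add_comm := by
    rintro ⟨E⟩ ⟨F⟩
    exact Quotient.sound ⟨EqFamily.sumComm E.fam F.fam⟩
  add_zero := by
    rintro ⟨E⟩
    exact Quotient.sound ⟨(EqFamily.sumZero E.fam E.isBundle).symm⟩
  zero_add := by
    rintro ⟨E⟩
    exact Quotient.sound
      ⟨(EqFamily.sumComm _ _).trans (EqFamily.sumZero E.fam E.isBundle).symm⟩
  nsmul := nsmulRec

def EqBundle.pullback (f : GMap Y X) (E : EqBundle X) : EqBundle Y :=
  ⟨E.fam.pullback f, E.isBundle.pullback f⟩

/-- Pullback of isomorphism classes. -/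
def Vec.map (f : GMap Y X) : Vec X →+ Vec Y where
  toFun := Quotient.map (EqBundle.pullback f) (by rintro E F ⟨i⟩; exact ⟨i.pullback f⟩)
  map_zero' := Quotient.sound ⟨EqFamily.pullbackZero f⟩
  map_add' := by
    rintro ⟨E⟩ ⟨F⟩
    exact Quotient.sound ⟨EqFamily.pullbackSum f E.fam F.fam⟩

theorem Vec.map_map {Z : GSpace.{u, v} H} (f : GMap Y X) (g : GMap Z Y) (c : Vec X) :
    Vec.map g (Vec.map f c) = Vec.map (f.comp g) c := by
  rcases c with ⟨E⟩
  exact Quotient.sound ⟨EqFamily.pullbackComp f g E.fam⟩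

end Bundles

/-! ## Equivariant K-theory -/

section KTheory

variable {H : Type v} [Group H] [TopologicalSpace H]

/-- `K_H^0(X)`, the Grothendieck group of the monoid of isomorphism classes. -/
abbrev K0 (X : GSpace.{u, v} H) : Type _ := Algebra.GrothendieckAddGroup (Vec X)

/-- The class `[E]` in `K_H^0(X)`. -/
def K0.mk {X : GSpace.{u, v} H} (E : EqBundle X) : K0 X :=
  Algebra.GrothendieckAddGroup.of (Vec.mk E)

/-- `f^* : K_H^0(X) → K_H^0(Y)` for `f : Y → X`. -/
def K0.map {X Y : GSpace.{u, v} H} (f : GMap Y X) : K0 X →+ K0 Y :=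
  Algebra.GrothendieckAddGroup.lift (Algebra.GrothendieckAddGroup.of.comp (Vec.map f))

theorem K0.map_of {X Y : GSpace.{u, v} H} (f : GMap Y X) (c : Vec X) :
    K0.map f (Algebra.GrothendieckAddGroup.of c) = Algebra.GrothendieckAddGroup.of (Vec.map f c) :=
  DFunLike.congr_fun (Algebra.GrothendieckAddGroup.lift.symm_apply_apply
    (Algebra.GrothendieckAddGroup.of.comp (Vec.map f))) c

theorem K0.map_map {X Y Z : GSpace.{u, v} H} (f : GMap Y X) (g : GMap Z Y) (k : K0 X) :
    K0.map g (K0.map f k) = K0.map (f.comp g) k := by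
  have : (K0.map g).comp (K0.map f) = K0.map (f.comp g) := by
    apply Algebra.GrothendieckAddGroup.lift.symm.injective
    ext c
    change K0.map g (K0.map f (Algebra.GrothendieckAddGroup.of c)) =
      K0.map (f.comp g) (Algebra.GrothendieckAddGroup.of c)
    rw [K0.map_of, K0.map_of, K0.map_of, Vec.map_map]
  exact DFunLike.congr_fun this k

/-- `K_H^n(X)`: the reduced group of `Σⁿ(X₊)`, i.e. the kernel of the restriction to the base
point. -/
def Kn [DiscreteTopology H] (n : ℕ) (X : GSpace.{u, v} H) : AddSubgroup (K0 (X.susp n)) :=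
  (K0.map (X.base n)).ker

/-- `f^* : K_H^n(X) → K_H^n(Y)` for `f : Y → X`. -/
def Kn.map [DiscreteTopology H] (n : ℕ) {X Y : GSpace.{u, v} H} (f : GMap Y X) :
    Kn n X →+ Kn n Y :=
  ((K0.map (f.susp n)).comp (Kn n X).subtype).codRestrict (Kn n Y) fun k => by
    change K0.map (Y.base n) (K0.map (f.susp n) k) = 0
    rw [K0.map_map]
    exact k.2

end KTheory

/-! ## Twisted equivariant K-theory -/

/-- Normalised 2-cocycles of `Q` with values in the circle (with trivial action). -/
structure Cocycle (Q : Type v) [Group Q] where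
  toFun : Q → Q → Circle
  cocycle : ∀ a b c, toFun a (b * c) * toFun b c = toFun (a * b) c * toFun a b
  one_left : ∀ q, toFun 1 q = 1
  one_right : ∀ q, toFun q 1 = 1

section Twisted

variable {Q : Type v} [Group Q]

/-- The central extension of `Q` by the circle defined by `α`: the set `Q × S¹` with the product
`(q₁, z₁) (q₂, z₂) = (q₁ q₂, α(q₁, q₂) z₁ z₂)`. -/
def Ext (_α : Cocycle Q) : Type v := Q × Circle

namespace Ext

variable (α : Cocycle Q)

instance [TopologicalSpace Q] : TopologicalSpace (Ext α) :=
  inferInstanceAs (TopologicalSpace (Q × Circle))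

instance : Group (Ext α) where
  mul a b := (a.1 * b.1, α.toFun a.1 b.1 * a.2 * b.2)
  one := (1, 1)
  inv a := (a.1⁻¹, (α.toFun a.1⁻¹ a.1 * a.2)⁻¹)
  mul_assoc a b c := by
    refine Prod.ext (mul_assoc a.1 b.1 c.1) ?_
    change α.toFun (a.1 * b.1) c.1 * (α.toFun a.1 b.1 * a.2 * b.2) * c.2 =
      α.toFun a.1 (b.1 * c.1) * a.2 * (α.toFun b.1 c.1 * b.2 * c.2)
    calc _ = (α.toFun (a.1 * b.1) c.1 * α.toFun a.1 b.1) * (a.2 * b.2 * c.2) := by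
          simp only [mul_assoc]
      _ = (α.toFun a.1 (b.1 * c.1) * α.toFun b.1 c.1) * (a.2 * b.2 * c.2) := by rw [α.cocycle]
      _ = _ := by simp only [mul_assoc, mul_left_comm]
  one_mul a := by
    refine Prod.ext (one_mul a.1) ?_
    change α.toFun 1 a.1 * 1 * a.2 = a.2
    rw [α.one_left, one_mul, one_mul]
  mul_one a := by
    refine Prod.ext (mul_one a.1) ?_
    change α.toFun a.1 1 * a.2 * 1 = a.2
    rw [α.one_right, one_mul, mul_one]
  inv_mul_cancel a := by
    refine Prod.ext (inv_mul_cancel a.1) ?_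
    change α.toFun a.1⁻¹ a.1 * (α.toFun a.1⁻¹ a.1 * a.2)⁻¹ * a.2 = 1
    rw [mul_inv, mul_inv_cancel_left, inv_mul_cancel]

/-- The projection to `Q`. -/
def proj : Ext α →* Q where
  toFun a := a.1
  map_one' := rfl
  map_mul' _ _ := rfl

/-- The element `z` of the central circle. -/
def central (z : Circle) : Ext α := (1, z)

theorem continuous_proj [TopologicalSpace Q] : Continuous (proj α) := continuous_fst

end Ext

variable [TopologicalSpace Q] (α : Cocycle Q)

/-- A `Q`-space as a space with an action of the central extension. -/
abbrev GSpace.ext (X : GSpace.{u, v} Q) : GSpace.{u, v} (Ext α) :=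
  X.comap (Ext.proj α) (Ext.continuous_proj α)

variable {α}

/-- The central circle acts on the fibres by multiplication by scalars. -/
def EqFamily.IsScalar {X : GSpace.{u, v} Q} (E : EqFamily (X.ext α)) : Prop :=
  ∀ (z : Circle) (x : X.ext α) (e : Ext.central α z • x = x) (v : E.Fib x),
    E.act (Ext.central α z) e v = (z : ℂ) • v

variable (α)

/-- The monoid of isomorphism classes of vector bundles over `X`, equivariant for the central
extension of `Q`, on which the central circle acts by multiplication by scalars. -/
def TwVec (X : GSpace.{u, v} Q) : AddSubmonoid (Vec (X.ext α)) where
  carrier := {c | ∃ E : EqBundle (X.ext α), E.fam.IsScalar ∧ Vec.mk E = c}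
  zero_mem' := ⟨⟨EqFamily.zero _, EqFamily.isBundle_zero _⟩, fun _ _ _ _ => rfl, rfl⟩
  add_mem' := by
    rintro _ _ ⟨E, hE, rfl⟩ ⟨F, hF, rfl⟩
    exact ⟨⟨E.fam.sum F.fam, E.isBundle.sum F.isBundle⟩,
      fun z x e v => Prod.ext (hE z x e v.1) (hF z x e v.2), rfl⟩

/-- Pullback of twisted bundles. -/
def TwVec.map {X Y : GSpace.{u, v} Q} (f : GMap Y X) : TwVec α X →+ TwVec α Y :=
  ((Vec.map (f.comap (Ext.proj α) (Ext.continuous_proj α))).comp (TwVec α X).subtype).codRestrict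
    (TwVec α Y) (by
      rintro ⟨_, E, hE, rfl⟩
      exact ⟨E.pullback (f.comap (Ext.proj α) (Ext.continuous_proj α)),
        fun z y _ v => hE z (f.toFun y) _ v, rfl⟩)

/-- The `α`-twisted `Q`-equivariant group `^αK_Q^0(X)`. -/
abbrev TwK0 (X : GSpace.{u, v} Q) : Type _ := Algebra.GrothendieckAddGroup (TwVec α X)

/-- The class in `^αK_Q^0(X)` of an `α`-twisted bundle. -/
def TwK0.mk {X : GSpace.{u, v} Q} (E : EqBundle (X.ext α)) (hE : E.fam.IsScalar) : TwK0 α X :=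
  Algebra.GrothendieckAddGroup.of (⟨Vec.mk E, E, hE, rfl⟩ : TwVec α X)

def TwK0.map {X Y : GSpace.{u, v} Q} (f : GMap Y X) : TwK0 α X →+ TwK0 α Y :=
  Algebra.GrothendieckAddGroup.lift (Algebra.GrothendieckAddGroup.of.comp (TwVec.map α f))

theorem TwK0.map_of {X Y : GSpace.{u, v} Q} (f : GMap Y X) (c : TwVec α X) :
    TwK0.map α f (Algebra.GrothendieckAddGroup.of c) =
      Algebra.GrothendieckAddGroup.of (TwVec.map α f c) :=
  DFunLike.congr_fun (Algebra.GrothendieckAddGroup.lift.symm_apply_apply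
    (Algebra.GrothendieckAddGroup.of.comp (TwVec.map α f))) c

theorem TwK0.map_map {X Y Z : GSpace.{u, v} Q} (f : GMap Y X) (g : GMap Z Y) (k : TwK0 α X) :
    TwK0.map α g (TwK0.map α f k) = TwK0.map α (f.comp g) k := by
  have : (TwK0.map α g).comp (TwK0.map α f) = TwK0.map α (f.comp g) := by
    apply Algebra.GrothendieckAddGroup.lift.symm.injective
    ext c
    have : TwVec.map α g (TwVec.map α f c) = TwVec.map α (f.comp g) c :=
      Subtype.ext (Vec.map_map (f.comap (Ext.proj α) (Ext.continuous_proj α))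
        (g.comap (Ext.proj α) (Ext.continuous_proj α)) c.1)
    change TwK0.map α g (TwK0.map α f (Algebra.GrothendieckAddGroup.of c)) =
      TwK0.map α (f.comp g) (Algebra.GrothendieckAddGroup.of c)
    rw [TwK0.map_of, TwK0.map_of, TwK0.map_of, this]
  exact DFunLike.congr_fun this k

/-- `^αK_Q^n(X)`: the reduced group of `Σⁿ(X₊)`, i.e. the kernel of the restriction to the base
point. -/
def TwKn [DiscreteTopology Q] (n : ℕ) (X : GSpace.{u, v} Q) : AddSubgroup (TwK0 α (X.susp n)) :=
  (TwK0.map α (X.base n)).ker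

/-- `f^* : ^αK_Q^n(X) → ^αK_Q^n(Y)` for `f : Y → X`. -/
def TwKn.map [DiscreteTopology Q] (n : ℕ) {X Y : GSpace.{u, v} Q} (f : GMap Y X) :
    TwKn α n X →+ TwKn α n Y :=
  ((TwK0.map α (f.susp n)).comp (TwKn α n X).subtype).codRestrict (TwKn α n Y) fun k => by
    change TwK0.map α (Y.base n) (TwK0.map α (f.susp n) k) = 0
    rw [TwK0.map_map]
    exact k.2

end Twisted

/-! ## Irreducible representations -/

section Representations

variable {A : Type v} [Group A]

/-- The linear representation on `ℂᵈ` given by a homomorphism `A → U(d)`. -/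
def unitaryRep {d : ℕ} (ρ : A →* Matrix.unitaryGroup (Fin d) ℂ) :
    Representation ℂ A (Fin d → ℂ) :=
  (Matrix.toLinAlgEquiv' : _ ≃ₐ[ℂ] ((Fin d → ℂ) →ₗ[ℂ] (Fin d → ℂ))).toMonoidHom.comp
    ((Matrix.unitaryGroup (Fin d) ℂ).subtype.comp ρ)

theorem unitaryRep_apply {d : ℕ} (ρ : A →* Matrix.unitaryGroup (Fin d) ℂ) (a : A)
    (v : Fin d → ℂ) : unitaryRep ρ a v = Matrix.mulVec (ρ a).1 v := rfl

/-- An irreducible unitary representation `τ : A → U(V_τ)`, on `V_τ = ℂᵈ`. -/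
structure IrrRep (A : Type v) [Group A] where
  d : ℕ
  ρ : A →* Matrix.unitaryGroup (Fin d) ℂ
  irr : (unitaryRep ρ).IsIrreducible

instance IrrRep.setoid (A : Type v) [Group A] : Setoid (IrrRep A) where
  r τ τ' := Nonempty ((unitaryRep τ.ρ).Equiv (unitaryRep τ'.ρ))
  iseqv := ⟨fun _ => ⟨.refl _⟩, fun ⟨i⟩ => ⟨i.symm⟩, fun ⟨i⟩ ⟨j⟩ => ⟨i.trans j⟩⟩

/-- `Irr(A)`, the set of isomorphism classes of complex irreducible representations of `A`. -/
def Irr (A : Type v) [Group A] : Type v := Quotient (IrrRep.setoid A)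

def Irr.mk (τ : IrrRep A) : Irr A := Quotient.mk _ τ

theorem IrrRep.d_pos (τ : IrrRep A) : 0 < τ.d := by
  rcases Nat.eq_zero_or_pos τ.d with h | h
  · exfalso
    have : IsEmpty (Fin τ.d) := by rw [h]; infer_instance
    obtain ⟨x, y, hxy⟩ := τ.irr.toNontrivial
    refine hxy (Subrepresentation.toSubmodule_injective ?_)
    exact Subsingleton.elim _ _
  · exact h

/-- Schur's lemma. -/
theorem IrrRep.schur (τ : IrrRep A) (N : Matrix (Fin τ.d) (Fin τ.d) ℂ)
    (h : ∀ a, N * (τ.ρ a).1 = (τ.ρ a).1 * N) : ∃ c : ℂ, N = c • 1 := by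
  have := τ.irr
  let f : (unitaryRep τ.ρ).IntertwiningMap (unitaryRep τ.ρ) :=
    ⟨Matrix.toLin' N, fun a => by
      have := congrArg Matrix.toLin' (h a)
      rwa [Matrix.toLin'_mul, Matrix.toLin'_mul] at this⟩
  obtain ⟨c, hc⟩ := (Representation.IsIrreducible.algebraMap_intertwiningMap_bijective_of_isAlgClosed
    (ρ := unitaryRep τ.ρ)).2 f
  refine ⟨c, Matrix.toLin'.injective (LinearMap.ext fun v => ?_)⟩
  have : (algebraMap ℂ ((unitaryRep τ.ρ).IntertwiningMap (unitaryRep τ.ρ)) c) v = f v := by rw [hc]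
  have h2 : Matrix.toLin' N v = c • v := this.symm
  rw [h2]
  simp

theorem IrrRep.schur_unitary (τ : IrrRep A) (N : Matrix.unitaryGroup (Fin τ.d) ℂ)
    (h : ∀ a, N * τ.ρ a = τ.ρ a * N) :
    ∃ z : Circle, N.1 = (z : ℂ) • (1 : Matrix (Fin τ.d) (Fin τ.d) ℂ) := by
  obtain ⟨c, hc⟩ := τ.schur N.1 fun a => congrArg Subtype.val (h a)
  have h1 : N.1 * star N.1 = 1 := Matrix.mem_unitaryGroup_iff.1 N.2
  have h2 : c * star c = 1 := by
    have := congrFun (congrFun h1 ⟨0, τ.d_pos⟩) ⟨0, τ.d_pos⟩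
    rw [hc] at this
    simpa [Matrix.star_eq_conjTranspose, Matrix.mul_apply, Matrix.one_apply, mul_comm] using this
  refine ⟨⟨c, ?_⟩, hc⟩
  change c ∈ Metric.sphere (0 : ℂ) 1
  rw [mem_sphere_zero_iff_norm]
  have h3 : ‖c‖ * ‖c‖ = 1 := by simpa using congrArg norm h2
  nlinarith [norm_nonneg c]

theorem IrrRep.scalar_inj (τ : IrrRep A) {w z : ℂ} {U : Matrix.unitaryGroup (Fin τ.d) ℂ} (h : w • U.1 = z • U.1) :
    w = z := by
  have h1 : (w • U.1) * star U.1 = (z • U.1) * star U.1 := by rw [h]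
  have hU : U.1 * star U.1 = 1 := Matrix.mem_unitaryGroup_iff.1 U.2
  rw [smul_mul_assoc, smul_mul_assoc, hU] at h1
  have := congrFun (congrFun h1 ⟨0, τ.d_pos⟩) ⟨0, τ.d_pos⟩
  simpa using this

/-- Isomorphic irreducible unitary representations are unitarily equivalent. -/
theorem exists_unitary {d : ℕ} (ρ' ρ : A →* Matrix.unitaryGroup (Fin d) ℂ)
    (h : (unitaryRep ρ').IsIrreducible) (e : (unitaryRep ρ').Equiv (unitaryRep ρ)) :
    ∃ M : Matrix.unitaryGroup (Fin d) ℂ, ∀ a : A, ρ' a = M⁻¹ * ρ a * M := by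
  let τ : IrrRep A := ⟨d, ρ', h⟩
  let T : Matrix (Fin d) (Fin d) ℂ := LinearMap.toMatrix' e.toLinearEquiv.toLinearMap
  have hT : ∀ a, T * (ρ' a).1 = (ρ a).1 * T := fun a => by
    apply Matrix.toLin'.injective
    rw [Matrix.toLin'_mul, Matrix.toLin'_mul, Matrix.toLin'_toMatrix']
    exact e.isIntertwining' a
  have hT' : ∀ a, star T * (ρ a).1 = (ρ' a).1 * star T := fun a => by
    have h1 := congrArg star (hT a⁻¹)
    rw [star_mul, star_mul, map_inv, map_inv] at h1
    have h2 : ∀ U : Matrix.unitaryGroup (Fin d) ℂ, star (U⁻¹).1 = U.1 := fun U => star_star U.1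
    rw [h2] at h1
    rw [h2] at h1
    exact h1.symm
  obtain ⟨c, hc⟩ := τ.schur (star T * T) fun a => by
    rw [mul_assoc, hT, ← mul_assoc, hT', mul_assoc]
  let i₀ : Fin d := ⟨0, τ.d_pos⟩
  have hc0 : c = ((∑ i, ‖T i i₀‖ ^ 2 : ℝ) : ℂ) := by
    have h1 : (star T * T) i₀ i₀ = (c • (1 : Matrix (Fin d) (Fin d) ℂ)) i₀ i₀ :=
      congrFun (congrFun hc i₀) i₀
    simp only [Matrix.mul_apply, Matrix.star_eq_conjTranspose, Matrix.conjTranspose_apply,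
      Matrix.smul_apply, Matrix.one_apply_eq, smul_eq_mul, mul_one] at h1
    rw [← h1]
    push_cast
    exact Finset.sum_congr rfl fun i _ => by
      rw [← Complex.conj_mul']; rfl
  set r : ℝ := ∑ i, ‖T i i₀‖ ^ 2 with hr
  have hr0 : 0 ≤ r := Finset.sum_nonneg fun i _ => by positivity
  have hrne : r ≠ 0 := by
    intro h0
    have hz : ∀ i, T i i₀ = 0 := fun i => by
      have := (Finset.sum_eq_zero_iff_of_nonneg (fun i _ => by positivity)).1 h0 i
        (Finset.mem_univ i)
      simpa using this
    have h1 : e.toLinearEquiv (Pi.single i₀ 1) = 0 := by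
      have : Matrix.toLin' T (Pi.single i₀ 1) = 0 := by
        ext i; simp [hz]
      rwa [show Matrix.toLin' T = _ from Matrix.toLin'_toMatrix' _] at this
    have h2 := (LinearEquiv.map_eq_zero_iff _).1 h1
    exact one_ne_zero ((Pi.single_eq_same (M := fun _ => ℂ) i₀ 1).symm.trans (congrFun h2 i₀))
  let s : ℂ := ((Real.sqrt r)⁻¹ : ℝ)
  have hs : star s * s * c = 1 := by
    rw [hc0]
    have : ((Real.sqrt r)⁻¹ * (Real.sqrt r)⁻¹ * r : ℝ) = 1 := by
      rw [← mul_inv, Real.mul_self_sqrt hr0, inv_mul_cancel₀ hrne]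
    simp only [s, Complex.star_def, Complex.conj_ofReal]
    exact_mod_cast this
  let M : Matrix.unitaryGroup (Fin d) ℂ := ⟨s • T, by
    rw [Matrix.mem_unitaryGroup_iff', star_smul, smul_mul_smul_comm]
    rw [hc, smul_smul, hs, one_smul]⟩
  refine ⟨M, fun a => ?_⟩
  rw [mul_assoc, eq_inv_mul_iff_mul_eq]
  apply Subtype.ext
  change (s • T) * (ρ' a).1 = (ρ a).1 * (s • T)
  rw [smul_mul_assoc, mul_smul_comm]
  exact congrArg (s • ·) (hT a)

end Representations

section Conjugation

variable {G : Type v} [Group G] {A : Subgroup G} [A.Normal]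

/-- The conjugate representation `(g · τ)(a) = τ(g⁻¹ a g)`. -/
def IrrRep.conj (g : G) (τ : IrrRep A) : IrrRep A where
  d := τ.d
  ρ := τ.ρ.comp (MulAut.conjNormal g⁻¹ : MulAut A).toMonoidHom
  irr := by
    let i : Subrepresentation (unitaryRep τ.ρ) ≃o Subrepresentation
        (unitaryRep (τ.ρ.comp (MulAut.conjNormal g⁻¹ : MulAut A).toMonoidHom)) :=
      { toFun := fun S => ⟨S.toSubmodule, fun a _ hv => S.apply_mem_toSubmodule _ hv⟩
        invFun := fun S => ⟨S.toSubmodule, fun a v hv => by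
          have := S.apply_mem_toSubmodule (MulAut.conjNormal g a) hv
          have e : (MulAut.conjNormal g⁻¹ : MulAut A) (MulAut.conjNormal g a) = a := by
            ext; simp
          change unitaryRep τ.ρ ((MulAut.conjNormal g⁻¹ : MulAut A) (MulAut.conjNormal g a)) v ∈ _
            at this
          rwa [e] at this⟩
        left_inv := fun _ => rfl
        right_inv := fun _ => rfl
        map_rel_iff' := Iff.rfl }
    exact i.isSimpleOrder_iff.1 τ.irr

/-- `G` acts on `Irr(A)` by conjugation. -/
instance : MulAction G (Irr A) where
  smul g := Quotient.map (IrrRep.conj g) (by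
    rintro τ τ' ⟨i⟩
    exact ⟨.mk i.toLinearEquiv fun a => i.isIntertwining' (MulAut.conjNormal g⁻¹ a)⟩)
  one_smul := by
    rintro ⟨τ⟩
    refine Quotient.sound ⟨.mk (LinearEquiv.refl ℂ (Fin τ.d → ℂ)) fun a => ?_⟩
    have : (MulAut.conjNormal (1 : G)⁻¹ : MulAut A) a = a := by simp
    change unitaryRep τ.ρ ((MulAut.conjNormal (1 : G)⁻¹ : MulAut A) a) = unitaryRep τ.ρ a
    rw [this]
  mul_smul g h := by
    rintro ⟨τ⟩
    refine Quotient.sound ⟨.mk (LinearEquiv.refl ℂ (Fin τ.d → ℂ)) fun a => ?_⟩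
    have : (MulAut.conjNormal (g * h)⁻¹ : MulAut A) a =
        (MulAut.conjNormal h⁻¹ : MulAut A) ((MulAut.conjNormal g⁻¹ : MulAut A) a) := by
      simp
    change unitaryRep τ.ρ ((MulAut.conjNormal (g * h)⁻¹ : MulAut A) a) = unitaryRep τ.ρ
      ((MulAut.conjNormal h⁻¹ : MulAut A) ((MulAut.conjNormal g⁻¹ : MulAut A) a))
    rw [this]

variable (A) in
/-- The set of orbits `G \ Irr(A)`. -/
abbrev IrrOrbits : Type v := MulAction.orbitRel.Quotient G (Irr A)

/-- `Q_[τ]`, the image in `Q = G/A` of the isotropy group `G_[τ]` of `[τ] ∈ Irr(A)`. -/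
def IrrRep.isotropy (τ : IrrRep A) : Subgroup (G ⧸ A) :=
  (MulAction.stabilizer G (Irr.mk τ)).map (QuotientGroup.mk' A)

/-- The choices made in the construction of the cocycle `α_τ`: a normalised section
`σ : Q_[τ] → G_[τ]` of the projection, and unitary matrices `M_q` with `M_1 = 1` such that
`τ(σ(q)⁻¹ a σ(q)) = M_q⁻¹ τ(a) M_q` for `a ∈ A`. -/
structure TwistChoice (τ : IrrRep A) where
  σ : τ.isotropy → G
  mk_σ : ∀ q, (σ q : G ⧸ A) = q
  σ_one : σ 1 = 1
  M : τ.isotropy → Matrix.unitaryGroup (Fin τ.d) ℂ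
  M_one : M 1 = 1
  M_spec : ∀ q (a : A), τ.ρ (MulAut.conjNormal (σ q)⁻¹ a) = (M q)⁻¹ * τ.ρ a * M q

namespace TwistChoice

/-- The choices can be made. -/
theorem exists_choice (τ : IrrRep A) : Nonempty (TwistChoice τ) := by
  classical
  have h : ∀ q : τ.isotropy, ∃ g : G, g • Irr.mk τ = Irr.mk τ ∧ (g : G ⧸ A) = q := by
    rintro ⟨_, g, hg, rfl⟩
    exact ⟨g, hg, rfl⟩
  choose σ₀ hσ₀ hσ₀' using h
  have hU : ∀ q : τ.isotropy, ∃ M : Matrix.unitaryGroup (Fin τ.d) ℂ, ∀ a : A,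
      τ.ρ (MulAut.conjNormal (σ₀ q)⁻¹ a) = M⁻¹ * τ.ρ a * M := fun q => by
    obtain ⟨e⟩ : Nonempty ((unitaryRep (τ.conj (σ₀ q)).ρ).Equiv (unitaryRep τ.ρ)) :=
      Quotient.exact (hσ₀ q)
    exact exists_unitary (τ.conj (σ₀ q)).ρ τ.ρ (τ.conj (σ₀ q)).irr e
  choose M₀ hM₀ using hU
  refine ⟨⟨fun q => if q = 1 then 1 else σ₀ q, fun q => ?_, if_pos rfl,
    fun q => if q = 1 then 1 else M₀ q, if_pos rfl, fun q a => ?_⟩⟩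
  · by_cases hq : q = 1
    · simp [hq]
    · simp only [if_neg hq, hσ₀']
  · by_cases hq : q = 1
    · simp [hq]
    · simp only [if_neg hq, hM₀]

variable {τ : IrrRep A} (c : TwistChoice τ)

/-- `χ(q₁, q₂) = σ(q₁q₂)⁻¹ σ(q₁) σ(q₂) ∈ A`. -/
def χ (q₁ q₂ : τ.isotropy) : A :=
  ⟨(c.σ (q₁ * q₂))⁻¹ * c.σ q₁ * c.σ q₂, by
    rw [← QuotientGroup.eq_one_iff]
    simp [c.mk_σ]⟩

/-- `τ(χ(q₁, q₂)) M_{q₂}⁻¹ M_{q₁}⁻¹ M_{q₁q₂}`, a scalar matrix. -/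
def N (q₁ q₂ : τ.isotropy) : Matrix.unitaryGroup (Fin τ.d) ℂ :=
  τ.ρ (c.χ q₁ q₂) * (c.M q₂)⁻¹ * (c.M q₁)⁻¹ * c.M (q₁ * q₂)

theorem M_mul (q : τ.isotropy) (a : A) :
    c.M q * τ.ρ (MulAut.conjNormal (c.σ q)⁻¹ a) = τ.ρ a * c.M q := by
  rw [c.M_spec]; group

theorem ρ_mul_M (q : τ.isotropy) (a : A) :
    τ.ρ a * c.M q = c.M q * τ.ρ (MulAut.conjNormal (c.σ q)⁻¹ a) := (c.M_mul q a).symm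

theorem N_comm (q₁ q₂ : τ.isotropy) (a : A) : c.N q₁ q₂ * τ.ρ a = τ.ρ a * c.N q₁ q₂ := by
  have key : ∀ (q : τ.isotropy) (b : A),
      (c.M q)⁻¹ * τ.ρ b = τ.ρ (MulAut.conjNormal (c.σ q)⁻¹ b) * (c.M q)⁻¹ := fun q b => by
    rw [c.M_spec]; group
  have h12 : c.M (q₁ * q₂) * τ.ρ a =
      τ.ρ (MulAut.conjNormal (c.σ (q₁ * q₂)) a) * c.M (q₁ * q₂) := by
    rw [c.ρ_mul_M]
    congr 2
    ext; simp
  unfold N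
  rw [mul_assoc, h12, ← mul_assoc, mul_assoc _ (c.M q₁)⁻¹, key, ← mul_assoc,
    mul_assoc _ (c.M q₂)⁻¹, key, ← mul_assoc, ← map_mul, ← mul_assoc, ← mul_assoc, ← mul_assoc,
    ← map_mul]
  congr 4
  ext
  simp [MulAut.conjNormal_apply, χ, mul_assoc]

/-- The value of the cocycle: the scalar by which `N` acts. -/
def α (q₁ q₂ : τ.isotropy) : Circle := (τ.schur_unitary (c.N q₁ q₂) (c.N_comm q₁ q₂)).choose

theorem N_eq (q₁ q₂ : τ.isotropy) :
    (c.N q₁ q₂).1 = (c.α q₁ q₂ : ℂ) • (1 : Matrix (Fin τ.d) (Fin τ.d) ℂ) :=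
  (τ.schur_unitary (c.N q₁ q₂) (c.N_comm q₁ q₂)).choose_spec

theorem α_mul (q₁ q₂ : τ.isotropy) :
    (c.α q₁ q₂ : ℂ) • ((c.M q₁).1 * (c.M q₂).1) = (c.M (q₁ * q₂)).1 * (τ.ρ (c.χ q₁ q₂)).1 := by
  have h : τ.ρ (c.χ q₁ q₂) * (c.M q₂)⁻¹ * (c.M q₁)⁻¹ * c.M (q₁ * q₂) = c.N q₁ q₂ := rfl
  have h2 : c.M (q₁ * q₂) * τ.ρ (c.χ q₁ q₂) =
      c.M (q₁ * q₂) * c.N q₁ q₂ * (c.M (q₁ * q₂))⁻¹ * (c.M q₁ * c.M q₂) := by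
    rw [← h]; group
  have h3 := congrArg Subtype.val h2
  have hM : (c.M (q₁ * q₂)).1 * ((c.M (q₁ * q₂))⁻¹).1 = 1 := by
    rw [← Submonoid.coe_mul, mul_inv_cancel]; rfl
  simp only [Submonoid.coe_mul, c.N_eq] at h3
  rw [h3, mul_smul_comm, mul_one, smul_mul_assoc, hM, smul_mul_assoc, one_mul]

theorem χ_mul (a b d : τ.isotropy) :
    c.χ (a * b) d * (MulAut.conjNormal (c.σ d)⁻¹ : MulAut A) (c.χ a b) =
      c.χ a (b * d) * c.χ b d := by
  ext
  simp [χ, mul_assoc]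

/-- The cocycle `α_τ ∈ Z²(Q_[τ], S¹)`, with
`α_τ(q₁, q₂) = τ(χ(q₁, q₂)) M_{q₂}⁻¹ M_{q₁}⁻¹ M_{q₁q₂}`. -/
def cocycle : Cocycle τ.isotropy where
  toFun := c.α
  cocycle a b d := by
    ext
    have h1 : ((c.α (a * b) d : ℂ) * (c.α a b : ℂ)) • ((c.M a).1 * (c.M b).1 * (c.M d).1) =
        (c.M (a * b * d)).1 * (τ.ρ (c.χ (a * b) d *
          (MulAut.conjNormal (c.σ d)⁻¹ : MulAut A) (c.χ a b))).1 := by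
      have hr := congrArg Subtype.val (c.ρ_mul_M d (c.χ a b))
      simp only [Submonoid.coe_mul] at hr
      rw [mul_smul, ← smul_mul_assoc, c.α_mul, mul_assoc, hr, ← mul_assoc, ← smul_mul_assoc,
        c.α_mul, map_mul, Submonoid.coe_mul, mul_assoc]
    have h2 : ((c.α a (b * d) : ℂ) * (c.α b d : ℂ)) • ((c.M a).1 * (c.M b).1 * (c.M d).1) =
        (c.M (a * b * d)).1 * (τ.ρ (c.χ a (b * d) * c.χ b d)).1 := by
      rw [mul_smul, mul_assoc (c.M a).1, ← mul_smul_comm, c.α_mul, ← mul_assoc, ← smul_mul_assoc,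
        c.α_mul, map_mul, Submonoid.coe_mul, mul_assoc, mul_assoc]
    rw [c.χ_mul, ← h2] at h1
    exact (τ.scalar_inj (U := c.M a * c.M b * c.M d) h1).symm
  one_left q := by
    ext
    refine τ.scalar_inj (U := c.M 1 * c.M q) ((c.α_mul 1 q).trans ?_)
    have : c.χ 1 q = 1 := by ext; simp [χ, c.σ_one]
    rw [this]
    simp [c.M_one]
  one_right q := by
    ext
    refine τ.scalar_inj (U := c.M q * c.M 1) ((c.α_mul q 1).trans ?_)
    have : c.χ q 1 = 1 := by ext; simp [χ, c.σ_one]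
    rw [this]
    simp [c.M_one]

end TwistChoice
end Conjugation

/-! ## The bundles `Hom_A(V_τ, E)` -/

section HomBundle

variable {G : Type v} [Group G] [TopologicalSpace G] {A : Subgroup G}

variable (A) in
/-- The subgroup `A` acts trivially on `X`. -/
def GSpace.TrivialOn (X : GSpace.{u, v} G) : Prop := ∀ (a : A) (x : X), (a : G) • x = x

theorem GSpace.out_smul {X : GSpace.{u, v} G} (hX : X.TrivialOn A) (g : G) (x : X) :
    (g : G ⧸ A).out • x = g • x := by
  obtain ⟨a, ha⟩ := QuotientGroup.mk_out_eq_mul A g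
  rw [ha, mul_smul, hX]

theorem GSpace.TrivialOn.susp [DiscreteTopology G] {X : GSpace.{u, v} G} (hX : X.TrivialOn A)
    (n : ℕ) : (X.susp n).TrivialOn A := by
  intro a t
  cases t using OnePoint.rec with
  | infty => rfl
  | coe p => exact congrArg (fun y => OnePoint.some (p.1, y)) (hX a p.2)

variable [A.Normal]

variable {τ : IrrRep A}

/-- The fibre `Hom_A(V_τ, E_x)`. -/
def homAFib {X : GSpace.{u, v} G} (hX : X.TrivialOn A) (τ : IrrRep A) (E : EqFamily X) (x : X) :
    Submodule ℂ ((Fin τ.d → ℂ) →ₗ[ℂ] E.Fib x) where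
  carrier := {f | ∀ (a : A) (v : Fin τ.d → ℂ),
    f (unitaryRep τ.ρ a v) = E.act (a : G) (hX a x) (f v)}
  zero_mem' a v := by simp
  add_mem' {f g} hf hg a v := by simp [hf a v, hg a v]
  smul_mem' z f hf a v := by simp [hf a v]

/-- The map `Hom_A(V_τ, E_x) → Hom_A(V_τ, E_y)`, `f ↦ (v ↦ z σ(q) f(M_q⁻¹ v))`, where
`y = σ(q) x`. -/
def homAAct (c : TwistChoice τ) {X : GSpace.{u, v} G} (hX : X.TrivialOn A) (E : EqFamily X)
    (q : τ.isotropy) (z : Circle) {x y : X} (h : c.σ q • x = y) :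
    homAFib hX τ E x →ₗ[ℂ] homAFib hX τ E y where
  toFun f := ⟨(z : ℂ) • (E.act (c.σ q) h ∘ₗ f.1 ∘ₗ Matrix.toLin' ((c.M q)⁻¹).1), fun a v => by
    have h1 : Matrix.toLin' ((c.M q)⁻¹).1 (unitaryRep τ.ρ a v) =
        unitaryRep τ.ρ (MulAut.conjNormal (c.σ q)⁻¹ a) (Matrix.toLin' ((c.M q)⁻¹).1 v) := by
      have h2 : (c.M q)⁻¹ * τ.ρ a = τ.ρ (MulAut.conjNormal (c.σ q)⁻¹ a) * (c.M q)⁻¹ := by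
        rw [c.M_spec]; group
      have h3 := congrArg Subtype.val h2
      simp only [Submonoid.coe_mul] at h3
      rw [unitaryRep_apply, unitaryRep_apply, Matrix.toLin'_apply, Matrix.toLin'_apply,
        Matrix.mulVec_mulVec, Matrix.mulVec_mulVec, h3]
    simp only [LinearMap.smul_apply, LinearMap.comp_apply, map_smul]
    rw [h1, f.2 (MulAut.conjNormal (c.σ q)⁻¹ a)]
    have e₁ : (c.σ q * ((MulAut.conjNormal (c.σ q)⁻¹ : MulAut A) a : G)) • x = y := by
      rw [mul_smul, hX, h]
    have e₂ : ((a : G) * c.σ q) • x = y := by rw [mul_smul, h, hX]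
    rw [← E.act_mul _ _ (hX _ x) h e₁, ← E.act_mul _ _ h (hX a y) e₂,
      E.act_congr (by simp [mul_assoc]) e₁ e₂]⟩
  map_add' f g := by ext v; simp
  map_smul' w f := by
    ext v
    simp [smul_comm w]

theorem homAAct_one (c : TwistChoice τ) {X : GSpace.{u, v} G} (hX : X.TrivialOn A)
    (E : EqFamily X) {x : X} (z : Circle) (h : c.σ 1 • x = x) (f : homAFib hX τ E x) :
    homAAct c hX E 1 z h f = (z : ℂ) • f := by
  ext v
  have h1 : ∀ w, E.act (c.σ 1) h w = w := fun w =>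
    (E.act_congr c.σ_one h (one_smul G x) w).trans (E.act_one _ w)
  simp [homAAct, h1, c.M_one]

theorem homAAct_mul (c : TwistChoice τ) {X : GSpace.{u, v} G} (hX : X.TrivialOn A)
    (E : EqFamily X) (q r : τ.isotropy) (w z : Circle) {x x' y : X} (h : c.σ r • x = x')
    (h' : c.σ q • x' = y) (h'' : c.σ (q * r) • x = y) (f : homAFib hX τ E x) :
    homAAct c hX E (q * r) (c.α q r * w * z) h'' f =
      homAAct c hX E q w h' (homAAct c hX E r z h f) := by
  apply Subtype.ext
  apply LinearMap.ext
  intro v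
  change ((c.α q r * w * z : Circle) : ℂ) • E.act (c.σ (q * r)) h''
      (f.1 (Matrix.toLin' ((c.M (q * r))⁻¹).1 v)) =
    (w : ℂ) • E.act (c.σ q) h' ((z : ℂ) • E.act (c.σ r) h
      (f.1 (Matrix.toLin' ((c.M r)⁻¹).1 (Matrix.toLin' ((c.M q)⁻¹).1 v))))
  have e₁ : (c.σ q * c.σ r) • x = y := by rw [mul_smul, h, h']
  have e₂ : (c.σ (q * r) * (c.χ q r : G)) • x = y := by rw [mul_smul, hX, h'']
  rw [map_smul, ← E.act_mul _ _ h h' e₁,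
    E.act_congr (by simp [TwistChoice.χ, mul_assoc]) e₁ e₂, E.act_mul _ _ (hX _ x) h'' e₂,
    ← f.2 (c.χ q r)]
  have h1 : τ.ρ (c.χ q r) * ((c.M r)⁻¹ * (c.M q)⁻¹) = c.N q r * (c.M (q * r))⁻¹ := by
    unfold TwistChoice.N; group
  have h2 := congrArg Subtype.val h1
  simp only [Submonoid.coe_mul, c.N_eq, smul_mul_assoc, one_mul] at h2
  have h3 : unitaryRep τ.ρ (c.χ q r) (Matrix.toLin' ((c.M r)⁻¹).1
      (Matrix.toLin' ((c.M q)⁻¹).1 v)) =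
      (c.α q r : ℂ) • Matrix.toLin' ((c.M (q * r))⁻¹).1 v := by
    have h4 := congrArg (fun U => Matrix.mulVec U v) h2
    simpa only [unitaryRep_apply, Matrix.toLin'_apply, Matrix.mulVec_mulVec, Matrix.smul_mulVec]
      using h4
  rw [h3, map_smul, map_smul, smul_smul, smul_smul, Circle.coe_mul, Circle.coe_mul]
  congr 1
  ring

instance [DiscreteTopology G] : DiscreteTopology (G ⧸ A) :=
  discreteTopology_iff_forall_isOpen.2 fun _ =>
    (QuotientGroup.isQuotientMap_mk A).isOpen_preimage.1 (isOpen_discrete _)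

variable [DiscreteTopology G]

/-- A `G`-space on which `A` acts trivially is a `G/A`-space: a coset acts as any of its elements
does. -/
def GSpace.quot (X : GSpace.{u, v} G) (hX : X.TrivialOn A) : GSpace.{u, v} (G ⧸ A) :=
  letI : MulAction (G ⧸ A) X :=
    { smul := fun q x => q.out • x
      one_smul := fun x => (GSpace.out_smul hX 1 x).trans (one_smul G x)
      mul_smul := fun q r x => by
        obtain ⟨g, rfl⟩ := QuotientGroup.mk_surjective q
        obtain ⟨h, rfl⟩ := QuotientGroup.mk_surjective r
        change ((g * h : G) : G ⧸ A).out • x = (g : G ⧸ A).out • (h : G ⧸ A).out • x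
        rw [GSpace.out_smul hX, GSpace.out_smul hX, GSpace.out_smul hX, mul_smul] }
  { carrier := X
    cont := ⟨continuous_prod_of_discrete_left.2 fun q => continuous_const_smul q.out⟩ }

theorem GSpace.quot_smul {X : GSpace.{u, v} G} (hX : X.TrivialOn A) (g : G) (x : X.quot hX) :
    (g : G ⧸ A) • x = (g • (show X from x) : X) := GSpace.out_smul hX g x

/-- A `G`-space on which `A` acts trivially, as a `Q_[τ]`-space. -/
def GSpace.res (X : GSpace.{u, v} G) (hX : X.TrivialOn A) (τ : IrrRep A) :
    GSpace.{u, v} τ.isotropy :=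
  (X.quot hX).comap τ.isotropy.subtype continuous_subtype_val

/-- A `G`-map as a `Q_[τ]`-map. -/
def GMap.res {X Y : GSpace.{u, v} G} (f : GMap X Y) (hX : X.TrivialOn A) (hY : Y.TrivialOn A)
    (τ : IrrRep A) : GMap (X.res hX τ) (Y.res hY τ) where
  toFun := f.toFun
  continuous := f.continuous
  map_smul q x := f.map_smul (q : G ⧸ A).out x

theorem TwistChoice.σ_smul (c : TwistChoice τ) {X : GSpace.{u, v} G} (hX : X.TrivialOn A)
    {p : Ext c.cocycle} {x y : (X.res hX τ).ext c.cocycle} (h : p • x = y) :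
    c.σ (Ext.proj c.cocycle p) • (show X from x) = (show X from y) := by
  have h1 := GSpace.quot_smul hX (c.σ (Ext.proj c.cocycle p)) x
  rw [c.mk_σ] at h1
  exact h1.symm.trans h

/-- The family `Hom_A(V_τ, E)` over `X`, with the action of the central extension of `Q_[τ]`
defined by `α_τ`, `((q, z) f)(v) = z σ(q) f(M_q⁻¹ v)`. A linear map `f : V_τ → E_x` is topologised
through the point `x` and the values `f(v) ∈ E`. -/
def homA (c : TwistChoice τ) {X : GSpace.{u, v} G} (hX : X.TrivialOn A) (E : EqFamily X) :
    EqFamily ((X.res hX τ).ext c.cocycle) where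
  Fib x := homAFib hX τ E x
  acg x := (homAFib hX τ E x).addCommGroup
  mod x := (homAFib hX τ E x).module
  top := TopologicalSpace.induced
    (fun t => ((t.proj : X), fun v : Fin τ.d → ℂ => (⟨t.proj, t.snd.1 v⟩ : E.Tot))) inferInstance
  act p _ _ h := homAAct c hX E p.1 p.2 (c.σ_smul hX h)
  act_one e f := (homAAct_one c hX E 1 (c.σ_smul hX e) f).trans
    ((congrArg (· • f) Circle.coe_one).trans (one_smul ℂ f))
  act_mul g h _ _ _ hxy hyz hxz f := homAAct_mul c hX E g.1 h.1 g.2 h.2 (c.σ_smul hX hxy)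
    (c.σ_smul hX hyz) (c.σ_smul hX hxz) f

theorem homA_isScalar (c : TwistChoice τ) {X : GSpace.{u, v} G} (hX : X.TrivialOn A)
    (E : EqFamily X) : (homA c hX E).IsScalar := fun z _ e f =>
  homAAct_one c hX E z (c.σ_smul hX e) f

end HomBundle
end EqK
end

noncomputable section

namespace EqK

/-! ## Complex representations of finite groups -/

section Representations

variable {A : Type v} [Group A]

/-! Since `A` acts trivially on `X`, each fibre E_x is a representation of `A` and splits into
isotypic parts V_π ⊗ Hom_A(V_π, E_x). An element g of `G` carries the π-part of E_x to the gπ-part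
of E_{gx}, so the parts belonging to one orbit are determined by those of a single representative τ
and by the action of G_[τ] on V_τ ⊗ Hom_A(V_τ, E). This is Clifford theory in families. Its core is
`homVec_bijective`: taking E to the family of all Hom_A(V_{τ_o}, E) is a bijection from isomorphism
classes of `G`-bundles to families of isomorphism classes of twisted bundles.

The inverse is induction. The operators R_k = M_q τ(σ(q)⁻¹k) extend τ to a projective representation
of G_[τ] with multiplier inverse to α_τ (`TwistChoice.R_mul`), while on a twisted bundle F the
elements (q, 1) multiply with multiplier α_τ (`TwistChoice.lift_mul`). On V_τ ⊗ F the two cancel, so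
G_[τ] acts honestly (`twAct_mul`), and `ind` is the sum over o of the bundles induced from G_[τ_o]
to `G`. Restricted to `A`, its components are multiples of the pairwise non-isomorphic conjugates
t_j τ_o, so Schur's lemma identifies F_o with Hom_A(V_{τ_o}, ind F) (`indHomIso`). Conversely,
evaluation of homomorphisms extends to an equivariant map from the bundle induced from the
Hom_A(V_{τ_o}, E) to E. By complete reducibility, and because the τ_o meet every orbit, its
bijectivity can be tested on homomorphisms out of the V_{τ_o} (`injective_of_homAFib`,
`surjective_of_homAFib`), which gives `indEvIso`.

Topologically, two facts suffice. The fibres of Hom_A(V_τ, E) are the images of averaging over `A`,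
a continuous family of projections in charts, and such images are locally trivial
(`exists_isChart_of_projection`). A continuous fibrewise linear bijection of bundles has a
continuous inverse, because matrix inversion is continuous (`HasCharts.continuous_symm`).

The bijection is additive and there are finitely many orbits, so it passes to Grothendieck groups,
which respect finite products (`grothendieckMap_bijective`). It commutes with pullbacks; applied to
the inclusion of the base point of Σⁿ(X₊), and combined with the isomorphism over a point, this
restricts it to the reduced groups (`homKn_bijective`). -/

open scoped MatrixOrder ComplexOrder in
/-- A complex representation of a finite group on `ℂᵈ` is conjugate to a unitary one. -/
theorem exists_unitaryRep_conj [Finite A] {d : ℕ} (ρ : Representation ℂ A (Fin d → ℂ)) :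
    ∃ (U : A →* Matrix.unitaryGroup (Fin d) ℂ) (B : (Fin d → ℂ) ≃ₗ[ℂ] (Fin d → ℂ)),
      ∀ a v, B (ρ a v) = unitaryRep U a (B v) := by
  classical
  have := Fintype.ofFinite A
  let R : A → Matrix (Fin d) (Fin d) ℂ := fun a => LinearMap.toMatrix' (ρ a)
  have hR1 : R 1 = 1 := by simp [R]
  have hRm : ∀ a b, R (a * b) = R a * R b := fun a b => by
    simp only [R, map_mul]
    exact LinearMap.toMatrix'_comp _ _
  -- The Hermitian form averaged over `A` is invariant (`hHinv`). Conjugation by its positive square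
  -- root makes the representation unitary.
  let H : Matrix (Fin d) (Fin d) ℂ := ∑ a, (R a).conjTranspose * R a
  have hH : H.PosDef := by
    -- The summand at `1` is the identity matrix; it makes the positive semidefinite sum definite.
    have h1 : H = 1 + ∑ a ∈ Finset.univ.erase (1 : A), (R a).conjTranspose * R a := by
      simp only [H]
      rw [← Finset.add_sum_erase _ _ (Finset.mem_univ (1 : A)), hR1]
      simp
    rw [h1]
    refine Matrix.PosDef.add_posSemidef Matrix.PosDef.one ?_
    exact Matrix.posSemidef_sum _ fun a _ => Matrix.posSemidef_conjTranspose_mul_self (R a)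
  have hHinv : ∀ b, (R b).conjTranspose * H * R b = H := fun b => by
    simp only [H, Finset.mul_sum, Finset.sum_mul]
    rw [← Equiv.sum_comp (Equiv.mulRight b) (fun a => (R a).conjTranspose * R a)]
    refine Finset.sum_congr rfl fun a _ => ?_
    simp [hRm, Matrix.mul_assoc]
  have hnn : (0 : Matrix (Fin d) (Fin d) ℂ) ≤ H :=
    Matrix.nonneg_iff_posSemidef.2 hH.posSemidef
  let S := CFC.sqrt H
  have hSS : S * S = H := CFC.sqrt_mul_sqrt_self H hnn
  have hS : S.conjTranspose = S :=
    (Matrix.nonneg_iff_posSemidef.1 (CFC.sqrt_nonneg H)).isHermitian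
  have hSu : IsUnit S := by
    have h1 : IsUnit (S * S) := hSS ▸ hH.isUnit
    have h2 := (Matrix.isUnit_iff_isUnit_det _).1 h1
    rw [Matrix.det_mul] at h2
    exact (Matrix.isUnit_iff_isUnit_det _).2 (isUnit_of_mul_isUnit_left h2)
  have hSd := (Matrix.isUnit_iff_isUnit_det _).1 hSu
  have hS1 : S * S⁻¹ = 1 := Matrix.mul_nonsing_inv S hSd
  have hS2 : S⁻¹ * S = 1 := Matrix.nonsing_inv_mul S hSd
  have hSi : (S⁻¹).conjTranspose = S⁻¹ := by rw [Matrix.conjTranspose_nonsing_inv, hS]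
  let U : A →* Matrix.unitaryGroup (Fin d) ℂ :=
    { toFun := fun a => ⟨S * R a * S⁻¹, by
        rw [Matrix.mem_unitaryGroup_iff', Matrix.star_eq_conjTranspose]
        simp only [Matrix.conjTranspose_mul, hS, hSi]
        calc _ = S⁻¹ * ((R a).conjTranspose * (S * S) * R a) * S⁻¹ := by
              simp only [Matrix.mul_assoc]
          _ = S⁻¹ * (S * S) * S⁻¹ := by rw [hSS, hHinv]
          _ = 1 := by rw [← Matrix.mul_assoc, hS2, Matrix.one_mul, hS1]⟩
      map_one' := Subtype.ext (by simp [hR1, hS1])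
      map_mul' := fun a b => Subtype.ext (by
        change S * R (a * b) * S⁻¹ = (S * R a * S⁻¹) * (S * R b * S⁻¹)
        calc _ = S * R a * (1 : Matrix (Fin d) (Fin d) ℂ) * R b * S⁻¹ := by
              rw [hRm, Matrix.mul_one]; simp only [Matrix.mul_assoc]
          _ = _ := by rw [← hS2]; simp only [Matrix.mul_assoc]) }
  refine ⟨U, LinearEquiv.ofLinearMap (Matrix.toLin' S) (Matrix.toLin' S⁻¹)
    (by rw [← Matrix.toLin'_mul, hS1, Matrix.toLin'_one])
    (by rw [← Matrix.toLin'_mul, hS2, Matrix.toLin'_one]), fun a v => ?_⟩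
  have h1 : ρ a v = (R a).mulVec v := (LinearMap.toMatrix'_mulVec (ρ a) v).symm
  change S.mulVec (ρ a v) = (S * R a * S⁻¹).mulVec (S.mulVec v)
  rw [h1, Matrix.mulVec_mulVec, Matrix.mulVec_mulVec, Matrix.mul_assoc, hS2, Matrix.mul_one]

/-- A nonzero stable subspace of a finite-dimensional representation of a finite group receives a
nonzero equivariant map from an irreducible representation. -/
theorem exists_irrRep_hom [Finite A] {W : Type*} [AddCommGroup W] [Module ℂ W]
    [FiniteDimensional ℂ W] (ρ : Representation ℂ A W) (S : Submodule ℂ W)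
    (hS : ∀ (a : A), ∀ v ∈ S, ρ a v ∈ S) (hS0 : S ≠ ⊥) :
    ∃ (π : IrrRep A) (f : (Fin π.d → ℂ) →ₗ[ℂ] W), f ≠ 0 ∧ (∀ v, f v ∈ S) ∧
      ∀ a v, f (unitaryRep π.ρ a v) = ρ a (f v) := by
  -- A minimal nonzero stable subspace is irreducible. It is then put in coordinates and made
  -- unitary, as `IrrRep` demands.
  let P : Set (Submodule ℂ W) := {T | T ≤ S ∧ T ≠ ⊥ ∧ ∀ (a : A), ∀ v ∈ T, ρ a v ∈ T}
  obtain ⟨T, ⟨hTS, hT0, hTa⟩, hmin⟩ := WellFounded.has_min (wellFounded_lt (α := Submodule ℂ W)) P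
    ⟨S, le_rfl, hS0, hS⟩
  let r : Subrepresentation ρ := ⟨T, fun a v hv => hTa a v hv⟩
  let b : T ≃ₗ[ℂ] (Fin (Module.finrank ℂ T) → ℂ) := (Module.finBasis ℂ T).equivFun
  let ρ' : Representation ℂ A (Fin (Module.finrank ℂ T) → ℂ) :=
    { toFun := fun a => b.toLinearMap ∘ₗ r.toRepresentation a ∘ₗ b.symm.toLinearMap
      map_one' := by ext; simp
      map_mul' := fun x y => by
        apply LinearMap.ext
        intro v
        simp }
  obtain ⟨U, B, hB⟩ := exists_unitaryRep_conj ρ'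
  let j : (Fin (Module.finrank ℂ T) → ℂ) →ₗ[ℂ] W :=
    T.subtype ∘ₗ b.symm.toLinearMap ∘ₗ B.symm.toLinearMap
  have hj : ∀ a v, j (unitaryRep U a v) = ρ a (j v) := fun a v => by
    have h1 : B.symm (unitaryRep U a v) = ρ' a (B.symm v) := by
      rw [LinearEquiv.symm_apply_eq, hB, LinearEquiv.apply_symm_apply]
    change ((b.symm (B.symm (unitaryRep U a v)) : T) : W) = ρ a (b.symm (B.symm v) : T)
    rw [h1]
    change ((b.symm (b (r.toRepresentation a (b.symm (B.symm v)))) : T) : W) = _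
    rw [LinearEquiv.symm_apply_apply]
    rfl
  have hjinj : Function.Injective j :=
    Subtype.val_injective.comp (b.symm.injective.comp B.symm.injective)
  have hjT : ∀ v, j v ∈ T := fun v => (b.symm (B.symm v)).2
  have hjsurj : ∀ w ∈ T, ∃ v, j v = w := fun w hw => ⟨B (b ⟨w, hw⟩), by simp [j]⟩
  have hpos : ∃ w ∈ T, w ≠ 0 := T.ne_bot_iff.1 hT0
  have hne : j ≠ 0 := by
    obtain ⟨w, hw, hw0⟩ := hpos
    obtain ⟨v, rfl⟩ := hjsurj w hw
    exact fun h => hw0 (by rw [h]; rfl)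
  have hnt : Nontrivial (Subrepresentation (unitaryRep U)) := by
    refine ⟨⟨⊥, ⊤, fun h => hne ?_⟩⟩
    have h2 : (⊥ : Submodule ℂ (Fin (Module.finrank ℂ T) → ℂ)) = ⊤ :=
      congrArg Subrepresentation.toSubmodule h
    refine LinearMap.ext fun v => ?_
    have : v ∈ (⊥ : Submodule ℂ (Fin (Module.finrank ℂ T) → ℂ)) := h2 ▸ Submodule.mem_top
    rw [(Submodule.mem_bot ℂ).1 this]
    simp
  refine ⟨⟨_, U, { toNontrivial := hnt, eq_bot_or_eq_top := fun R => ?_ }⟩, j, hne,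
    fun v => hTS (hjT v), hj⟩
  by_cases hR : R.toSubmodule = ⊥
  · exact Or.inl (Subrepresentation.toSubmodule_injective hR)
  -- The injective map `j` sends a nonzero stable subspace to a member of `P` inside `T`, hence onto
  -- `T` by minimality.
  · refine Or.inr (Subrepresentation.toSubmodule_injective ?_)
    have hle : R.toSubmodule.map j ≤ T := by
      rintro _ ⟨v, -, rfl⟩
      exact hjT v
    have hm : R.toSubmodule.map j ∈ P := by
      refine ⟨hle.trans hTS, fun h => hR ?_, ?_⟩
      · exact Submodule.map_injective_of_injective hjinj (h.trans (Submodule.map_bot j).symm)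
      · rintro a _ ⟨v, hv, rfl⟩
        exact ⟨_, R.apply_mem_toSubmodule a hv, hj a v⟩
    have heq : R.toSubmodule.map j = T := by
      by_contra hc
      exact hmin _ hm (lt_of_le_of_ne hle hc)
    refine (Submodule.eq_top_iff'.2 fun v => ?_)
    have : j v ∈ R.toSubmodule.map j := by rw [heq]; exact hjT v
    obtain ⟨w, hw, h⟩ := this
    exact hjinj h ▸ hw

/-- A finite group has finitely many classes of irreducible representations. -/
theorem finite_irr [Finite A] : Finite (Irr A) := by
  classical
  have := Fintype.ofFinite A
  have hcard : (Nat.card A : ℂ) ≠ 0 := Nat.cast_ne_zero.2 Nat.card_pos.ne'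
  have : Invertible (Nat.card A : ℂ) := invertibleOfNonzero hcard
  let χ : Irr A → (A → ℂ) := fun o => (unitaryRep o.out.ρ).character
  have horth : ∀ o o' : Irr A, (Nat.card A : ℂ)⁻¹ * ∑ g : A, χ o g * χ o' g⁻¹ =
      if o = o' then 1 else 0 := fun o o' => by
    have := o.out.irr
    have := o'.out.irr
    have h := Representation.char_orthonormal (ρ := unitaryRep o.out.ρ) (σ := unitaryRep o'.out.ρ)
    refine h.trans ?_
    congr 1
    refine propext ⟨fun h => ?_, fun h => by subst h; exact ⟨.refl _⟩⟩
    exact ((Quotient.out_eq o').symm.trans ((Quotient.sound h).trans (Quotient.out_eq o))).symm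
  -- Pairing with the character of `o` isolates the coefficient of `o`. The characters are thus
  -- independent in the finite-dimensional space of functions on `A`.
  have hli : LinearIndependent ℂ χ := by
    rw [linearIndependent_iff']
    intro s c hc o ho
    let L : (A → ℂ) →ₗ[ℂ] ℂ :=
      { toFun := fun f => (Nat.card A : ℂ)⁻¹ * ∑ g : A, f g * χ o g⁻¹
        map_add' := fun f f' => by simp [add_mul, Finset.sum_add_distrib, mul_add]
        map_smul' := fun z f => by
          simp only [Pi.smul_apply, smul_eq_mul, RingHom.id_apply, mul_assoc, ← Finset.mul_sum]
          ring }
    have h1 := congrArg L hc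
    rw [map_sum, map_zero] at h1
    have h2 : ∀ o', L (c o' • χ o') = if o' = o then c o' else 0 := fun o' => by
      rw [map_smul]
      change c o' • ((Nat.card A : ℂ)⁻¹ * ∑ g : A, χ o' g * χ o g⁻¹) = _
      rw [horth]
      split_ifs <;> simp
    simp only [h2] at h1
    simpa [ho] using h1
  exact hli.finite

end Representations

/-! ### Schur's lemma with multiplicity spaces -/

section Schur

variable {G : Type v} [Group G] {A : Subgroup G} {F : Type*} [AddCommGroup F]
  [Module ℂ F]

/-- A nonzero equivariant map from `V_π` to `V_{gτ} ⊗ F`, where `A` acts trivially on `F`, exists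
only if `π` is isomorphic to `gτ`. -/
theorem irr_mk_eq_of_hom_ne_zero [A.Normal] (π τ : IrrRep A) (g : G)
    (f : (Fin π.d → ℂ) →ₗ[ℂ] (Fin τ.d → F))
    (hf : ∀ (a : A) v i, f (unitaryRep π.ρ a v) i =
      ∑ l, (τ.ρ (MulAut.conjNormal g⁻¹ a)).1 i l • f v l) (h0 : f ≠ 0) :
    Irr.mk π = g • Irr.mk τ := by
  obtain ⟨v, hv⟩ : ∃ v, f v ≠ 0 := by
    by_contra h
    push Not at h
    exact h0 (LinearMap.ext h)
  obtain ⟨i, hi⟩ : ∃ i, f v i ≠ 0 := by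
    by_contra h
    push Not at h
    exact hv (funext h)
  -- A functional that does not vanish on the chosen coordinate collapses `F` to `ℂ` and leaves a
  -- nonzero intertwiner between irreducible representations.
  obtain ⟨ℓ, hℓ⟩ : ∃ ℓ : Module.Dual ℂ F, ℓ (f v i) ≠ 0 := by
    by_contra h
    push Not at h
    exact hi ((Module.forall_dual_apply_eq_zero_iff ℂ _).1 h)
  let φ : (unitaryRep π.ρ).IntertwiningMap (unitaryRep (τ.conj g).ρ) :=
    ⟨ℓ.compLeft (Fin τ.d) ∘ₗ f, fun a => by
      have key : ∀ w (k : Fin τ.d), ℓ (f (unitaryRep π.ρ a w) k) =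
          Matrix.mulVec (τ.ρ (MulAut.conjNormal g⁻¹ a)).1 (fun l => ℓ (f w l)) k := fun w k => by
        rw [hf, map_sum]
        simp [Matrix.mulVec, dotProduct]
      exact LinearMap.ext fun w => funext fun k => key w k⟩
  have := π.irr
  have := (τ.conj g).irr
  rcases Representation.IsIrreducible.bijective_or_eq_zero φ with h | h
  · exact Quotient.sound ⟨φ.ofBijective h⟩
  · exfalso
    apply hℓ
    have := congrArg (fun ψ : (unitaryRep π.ρ).IntertwiningMap (unitaryRep (τ.conj g).ρ) =>
      ψ v) h
    exact congrFun this i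

/-- An equivariant map from `V_τ` to `V_τ ⊗ F`, where `A` acts trivially on `F`, is `v ↦ v ⊗ u`
for some `u ∈ F`. -/
theorem exists_eq_smul_of_hom (τ : IrrRep A) (f : (Fin τ.d → ℂ) →ₗ[ℂ] (Fin τ.d → F))
    (hf : ∀ (a : A) v i, f (unitaryRep τ.ρ a v) i = ∑ l, (τ.ρ a).1 i l • f v l) :
    ∃ u : F, ∀ v i, f v i = v i • u := by
  classical
  let i₀ : Fin τ.d := ⟨0, τ.d_pos⟩
  -- The only candidate for `u` is this coordinate of the image of a basis vector. The identity is
  -- tested against all functionals on `F`; each turns `f` into an endomorphism of V_τ, which is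
  -- scalar by Schur's lemma.
  refine ⟨f (Pi.single i₀ 1) i₀, fun v i => ?_⟩
  rw [← sub_eq_zero]
  refine (Module.forall_dual_apply_eq_zero_iff ℂ _).1 fun ℓ => ?_
  let φ : (Fin τ.d → ℂ) →ₗ[ℂ] (Fin τ.d → ℂ) := ℓ.compLeft (Fin τ.d) ∘ₗ f
  obtain ⟨c, hc⟩ := τ.schur (LinearMap.toMatrix' φ) fun a => by
    apply Matrix.toLin'.injective
    rw [Matrix.toLin'_mul, Matrix.toLin'_mul, Matrix.toLin'_toMatrix']
    apply LinearMap.ext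
    intro w
    funext k
    change ℓ (f (unitaryRep τ.ρ a w) k) = Matrix.mulVec (τ.ρ a).1 (fun l => ℓ (f w l)) k
    rw [hf, map_sum]
    simp [Matrix.mulVec, dotProduct]
  have hφ : ∀ w, φ w = c • w := fun w => by
    rw [← LinearMap.toMatrix'_mulVec, hc, Matrix.smul_mulVec, Matrix.one_mulVec]
  have h1 : ∀ w k, ℓ (f w k) = c * w k := fun w k => congrFun (hφ w) k
  rw [map_sub, map_smul, h1, h1]
  simp [mul_comm]

end Schur

/-! ## Local charts of families of vector spaces -/

section ChartInverse

variable {B : Type*} {Fib : B → Type*} [∀ b, AddCommGroup (Fib b)] [∀ b, Module ℂ (Fib b)]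
  {W : Type*} [AddCommGroup W] [Module ℂ W]

/-- The inverse of a chart, extended by zero. -/
def chartInv (U : Set B) (κ : ∀ b, Fib b →ₗ[ℂ] W) (hκ : ∀ b ∈ U, Function.Bijective (κ b)) (b : B) :
    W →ₗ[ℂ] Fib b :=
  open scoped Classical in
  if h : b ∈ U then (LinearEquiv.ofBijective (κ b) (hκ b h)).symm.toLinearMap else 0

theorem apply_chartInv {U : Set B} {κ : ∀ b, Fib b →ₗ[ℂ] W}
    (hκ : ∀ b ∈ U, Function.Bijective (κ b)) {b : B} (hb : b ∈ U) (w : W) :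
    κ b (chartInv U κ hκ b w) = w := by
  rw [chartInv, dif_pos hb]
  exact (LinearEquiv.ofBijective (κ b) (hκ b hb)).apply_symm_apply w

theorem chartInv_apply {U : Set B} {κ : ∀ b, Fib b →ₗ[ℂ] W}
    (hκ : ∀ b ∈ U, Function.Bijective (κ b)) {b : B} (hb : b ∈ U) (v : Fib b) :
    chartInv U κ hκ b (κ b v) = v :=
  (hκ b hb).1 (apply_chartInv hκ hb _)

end ChartInverse

section Charts

open Filter

variable {B : Type*} [TopologicalSpace B] (Fib : B → Type*) [∀ b, AddCommGroup (Fib b)]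
  [∀ b, Module ℂ (Fib b)] [TopologicalSpace (Bundle.TotalSpace Unit Fib)]
  {W : Type*} [NormedAddCommGroup W] [NormedSpace ℂ W]

/-- A linear chart over the open set `U`: near a point over `U`, the topology of the total space is
the one induced by the projection and by `κ`. -/
structure IsChart (U : Set B) (κ : ∀ b, Fib b →ₗ[ℂ] W) : Prop where
  isOpen : IsOpen U
  bijective : ∀ b ∈ U, Function.Bijective (κ b)
  nhds_eq : ∀ t : Bundle.TotalSpace Unit Fib, t.proj ∈ U →
    𝓝 t = comap (fun s => s.proj) (𝓝 t.proj) ⊓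
      comap (fun s : Bundle.TotalSpace Unit Fib => κ s.proj s.snd) (𝓝 (κ t.proj t.snd))

/-- Every point of the base lies in the domain of a chart. -/
def HasCharts : Prop :=
  ∀ b₀ : B, ∃ (n : ℕ) (U : Set B) (κ : ∀ b, Fib b →ₗ[ℂ] (Fin n → ℂ)), IsChart Fib U κ ∧ b₀ ∈ U

variable {Fib}

/-- The continuity arguments for families rest on this: convergence in the total space is checked on
the base point and on the chart coordinate. -/
theorem IsChart.tendsto_iff {U : Set B} {κ : ∀ b, Fib b →ₗ[ℂ] W} (h : IsChart Fib U κ) {Z : Type*}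
    {l : Filter Z} {g : Z → Bundle.TotalSpace Unit Fib} {t : Bundle.TotalSpace Unit Fib}
    (ht : t.proj ∈ U) : Tendsto g l (𝓝 t) ↔ Tendsto (fun z => (g z).proj) l (𝓝 t.proj) ∧
      Tendsto (fun z => κ (g z).proj (g z).snd) l (𝓝 (κ t.proj t.snd)) := by
  rw [h.nhds_eq t ht, tendsto_inf, tendsto_comap_iff, tendsto_comap_iff]
  rfl

theorem IsChart.exists_fin [FiniteDimensional ℂ W] {U : Set B} {κ : ∀ b, Fib b →ₗ[ℂ] W}
    (h : IsChart Fib U κ) :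
    ∃ (n : ℕ) (κ' : ∀ b, Fib b →ₗ[ℂ] (Fin n → ℂ)), IsChart Fib U κ' := by
  let e : W ≃L[ℂ] (Fin (Module.finrank ℂ W) → ℂ) := ContinuousLinearEquiv.ofFinrankEq (by simp)
  refine ⟨_, fun b => e.toLinearEquiv.toLinearMap ∘ₗ κ b, h.isOpen,
    fun b hb => e.bijective.comp (h.bijective b hb), fun t ht => ?_⟩
  rw [h.nhds_eq t ht]
  congr 1
  change _ = comap (e ∘ fun s : Bundle.TotalSpace Unit Fib => κ s.proj s.snd) (𝓝 (e _))
  rw [← comap_comap]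
  exact congrArg _ (e.toHomeomorph.isInducing.nhds_eq_comap _)

theorem HasCharts.continuous_proj (h : HasCharts Fib) :
    Continuous fun t : Bundle.TotalSpace Unit Fib => t.proj :=
  continuous_iff_continuousAt.2 fun t => by
    obtain ⟨n, U, κ, hκ, ht⟩ := h t.proj
    exact ((hκ.tendsto_iff ht).1 tendsto_id).1

theorem HasCharts.finiteDimensional (h : HasCharts Fib) (b : B) : FiniteDimensional ℂ (Fib b) := by
  obtain ⟨n, U, κ, hκ, hb⟩ := h b
  exact FiniteDimensional.of_injective (κ b) (hκ.bijective b hb).1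

/-! ### Continuity of fibrewise linear operations -/

section Operations

variable {Z : Type*} [TopologicalSpace Z] {p : Z → B}

/-- Charts are linear on fibres, so in coordinates this is continuity of addition in ℂⁿ. Taking
sections along a map `p : Z → B` avoids fibre products of total spaces. -/
theorem HasCharts.continuous_add (h : HasCharts Fib) {s s' : ∀ z, Fib (p z)}
    (hs : Continuous fun z => (⟨p z, s z⟩ : Bundle.TotalSpace Unit Fib))
    (hs' : Continuous fun z => (⟨p z, s' z⟩ : Bundle.TotalSpace Unit Fib)) :
    Continuous fun z => (⟨p z, s z + s' z⟩ : Bundle.TotalSpace Unit Fib) :=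
  continuous_iff_continuousAt.2 fun z => by
    obtain ⟨n, U, κ, hκ, hz⟩ := h (p z)
    have h1 := (hκ.tendsto_iff (t := ⟨p z, s z⟩) hz).1 hs.continuousAt
    have h2 := (hκ.tendsto_iff (t := ⟨p z, s' z⟩) hz).1 hs'.continuousAt
    refine (hκ.tendsto_iff (t := ⟨p z, s z + s' z⟩) hz).2 ⟨h1.1, ?_⟩
    simpa only [map_add] using h1.2.add h2.2

theorem HasCharts.continuous_smul (h : HasCharts Fib) {c : Z → ℂ} (hc : Continuous c)
    {s : ∀ z, Fib (p z)} (hs : Continuous fun z => (⟨p z, s z⟩ : Bundle.TotalSpace Unit Fib)) :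
    Continuous fun z => (⟨p z, c z • s z⟩ : Bundle.TotalSpace Unit Fib) :=
  continuous_iff_continuousAt.2 fun z => by
    obtain ⟨n, U, κ, hκ, hz⟩ := h (p z)
    have h1 := (hκ.tendsto_iff (t := ⟨p z, s z⟩) hz).1 hs.continuousAt
    refine (hκ.tendsto_iff (t := ⟨p z, c z • s z⟩) hz).2 ⟨h1.1, ?_⟩
    simpa only [map_smul] using hc.continuousAt.tendsto.smul h1.2

theorem HasCharts.continuous_zero (h : HasCharts Fib) (hp : Continuous p) :
    Continuous fun z => (⟨p z, 0⟩ : Bundle.TotalSpace Unit Fib) :=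
  continuous_iff_continuousAt.2 fun z => by
    obtain ⟨n, U, κ, hκ, hz⟩ := h (p z)
    refine (hκ.tendsto_iff (t := ⟨p z, 0⟩) hz).2 ⟨hp.continuousAt, ?_⟩
    simpa only [map_zero] using tendsto_const_nhds

theorem HasCharts.continuous_sum (h : HasCharts Fib) (hp : Continuous p) {ι : Type*}
    (I : Finset ι) {s : ι → ∀ z, Fib (p z)}
    (hs : ∀ i, Continuous fun z => (⟨p z, s i z⟩ : Bundle.TotalSpace Unit Fib)) :
    Continuous fun z => (⟨p z, ∑ i ∈ I, s i z⟩ : Bundle.TotalSpace Unit Fib) := by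
  classical
  induction I using Finset.induction_on with
  | empty => simpa only [Finset.sum_empty] using h.continuous_zero hp
  | insert i I hi ih =>
    simp only [Finset.sum_insert hi]
    exact h.continuous_add (hs i) ih

end Operations

/-- In the chart these sections have constant coordinate `w` near `b₀`; the zero value of `chartInv`
off `U` plays no role. -/
theorem IsChart.tendsto_chartInv {U : Set B} {κ : ∀ b, Fib b →ₗ[ℂ] W} (h : IsChart Fib U κ)
    {b₀ : B} (hb : b₀ ∈ U) (w : W) :
    Tendsto (fun b => (⟨b, chartInv U κ h.bijective b w⟩ : Bundle.TotalSpace Unit Fib)) (𝓝 b₀)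
      (𝓝 ⟨b₀, chartInv U κ h.bijective b₀ w⟩) := by
  refine (h.tendsto_iff (t := ⟨b₀, _⟩) hb).2 ⟨tendsto_id, ?_⟩
  refine Tendsto.congr' (f₁ := fun _ => w) ?_ ?_
  · filter_upwards [h.isOpen.mem_nhds hb] with b hb'
    exact (apply_chartInv h.bijective hb' w).symm
  · rw [apply_chartInv h.bijective hb]
    exact tendsto_const_nhds

/-- A fibrewise linear map that is continuous depends continuously on the point, in charts. -/
theorem IsChart.continuousAt_clm [FiniteDimensional ℂ W] {B' : Type*} [TopologicalSpace B']
    {Fib' : B' → Type*}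
    [∀ b, AddCommGroup (Fib' b)] [∀ b, Module ℂ (Fib' b)]
    [TopologicalSpace (Bundle.TotalSpace Unit Fib')] {W' : Type*} [NormedAddCommGroup W']
    [NormedSpace ℂ W'] {U : Set B} {κ : ∀ b, Fib b →ₗ[ℂ] W} (h : IsChart Fib U κ)
    {U' : Set B'} {κ' : ∀ b, Fib' b →ₗ[ℂ] W'} (h' : IsChart Fib' U' κ') {m : B → B'}
    (Φ : ∀ b, Fib b →ₗ[ℂ] Fib' (m b))
    (hΦ : Continuous fun t : Bundle.TotalSpace Unit Fib =>
      (⟨m t.proj, Φ t.proj t.snd⟩ : Bundle.TotalSpace Unit Fib')) {b₀ : B} (hb : b₀ ∈ U)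
    (hb' : m b₀ ∈ U') :
    ContinuousAt (fun b => LinearMap.toContinuousLinearMap
      (κ' (m b) ∘ₗ Φ b ∘ₗ chartInv U κ h.bijective b)) b₀ := by
  -- As `W` is finite-dimensional, continuity in operator norm may be tested on vectors, that is, on
  -- the sections with constant coordinates.
  rw [continuousAt_clm_apply]
  intro w
  exact ((h'.tendsto_iff (t := ⟨m b₀, _⟩) hb').1
    ((hΦ.tendsto _).comp (h.tendsto_chartInv hb w))).2

/-- A continuous fibrewise linear bijection of locally trivial families has a continuous
inverse. -/
theorem HasCharts.continuous_symm {Fib' : B → Type*} [∀ b, AddCommGroup (Fib' b)]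
    [∀ b, Module ℂ (Fib' b)] [TopologicalSpace (Bundle.TotalSpace Unit Fib')]
    (h : HasCharts Fib) (h' : HasCharts Fib') (Φ : ∀ b, Fib b ≃ₗ[ℂ] Fib' b)
    (hΦ : Continuous fun t : Bundle.TotalSpace Unit Fib =>
      (⟨t.proj, Φ t.proj t.snd⟩ : Bundle.TotalSpace Unit Fib')) :
    Continuous fun t : Bundle.TotalSpace Unit Fib' =>
      (⟨t.proj, (Φ t.proj).symm t.snd⟩ : Bundle.TotalSpace Unit Fib) := by
  refine continuous_iff_continuousAt.2 fun t => ?_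
  obtain ⟨n, U, κ, hκ, hU⟩ := h t.proj
  obtain ⟨n', U', κ', hκ', hU'⟩ := h' t.proj
  -- In charts the map is a family of invertible operators, continuous at the given point. Inversion
  -- is continuous at an invertible operator, so the inverse family is continuous there too.
  let T : B → (Fin n → ℂ) →L[ℂ] (Fin n' → ℂ) := fun b => LinearMap.toContinuousLinearMap
    (κ' b ∘ₗ (Φ b).toLinearMap ∘ₗ chartInv U κ hκ.bijective b)
  have hT : ContinuousAt T t.proj := hκ.continuousAt_clm hκ' (m := id)
    (fun b => (Φ b).toLinearMap) hΦ hU hU'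
  let e : ∀ b, b ∈ U → b ∈ U' → ((Fin n → ℂ) ≃L[ℂ] (Fin n' → ℂ)) := fun b hb hb' =>
    (((LinearEquiv.ofBijective (κ b) (hκ.bijective b hb)).symm.trans (Φ b)).trans
      (LinearEquiv.ofBijective (κ' b) (hκ'.bijective b hb'))).toContinuousLinearEquiv
  have he : ∀ b hb hb', T b = (e b hb hb' : (Fin n → ℂ) →L[ℂ] (Fin n' → ℂ)) := fun b hb hb' => by
    ext1 w
    change κ' b (Φ b (chartInv U κ hκ.bijective b w)) = _
    rw [chartInv, dif_pos hb]
    rfl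
  have hinv : ContinuousAt (fun b => ContinuousLinearMap.inverse (T b)) t.proj := by
    have h1 : ContinuousAt ContinuousLinearMap.inverse (T t.proj) := by
      rw [he t.proj hU hU']
      exact (contDiffAt_map_inverse (n := 0) (e t.proj hU hU')).continuousAt
    exact h1.comp hT
  have hval : ∀ (b : B) (_ : b ∈ U) (_ : b ∈ U') (v : Fib' b),
      κ b ((Φ b).symm v) = ContinuousLinearMap.inverse (T b) (κ' b v) := fun b hb hb' v => by
    rw [he b hb hb', ContinuousLinearMap.inverse_equiv]
    symm
    change (e b hb hb').symm (κ' b v) = _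
    rw [ContinuousLinearEquiv.symm_apply_eq]
    change κ' b v = κ' b (Φ b ((LinearEquiv.ofBijective (κ b) (hκ.bijective b hb)).symm
      (LinearEquiv.ofBijective (κ b) (hκ.bijective b hb) ((Φ b).symm v))))
    rw [LinearEquiv.symm_apply_apply, LinearEquiv.apply_symm_apply]
  refine (hκ.tendsto_iff (t := ⟨t.proj, _⟩) hU).2 ⟨h'.continuous_proj.continuousAt, ?_⟩
  have h2 := ((hκ'.tendsto_iff hU').1 (tendsto_id (x := 𝓝 t)))
  have hp : Tendsto (fun s : Bundle.TotalSpace Unit Fib' => s.proj) (𝓝 t) (𝓝 t.proj) :=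
    h'.continuous_proj.continuousAt
  refine Tendsto.congr' (f₁ := fun s : Bundle.TotalSpace Unit Fib' =>
    ContinuousLinearMap.inverse (T s.proj) (κ' s.proj s.snd)) ?_ ?_
  · filter_upwards [hp (hκ.isOpen.mem_nhds hU), hp (hκ'.isOpen.mem_nhds hU')] with s hs hs'
    exact (hval s.proj hs hs' s.snd).symm
  · rw [hval t.proj hU hU']
    exact ((isBoundedBilinearMap_apply (𝕜 := ℂ)).continuous.tendsto
      (ContinuousLinearMap.inverse (T t.proj), κ' t.proj t.snd)).comp
      ((hinv.tendsto.comp hp).prodMk_nhds h2.2)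

/-- The image of a continuous family of projections has charts. -/
theorem exists_isChart_of_projection [FiniteDimensional ℂ W] {U : Set B} (hU : IsOpen U)
    (K : ∀ b, Fib b →ₗ[ℂ] W) (hinj : ∀ b ∈ U, Function.Injective (K b))
    (hnhds : ∀ t : Bundle.TotalSpace Unit Fib, t.proj ∈ U →
      𝓝 t = comap (fun s => s.proj) (𝓝 t.proj) ⊓
        comap (fun s : Bundle.TotalSpace Unit Fib => K s.proj s.snd) (𝓝 (K t.proj t.snd)))
    (P : B → W →L[ℂ] W) (hP : ContinuousOn P U) (hPP : ∀ b ∈ U, P b * P b = P b)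
    (hPK : ∀ b ∈ U, ∀ v, P b (K b v) = K b v) (hKP : ∀ b ∈ U, ∀ w, ∃ v, K b v = P b w)
    {b₀ : B} (hb₀ : b₀ ∈ U) :
    ∃ (n : ℕ) (U' : Set B) (κ : ∀ b, Fib b →ₗ[ℂ] (Fin n → ℂ)), IsChart Fib U' κ ∧ b₀ ∈ U' := by
  have : CompleteSpace W := FiniteDimensional.complete ℂ W
  -- Interpolation between projections: `Γ b` is `1` at `b₀`, hence invertible nearby, and `Γ b * P
  -- b = P b₀ * Γ b`, so it carries the image of `P b` to that of `P b₀`. On the image of `K b` it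
  -- agrees with `P b₀`, which gives the chart `κ` with values in the fixed space `R`.
  let Γ : B → W →L[ℂ] W := fun b => P b₀ * P b + (1 - P b₀) * (1 - P b)
  have hΓ : ContinuousOn Γ U := (continuousOn_const.mul hP).add
    (continuousOn_const.mul (continuousOn_const.sub hP))
  let U' : Set B := U ∩ Γ ⁻¹' {T | IsUnit T}
  have hU' : IsOpen U' := hΓ.isOpen_inter_preimage hU Units.isOpen
  have hb₀' : b₀ ∈ U' := by
    refine ⟨hb₀, ?_⟩
    have : Γ b₀ = 1 := by
      simp only [Γ, mul_sub, sub_mul, mul_one, one_mul, hPP b₀ hb₀]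
      abel
    simp [this]
  let R : Submodule ℂ W := LinearMap.range (P b₀).toLinearMap
  let κ : ∀ b, Fib b →ₗ[ℂ] R := fun b => (P b₀).toLinearMap.rangeRestrict ∘ₗ K b
  have hκ : ∀ b, b ∈ U' → ∀ v, ((κ b v : R) : W) = Γ b (K b v) := fun b hb v => by
    change P b₀ (K b v) = P b₀ (P b (K b v)) + (1 - P b₀) ((1 - P b) (K b v))
    have h1 : (1 - P b) (K b v) = 0 := by
      change K b v - P b (K b v) = 0
      rw [hPK b hb.1, sub_self]
    rw [h1, map_zero, hPK b hb.1, add_zero]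
  have hinv : ∀ b, b ∈ U' → ∀ w, Ring.inverse (Γ b) (Γ b w) = w := fun b hb w => by
    have := Ring.inverse_mul_cancel (Γ b) hb.2
    exact congrArg (fun T : W →L[ℂ] W => T w) this
  have hinv' : ∀ b, b ∈ U' → ∀ w, Γ b (Ring.inverse (Γ b) w) = w := fun b hb w => by
    have := Ring.mul_inverse_cancel (Γ b) hb.2
    exact congrArg (fun T : W →L[ℂ] W => T w) this
  have hchart : IsChart Fib U' κ := by
    refine ⟨hU', fun b hb => ⟨fun v v' hvv => ?_, ?_⟩, fun t ht => ?_⟩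
    · have h1 : Γ b (K b v) = Γ b (K b v') := by rw [← hκ b hb, ← hκ b hb, hvv]
      have h2 := congrArg (fun w => (Ring.inverse (Γ b) : W →L[ℂ] W) w) h1
      rw [hinv b hb, hinv b hb] at h2
      exact hinj b hb.1 h2
    · rintro ⟨_, w, rfl⟩
      -- The preimage comes from inverting `Γ b` on `P b₀ w`; projecting the result by `P b` changes
      -- nothing after `Γ b`, by the intertwining relation `h1`.
      obtain ⟨v, hv⟩ := hKP b hb.1 (Ring.inverse (Γ b) (P b₀ w))
      refine ⟨v, Subtype.ext ?_⟩
      rw [hκ b hb, hv]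
      have h1 : Γ b * P b = P b₀ * Γ b := by
        simp only [Γ, mul_add, add_mul, mul_sub, sub_mul, mul_one, one_mul, mul_assoc,
          hPP b hb.1]
        simp only [← mul_assoc, hPP b₀ hb₀]
        abel
      have h2 := congrArg (fun T : W →L[ℂ] W => T (Ring.inverse (Γ b) (P b₀ w))) h1
      refine h2.trans ?_
      change P b₀ (Γ b (Ring.inverse (Γ b) (P b₀ w))) = P b₀ w
      rw [hinv' b hb]
      exact congrArg (fun T : W →L[ℂ] W => T w) (hPP b₀ hb₀)
    · rw [hnhds t ht.1]
      refine le_antisymm (le_inf inf_le_left ?_) (le_inf inf_le_left ?_)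
      · refine inf_le_right.trans (tendsto_iff_comap.1 ?_)
        have hc : Continuous fun w => (P b₀).toLinearMap.rangeRestrict w :=
          (P b₀).continuous.subtype_mk _
        exact (hc.tendsto _).comp tendsto_comap
      -- `K` is recovered from `κ` by the inverse of `Γ`, which is continuous in the base point.
      · refine tendsto_iff_comap.1 ?_
        set l := comap (fun s : Bundle.TotalSpace Unit Fib => s.proj) (𝓝 t.proj) ⊓
          comap (fun s : Bundle.TotalSpace Unit Fib => κ s.proj s.snd) (𝓝 (κ t.proj t.snd))
        have hp : Tendsto (fun s : Bundle.TotalSpace Unit Fib => s.proj) l (𝓝 t.proj) :=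
          tendsto_comap.mono_left inf_le_left
        have hk : Tendsto (fun s : Bundle.TotalSpace Unit Fib => κ s.proj s.snd) l
            (𝓝 (κ t.proj t.snd)) := tendsto_comap.mono_left inf_le_right
        have hi : ContinuousAt (fun b => Ring.inverse (Γ b)) t.proj := by
          obtain ⟨x, hx⟩ := ht.2
          have h1 : ContinuousAt Ring.inverse (Γ t.proj) := by
            rw [← hx]
            exact NormedRing.inverse_continuousAt x
          exact h1.comp (hΓ.continuousAt (hU.mem_nhds ht.1))
        refine Tendsto.congr' (f₁ := fun s : Bundle.TotalSpace Unit Fib =>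
          Ring.inverse (Γ s.proj) (κ s.proj s.snd : R)) ?_ ?_
        · filter_upwards [hp (hU'.mem_nhds ht)] with s hs
          rw [hκ _ hs, hinv _ hs]
        · have h2 := ((isBoundedBilinearMap_apply (𝕜 := ℂ)).continuous.tendsto
            ((Ring.inverse (Γ t.proj) : W →L[ℂ] W), ((κ t.proj t.snd : R) : W))).comp
            ((hi.tendsto.comp hp).prodMk_nhds
              ((continuous_subtype_val.tendsto (κ t.proj t.snd)).comp hk))
          have h3 : Ring.inverse (Γ t.proj) ((κ t.proj t.snd : R) : W) = K t.proj t.snd := by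
            rw [hκ _ ht, hinv _ ht]
          rw [← h3]
          exact h2
  obtain ⟨n, κ', hc⟩ := hchart.exists_fin
  exact ⟨n, U', κ', hc, by assumption⟩

/-- A finite fibre product of pullbacks of locally trivial families is locally trivial. -/
theorem HasCharts.pi {ι : Type*} [Finite ι] {C : ι → Type*} [∀ i, TopologicalSpace (C i)]
    {D : ∀ i, C i → Type*} [∀ i c, AddCommGroup (D i c)] [∀ i c, Module ℂ (D i c)]
    [∀ i, TopologicalSpace (Bundle.TotalSpace Unit (D i))] (hD : ∀ i, HasCharts (D i))
    (m : ∀ i, B → C i) (hm : ∀ i, Continuous (m i)) (e : ∀ b, Fib b ≃ₗ[ℂ] ∀ i, D i (m i b))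
    (hind : IsInducing fun t : Bundle.TotalSpace Unit Fib =>
      (t.proj, fun i => (⟨m i t.proj, e t.proj t.snd i⟩ : Bundle.TotalSpace Unit (D i)))) :
    HasCharts Fib := by
  intro b₀
  have := Fintype.ofFinite ι
  choose n U κ hκ hU using fun i => hD i (m i b₀)
  have hpi : ∀ t : Bundle.TotalSpace Unit Fib, 𝓝 t = comap (fun s => s.proj) (𝓝 t.proj) ⊓
      ⨅ i, comap (fun s : Bundle.TotalSpace Unit Fib =>
        (⟨m i s.proj, e s.proj s.snd i⟩ : Bundle.TotalSpace Unit (D i)))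
        (𝓝 ⟨m i t.proj, e t.proj t.snd i⟩) := fun t => by
    rw [hind.nhds_eq_comap, nhds_prod_eq, prod_eq_inf, comap_inf, comap_comap, comap_comap,
      nhds_pi, Filter.pi, comap_iInf]
    simp only [comap_comap]
    rfl
  have hch : IsChart Fib (⋂ i, m i ⁻¹' U i) (W := ∀ i, Fin (n i) → ℂ)
      (fun b => (LinearMap.pi fun i => κ i (m i b) ∘ₗ LinearMap.proj i) ∘ₗ (e b).toLinearMap) := by
    refine ⟨isOpen_iInter_of_finite fun i => (hκ i).isOpen.preimage (hm i),
      fun b hb => ⟨fun v v' hvv => (e b).injective (funext fun i => ?_), fun w => ?_⟩,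
      fun t ht => ?_⟩
    · exact ((hκ i).bijective _ (Set.mem_iInter.1 hb i)).1 (congrFun hvv i)
    · choose v hv using fun i => ((hκ i).bijective _ (Set.mem_iInter.1 hb i)).2 (w i)
      refine ⟨(e b).symm v, funext fun i => ?_⟩
      change κ i (m i b) (e b ((e b).symm v) i) = w i
      rw [LinearEquiv.apply_symm_apply, hv]
    · rw [hpi t, nhds_pi, Filter.pi, comap_iInf]
      simp only [comap_comap]
      -- The conditions on the base points `m i s.proj` follow from the one on `s.proj`, by
      -- continuity of `m i`, and can be dropped.
      have hp : ∀ i, comap (fun s : Bundle.TotalSpace Unit Fib => s.proj) (𝓝 t.proj) ≤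
          comap (fun s : Bundle.TotalSpace Unit Fib => m i s.proj) (𝓝 (m i t.proj)) := fun i =>
        tendsto_iff_comap.1 (((hm i).tendsto _).comp tendsto_comap)
      have hi : ∀ i, comap (fun s : Bundle.TotalSpace Unit Fib =>
          (⟨m i s.proj, e s.proj s.snd i⟩ : Bundle.TotalSpace Unit (D i)))
          (𝓝 ⟨m i t.proj, e t.proj t.snd i⟩) =
          comap (fun s : Bundle.TotalSpace Unit Fib => m i s.proj) (𝓝 (m i t.proj)) ⊓
          comap (fun s : Bundle.TotalSpace Unit Fib => κ i (m i s.proj) (e s.proj s.snd i))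
            (𝓝 (κ i (m i t.proj) (e t.proj t.snd i))) := fun i => by
        rw [(hκ i).nhds_eq ⟨m i t.proj, e t.proj t.snd i⟩ (Set.mem_iInter.1 ht i), comap_inf,
          comap_comap, comap_comap]
        rfl
      simp only [hi]
      refine le_antisymm (le_inf inf_le_left (le_iInf fun i => ?_))
        (le_inf inf_le_left (le_iInf fun i => le_inf (inf_le_left.trans (hp i)) ?_))
      · exact inf_le_right.trans ((iInf_le _ i).trans inf_le_right)
      · exact inf_le_right.trans (iInf_le _ i)
  obtain ⟨k, κ', hκ'⟩ := hch.exists_fin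
  exact ⟨k, _, κ', hκ', Set.mem_iInter.2 hU⟩

end Charts

/-! ### Equivalence of charts and local trivialisations -/

section Bundles

open Filter

variable {H : Type v} [Group H] [TopologicalSpace H] {X : GSpace.{u, v} H} {E : EqFamily X}

/-- The trivialisation is a homeomorphism on the part of the total space over `U`. That part is
open, so it determines the full neighbourhood filters of its points. -/
theorem EqFamily.IsBundle.hasCharts (hE : E.IsBundle) : HasCharts E.Fib := by
  classical
  intro x₀
  obtain ⟨U, n, φ, hU, hx, hφ⟩ := hE.locally_trivial x₀
  let κ : ∀ x, E.Fib x →ₗ[ℂ] (Fin n → ℂ) := fun x =>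
    if h : x ∈ U then (φ ⟨x, h⟩).toLinearMap else 0
  have hκ : ∀ x (h : x ∈ U) v, κ x v = φ ⟨x, h⟩ v := fun x h v => by
    simp only [κ, dif_pos h]; rfl
  refine ⟨n, U, κ, ⟨hU, fun x h => ?_, fun t ht => ?_⟩, hx⟩
  · have : ⇑(κ x) = φ ⟨x, h⟩ := funext (hκ x h)
    rw [this]
    exact (φ ⟨x, h⟩).bijective
  · have hoe : IsOpenEmbedding (Subtype.val : {t : E.Tot // t.proj ∈ U} → E.Tot) :=
      (hU.preimage hE.continuous_proj).isOpenEmbedding_subtypeVal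
    refine le_antisymm (le_inf ?_ ?_) ?_
    · exact tendsto_iff_comap.1 hE.continuous_proj.continuousAt
    · refine tendsto_iff_comap.1 ?_
      have h1 : ContinuousAt (fun s : E.Tot => κ s.proj s.snd) ((⟨t, ht⟩ :
          {t : E.Tot // t.proj ∈ U}) : E.Tot) := by
        rw [← hoe.continuousAt_iff]
        refine (hφ.continuous.snd.continuousAt (x := ⟨t, ht⟩)).congr
          (Eventually.of_forall fun s => ?_)
        exact (hκ _ s.2 _).symm
      exact h1
    · set l := comap (fun s : E.Tot => s.proj) (𝓝 t.proj) ⊓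
        comap (fun s : E.Tot => κ s.proj s.snd) (𝓝 (κ t.proj t.snd))
      have hp : Tendsto (fun s : E.Tot => s.proj) l (𝓝 t.proj) :=
        tendsto_comap.mono_left inf_le_left
      have hk : Tendsto (fun s : E.Tot => κ s.proj s.snd) l
          (𝓝 (κ t.proj t.snd)) := tendsto_comap.mono_left inf_le_right
      let e := hφ.homeomorph
      -- The inverse trivialisation, with the arbitrary value `t` off `U`; only its values near
      -- `t.proj` matter.
      let g : X × (Fin n → ℂ) → E.Tot := fun p =>
        if h : p.1 ∈ U then (e.symm (⟨p.1, h⟩, p.2)).1 else t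
      have he : ∀ s (h : s.proj ∈ U), e.symm (⟨s.proj, h⟩, κ s.proj s.snd) = ⟨s, h⟩ :=
        fun s h => by
          rw [hκ _ h, Homeomorph.symm_apply_eq]
          rfl
      have hgs : ∀ s : E.Tot, s.proj ∈ U → g (s.proj, κ s.proj s.snd) = s := fun s h => by
        simp only [g, dif_pos h, he s h]
      have hoe' : IsOpenEmbedding (Prod.map (Subtype.val : U → X) (id : (Fin n → ℂ) → _)) :=
        hU.isOpenEmbedding_subtypeVal.prodMap .id
      have hg : ContinuousAt g (Prod.map (Subtype.val : U → X) id
          ((⟨t.proj, ht⟩ : U), κ t.proj t.snd)) := by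
        rw [← hoe'.continuousAt_iff]
        refine (continuous_subtype_val.comp e.symm.continuous).continuousAt.congr
          (Eventually.of_forall fun p => ?_)
        change (e.symm p).1 = g (p.1.1, p.2)
        simp only [g, dif_pos p.1.2]
      have h2 : Tendsto (fun s : E.Tot => g (s.proj, κ s.proj s.snd)) l (𝓝 t) := by
        have h3 : Tendsto g (𝓝 (t.proj, κ t.proj t.snd)) (𝓝 t) := by
          have h4 := hg.tendsto
          have h5 : g (Prod.map (Subtype.val : U → X) id ((⟨t.proj, ht⟩ : U), κ t.proj t.snd)) =
            t := hgs t ht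
          rw [h5] at h4
          exact h4
        exact h3.comp (hp.prodMk_nhds hk)
      refine tendsto_id'.1 (h2.congr' ?_)
      filter_upwards [hp (hU.mem_nhds ht)] with s hs
      exact hgs s hs

/-- Restricted to the part over `U`, the filter identity of a chart says that the chart is inducing;
with bijectivity on fibres this is a trivialisation. -/
theorem EqFamily.isBundle_of_hasCharts (h : HasCharts E.Fib)
    (hact : Continuous fun p : H × E.Tot => (⟨p.1 • p.2.proj, E.act p.1 rfl p.2.snd⟩ : E.Tot)) :
    E.IsBundle where
  continuous_proj := h.continuous_proj
  continuous_act := hact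
  locally_trivial x₀ := by
    obtain ⟨n, U, κ, hκ, hx⟩ := h x₀
    let φ : ∀ x : U, E.Fib x ≃ₗ[ℂ] (Fin n → ℂ) := fun x =>
      LinearEquiv.ofBijective (κ x) (hκ.bijective x x.2)
    refine ⟨U, n, φ, hκ.isOpen, hx,
      E.isHomeomorph_of_isInducing φ (isInducing_iff_nhds.2 fun t => ?_)⟩
    rw [nhds_subtype_eq_comap, hκ.nhds_eq t.1 t.2, nhds_prod_eq, prod_eq_inf, comap_inf, comap_inf,
      nhds_subtype_eq_comap]
    simp only [comap_comap]
    rfl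

/-- The base point of the result is `q z`, equal to `h • p z` only through `e`. Absorbing this
transport once lets later continuity proofs choose the form of the base point. -/
theorem EqFamily.IsBundle.continuous_act_apply (hE : E.IsBundle) {Z : Type*} [TopologicalSpace Z]
    (h : H) {p q : Z → X} (e : ∀ z, h • p z = q z) {s : ∀ z, E.Fib (p z)}
    (hs : Continuous fun z => (⟨p z, s z⟩ : E.Tot)) :
    Continuous fun z => (⟨q z, E.act h (e z) (s z)⟩ : E.Tot) :=
  (hE.continuous_act.comp (continuous_const.prodMk hs)).congr fun z =>
    E.act_heq h rfl (e z) (s z)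

/-- A fibrewise linear, continuous, equivariant bijection of bundles is an isomorphism. -/
def EqFamily.IsBundle.isoOfBijective {F : EqFamily X} (hE : E.IsBundle) (hF : F.IsBundle)
    (Φ : ∀ x, E.Fib x →ₗ[ℂ] F.Fib x) (hΦ : ∀ x, Function.Bijective (Φ x))
    (hcomm : ∀ (h : H) {x y : X} (e : h • x = y) (v : E.Fib x),
      Φ y (E.act h e v) = F.act h e (Φ x v))
    (hc : Continuous fun t : E.Tot => (⟨t.proj, Φ t.proj t.snd⟩ : F.Tot)) : E.Iso F where
  toEquiv x := LinearEquiv.ofBijective (Φ x) (hΦ x)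
  comm h _ _ e v := hcomm h e v
  continuous_toFun := hc
  continuous_invFun := hE.hasCharts.continuous_symm hF.hasCharts
    (fun x => LinearEquiv.ofBijective (Φ x) (hΦ x)) hc

end Bundles

/-! ## Functoriality and local triviality of `Hom_A(V_τ, E)` -/

section FibreRep

variable {G : Type v} [Group G] [TopologicalSpace G] {A : Subgroup G}
  {X : GSpace.{u, v} G} (hX : X.TrivialOn A) (E : EqFamily X)

/-- The representation of `A` on a fibre. -/
def fibRep (x : X) : Representation ℂ A (E.Fib x) where
  toFun a := E.act (a : G) (hX a x)
  map_one' := LinearMap.ext fun v => E.act_one (hX 1 x) v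
  map_mul' a b := LinearMap.ext fun v =>
    E.act_mul (a : G) (b : G) (hX b x) (hX a x) (hX (a * b) x) v

variable (τ : IrrRep A)

/-- The average over `A` of a linear map `V_τ → E_x`. -/
def homAvg (x : X) : ((Fin τ.d → ℂ) →ₗ[ℂ] E.Fib x) →ₗ[ℂ] ((Fin τ.d → ℂ) →ₗ[ℂ] E.Fib x) :=
  (Nat.card A : ℂ)⁻¹ • ∑ᶠ a : A, (LinearMap.llcomp ℂ _ _ _ (fibRep hX E x a)) ∘ₗ
    LinearMap.lcomp ℂ _ (unitaryRep τ.ρ a⁻¹)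

theorem homAvg_apply [Fintype A] (x : X) (f : (Fin τ.d → ℂ) →ₗ[ℂ] E.Fib x) (v : Fin τ.d → ℂ) :
    homAvg hX E τ x f v = (Nat.card A : ℂ)⁻¹ • ∑ a : A,
      fibRep hX E x a (f (unitaryRep τ.ρ a⁻¹ v)) := by
  rw [homAvg, finsum_eq_sum_of_fintype]
  simp

/-- Acting by `b` amounts to reindexing the sum by `a ↦ b * a`. Together with `homAvg_of_mem` this
makes averaging a projection onto Hom_A(V_τ, E_x). -/
theorem homAvg_mem [Finite A] [A.Normal] (x : X) (f : (Fin τ.d → ℂ) →ₗ[ℂ] E.Fib x) :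
    homAvg hX E τ x f ∈ homAFib hX τ E x := by
  have := Fintype.ofFinite A
  intro b v
  change _ = fibRep hX E x b _
  rw [homAvg_apply, homAvg_apply, map_smul, map_sum,
    ← Equiv.sum_comp (Equiv.mulLeft b)]
  congr 1
  refine Finset.sum_congr rfl fun a _ => ?_
  simp only [Equiv.coe_mulLeft, map_mul, mul_inv_rev, Module.End.mul_apply]
  rw [← Module.End.mul_apply (unitaryRep τ.ρ b⁻¹), ← map_mul, inv_mul_cancel, map_one]
  rfl

theorem homAvg_of_mem [Finite A] [A.Normal] (x : X) {f : (Fin τ.d → ℂ) →ₗ[ℂ] E.Fib x}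
    (hf : f ∈ homAFib hX τ E x) : homAvg hX E τ x f = f := by
  have := Fintype.ofFinite A
  refine LinearMap.ext fun v => ?_
  have h1 : ∀ a : A, fibRep hX E x a (f (unitaryRep τ.ρ a⁻¹ v)) = f v := fun a => by
    refine (hf a _).symm.trans ?_
    rw [← Module.End.mul_apply, ← map_mul, mul_inv_cancel, map_one]
    rfl
  rw [homAvg_apply]
  simp only [h1]
  rw [Finset.sum_const, Finset.card_univ, ← Nat.card_eq_fintype_card, ← Nat.cast_smul_eq_nsmul ℂ,
    inv_smul_smul₀ (Nat.cast_ne_zero.2 Nat.card_pos.ne')]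

end FibreRep

section HomFibre

variable {G : Type v} [Group G] [TopologicalSpace G] {A : Subgroup G} [A.Normal] {τ : IrrRep A}
  (c : TwistChoice τ) {X : GSpace.{u, v} G} (hX : X.TrivialOn A)

/-- An equivariant map `E_x → F_x` induces a map `Hom_A(V_τ, E_x) → Hom_A(V_τ, F_x)`. -/
def homAFibMap {E F : EqFamily X} {x : X} (φ : E.Fib x →ₗ[ℂ] F.Fib x)
    (hφ : ∀ (a : A) v, φ (E.act (a : G) (hX a x) v) = F.act (a : G) (hX a x) (φ v)) :
    homAFib hX τ E x →ₗ[ℂ] homAFib hX τ F x where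
  toFun f := ⟨φ ∘ₗ f.1, fun a v => (congrArg φ (f.2 a v)).trans (hφ a (f.1 v))⟩
  map_add' f g := Subtype.ext (LinearMap.ext fun v => map_add φ (f.1 v) (g.1 v))
  map_smul' z f := Subtype.ext (LinearMap.ext fun v => map_smul φ z (f.1 v))

/-- The action on homomorphisms precomposes with a matrix and postcomposes with a scalar and the
action on `E`; only the postcomposition meets `φ`, which is linear and equivariant. -/
theorem homAFibMap_homAAct {E F : EqFamily X} (φ : ∀ x, E.Fib x →ₗ[ℂ] F.Fib x)
    (hφ : ∀ (g : G) {x y : X} (e : g • x = y) v, φ y (E.act g e v) = F.act g e (φ x v))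
    (q : τ.isotropy) (z : Circle) {x y : X} (e : c.σ q • x = y) (f : homAFib hX τ E x) :
    homAFibMap hX (φ y) (fun a v => hφ a (hX a y) v) (homAAct c hX E q z e f) =
      homAAct c hX F q z e (homAFibMap hX (φ x) (fun a v => hφ a (hX a x) v) f) :=
  Subtype.ext (LinearMap.ext fun v =>
    (map_smul (φ y) (z : ℂ) (E.act (c.σ q) e (f.1 (Matrix.toLin' ((c.M q)⁻¹).1 v)))).trans
      (congrArg ((z : ℂ) • ·) (hφ (c.σ q) e _)))

/-- An isomorphism induces an isomorphism `Hom_A(V_τ, E_x) ≃ Hom_A(V_τ, F_x)`. -/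
def homAFibCongr {E F : EqFamily X} (i : E.Iso F) (x : X) :
    homAFib hX τ E x ≃ₗ[ℂ] homAFib hX τ F x :=
  LinearEquiv.ofLinearMap
    (homAFibMap hX (i.toEquiv x).toLinearMap (fun a v => i.comm a (hX a x) v))
    (homAFibMap hX (i.symm.toEquiv x).toLinearMap (fun a v => i.symm.comm a (hX a x) v))
    (LinearMap.ext fun f => Subtype.ext (LinearMap.ext fun v =>
      (i.toEquiv x).apply_symm_apply (f.1 v)))
    (LinearMap.ext fun f => Subtype.ext (LinearMap.ext fun v =>
      (i.toEquiv x).symm_apply_apply (f.1 v)))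

/-- `Hom_A(V_τ, E_x ⊕ F_x) = Hom_A(V_τ, E_x) ⊕ Hom_A(V_τ, F_x)`. -/
def homAFibSum (E F : EqFamily X) (x : X) :
    homAFib hX τ (E.sum F) x ≃ₗ[ℂ] homAFib hX τ E x × homAFib hX τ F x where
  toFun f := (⟨LinearMap.fst ℂ (E.Fib x) (F.Fib x) ∘ₗ f.1, fun a v =>
      congrArg (fun w : E.Fib x × F.Fib x => w.1) (f.2 a v)⟩,
    ⟨LinearMap.snd ℂ (E.Fib x) (F.Fib x) ∘ₗ f.1, fun a v =>
      congrArg (fun w : E.Fib x × F.Fib x => w.2) (f.2 a v)⟩)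
  invFun f := ⟨f.1.1.prod f.2.1, fun a v => Prod.ext (f.1.2 a v) (f.2.2 a v)⟩
  map_add' _ _ := rfl
  map_smul' _ _ := rfl
  left_inv _ := rfl
  right_inv _ := rfl

end HomFibre

section HomBundle

variable {G : Type v} [Group G] [TopologicalSpace G] [DiscreteTopology G] {A : Subgroup G}
  [A.Normal] {τ : IrrRep A} (c : TwistChoice τ) {X Y : GSpace.{u, v} G} (hX : X.TrivialOn A)

theorem isInducing_homA (E : EqFamily X) : IsInducing fun t : (homA c hX E).Tot =>
    ((t.proj : X), fun v : Fin τ.d → ℂ => (⟨t.proj, t.snd.1 v⟩ : E.Tot)) := ⟨rfl⟩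

theorem continuous_homA_proj (E : EqFamily X) :
    Continuous fun t : (homA c hX E).Tot => (t.proj : X) :=
  (isInducing_homA c hX E).continuous.fst

theorem continuous_homA_eval (E : EqFamily X) (v : Fin τ.d → ℂ) :
    Continuous fun t : (homA c hX E).Tot => (⟨t.proj, t.snd.1 v⟩ : E.Tot) :=
  (continuous_apply v).comp (isInducing_homA c hX E).continuous.snd

theorem continuous_homA_mk {Z : Type*} [TopologicalSpace Z] {E : EqFamily X}
    {g : Z → (homA c hX E).Tot} (h₁ : Continuous fun z => ((g z).proj : X))
    (h₂ : ∀ v : Fin τ.d → ℂ, Continuous fun z => (⟨(g z).proj, (g z).snd.1 v⟩ : E.Tot)) :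
    Continuous g :=
  (isInducing_homA c hX E).continuous_iff.2 (h₁.prodMk (continuous_pi h₂))

/-- `Hom_A(V_τ, E)` is locally trivial. -/
theorem hasCharts_homA [Finite A] {E : EqFamily X} (hE : E.IsBundle) :
    HasCharts (homA c hX E).Fib := by
  classical
  have := Fintype.ofFinite A
  intro x₀
  obtain ⟨n, U, κ, hκ, hx₀⟩ := hE.hasCharts x₀
  -- An equivariant map is recorded by the chart coordinates of its values on the standard basis of
  -- V_τ. `J` rebuilds a linear map from such data, and `K` after `homAvg` after `J` is the
  -- projection fed to `exists_isChart_of_projection`.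
  let K : ∀ x : X, homAFib hX τ E x →ₗ[ℂ] (Fin τ.d → Fin n → ℂ) := fun x =>
    LinearMap.pi fun i => κ x ∘ₗ LinearMap.applyₗ (Pi.single i 1) ∘ₗ (homAFib hX τ E x).subtype
  have hK : ∀ (x : X) (f : homAFib hX τ E x) i, K x f i = κ x (f.1 (Pi.single i 1)) :=
    fun _ _ _ => rfl
  have hsum : ∀ (x : X) (f : (Fin τ.d → ℂ) →ₗ[ℂ] E.Fib x) (v : Fin τ.d → ℂ),
      f v = ∑ i, v i • f (Pi.single i 1) := fun x f v => by
    conv_lhs => rw [pi_eq_sum_univ' v, map_sum]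
    simp only [map_smul]
  let J : ∀ x : X, (Fin τ.d → Fin n → ℂ) →ₗ[ℂ] ((Fin τ.d → ℂ) →ₗ[ℂ] E.Fib x) := fun x =>
    ∑ l, (LinearMap.smulRightₗ (LinearMap.proj l : (Fin τ.d → ℂ) →ₗ[ℂ] ℂ)) ∘ₗ
      chartInv U κ hκ.bijective x ∘ₗ LinearMap.proj l
  have hJ : ∀ (x : X) w v, J x w v = chartInv U κ hκ.bijective x (∑ l, v l • w l) :=
    fun x w v => by
      simp [J, LinearMap.sum_apply]
  have hJK : ∀ x ∈ U, ∀ f : homAFib hX τ E x, J x (K x f) = f.1 := fun x hx f => by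
    refine LinearMap.ext fun v => ?_
    rw [hJ, hsum x f.1 v, map_sum]
    refine Finset.sum_congr rfl fun i _ => ?_
    rw [map_smul, hK, chartInv_apply hκ.bijective hx]
  let P₀ : ∀ x : X, (Fin τ.d → Fin n → ℂ) →ₗ[ℂ] (Fin τ.d → Fin n → ℂ) := fun x =>
    LinearMap.pi fun i => κ x ∘ₗ LinearMap.applyₗ (Pi.single i 1) ∘ₗ homAvg hX E τ x ∘ₗ J x
  have hP₀ : ∀ (x : X) w, P₀ x w = K x ⟨homAvg hX E τ x (J x w), homAvg_mem hX E τ x _⟩ :=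
    fun _ _ => rfl
  let P : X → (Fin τ.d → Fin n → ℂ) →L[ℂ] (Fin τ.d → Fin n → ℂ) := fun x =>
    LinearMap.toContinuousLinearMap (P₀ x)
  have hPK : ∀ x ∈ U, ∀ f, P x (K x f) = K x f := fun x hx f => by
    change P₀ x (K x f) = _
    rw [hP₀]
    congr 1
    exact Subtype.ext ((congrArg _ (hJK x hx f)).trans (homAvg_of_mem hX E τ x f.2))
  -- The base of `homA` is `X` viewed as a space over the central extension; its topology is
  -- restated here for the family over `X` itself.
  let : TopologicalSpace (Bundle.TotalSpace Unit fun x : X => homAFib hX τ E x) :=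
    (homA c hX E).top
  refine exists_isChart_of_projection (B := X) (Fib := fun x => homAFib hX τ E x) hκ.isOpen K
    (fun x hx f f' hff => ?_) (fun t ht => ?_) P ?_ (fun x hx => ?_) hPK (fun x hx w => ⟨_, (hP₀ x w).symm⟩)
    hx₀
  · exact Subtype.ext (by rw [← hJK x hx f, ← hJK x hx f', hff])
  · refine le_antisymm (le_inf ?_ ?_) ?_
    · exact Filter.tendsto_iff_comap.1 (continuous_homA_proj c hX E).continuousAt
    · refine Filter.tendsto_iff_comap.1 (tendsto_pi_nhds.2 fun i => ?_)
      exact ((hκ.tendsto_iff (t := ⟨t.proj, t.snd.1 (Pi.single i 1)⟩) ht).1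
        (continuous_homA_eval c hX E (Pi.single i 1)).continuousAt).2
    -- The topology comes from evaluation at all vectors; by linearity the values on the basis
    -- control the others.
    · refine le_trans ?_ ((isInducing_homA c hX E).nhds_eq_comap t).ge
      refine Filter.tendsto_iff_comap.1 (Filter.Tendsto.prodMk_nhds
        (Filter.tendsto_comap.mono_left inf_le_left) (tendsto_pi_nhds.2 fun v => ?_))
      refine (hκ.tendsto_iff (t := ⟨t.proj, t.snd.1 v⟩) ht).2
        ⟨Filter.tendsto_comap.mono_left inf_le_left, ?_⟩
      have h1 : ∀ s : Bundle.TotalSpace Unit fun x => homAFib hX τ E x,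
          κ s.proj (s.snd.1 v) = ∑ i, v i • K s.proj s.snd i := fun s => by
        rw [hsum _ s.snd.1 v, map_sum]
        exact Finset.sum_congr rfl fun i _ => by rw [map_smul, hK]
      refine Filter.Tendsto.congr (fun s => (h1 s).symm) ?_
      have h2 := h1 t
      refine Eq.subst (motive := fun z => Filter.Tendsto _ _ (𝓝 z)) h2.symm ?_
      refine tendsto_finsetSum _ fun i _ => Filter.Tendsto.const_smul ?_ _
      exact (tendsto_pi_nhds.1 (Filter.tendsto_comap.mono_left inf_le_right)) i
  -- In coordinates the projection is a finite average of the actions of the elements of `A`, read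
  -- in the chart of `E` and combined with constant coefficients of τ.
  · rw [continuousOn_clm_apply]
    intro w
    refine continuousOn_pi.2 fun i => ?_
    have h1 : ∀ x, P x w i = (Nat.card A : ℂ)⁻¹ • ∑ a : A, (κ x ∘ₗ fibRep hX E x a ∘ₗ
        chartInv U κ hκ.bijective x) (∑ l, unitaryRep τ.ρ a⁻¹ (Pi.single i 1) l • w l) :=
      fun x => by
        change κ x (homAvg hX E τ x (J x w) (Pi.single i 1)) = _
        rw [homAvg_apply, map_smul, map_sum]
        simp only [hJ]
        rfl
    simp only [h1]
    have h2 : ContinuousOn (fun x : X => ∑ a : A, (κ x ∘ₗ fibRep hX E x a ∘ₗ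
        chartInv U κ hκ.bijective x) (∑ l, unitaryRep τ.ρ a⁻¹ (Pi.single i 1) l • w l)) U := by
      refine continuousOn_finsetSum _ fun a _ => ?_
      intro x hx
      have h3 := hκ.continuousAt_clm hκ (m := id) (fun x => fibRep hX E x a)
        (hE.continuous_act_apply (a : G) (p := fun t : E.Tot => t.proj) (q := fun t => t.proj)
          (fun t => hX a t.proj) (s := fun t => t.snd) continuous_id) hx hx
      exact (continuousAt_clm_apply.1 h3 _).continuousWithinAt
    exact h2.const_smul (Nat.card A : ℂ)⁻¹
  · refine ContinuousLinearMap.ext fun w => ?_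
    have h1 : P x w = K x ⟨homAvg hX E τ x (J x w), homAvg_mem hX E τ x _⟩ := hP₀ x w
    change P x (P x w) = P x w
    rw [h1, hPK x hx]

/-- Q_[τ] is discrete, so continuity of the action is checked for fixed q, jointly in the circle and
the total space. -/
theorem homA_isBundle [Finite A] {E : EqFamily X} (hE : E.IsBundle) :
    (homA c hX E).IsBundle := by
  refine EqFamily.isBundle_of_hasCharts (hasCharts_homA c hX hE) ?_
  refine continuous_homA_mk c hX ?_ fun v => ?_
  · exact continuous_fst.smul ((continuous_homA_proj c hX E).comp continuous_snd)
  · let Φ : τ.isotropy → Circle × (homA c hX E).Tot → E.Tot := fun q p =>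
      ⟨c.σ q • (show X from p.2.proj), (p.1 : ℂ) • E.act (c.σ q) rfl
        (p.2.snd.1 (Matrix.toLin' ((c.M q)⁻¹).1 v))⟩
    have hΦ : Continuous fun p : τ.isotropy × (Circle × (homA c hX E).Tot) => Φ p.1 p.2 := by
      refine continuous_prod_of_discrete_left.2 fun q => ?_
      change Continuous fun p : Circle × (homA c hX E).Tot => Φ q p
      refine hE.hasCharts.continuous_smul (continuous_subtype_val.comp continuous_fst) ?_
      exact hE.continuous_act_apply (c.σ q) (fun _ => rfl)
        (p := fun p : Circle × (homA c hX E).Tot => (p.2.proj : X))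
        ((continuous_homA_eval c hX E (Matrix.toLin' ((c.M q)⁻¹).1 v)).comp continuous_snd)
    have hr : Continuous fun p : (Ext c.cocycle) × (homA c hX E).Tot =>
        ((p.1.1, (p.1.2, p.2)) : τ.isotropy × (Circle × (homA c hX E).Tot)) :=
      (continuous_fst.comp continuous_fst).prodMk
        ((continuous_snd.comp continuous_fst).prodMk continuous_snd)
    refine (hΦ.comp hr).congr fun p => ?_
    -- The base point computed in `G` and the one computed in the quotient are equal but written
    -- differently; generalising the second allows the equality to be eliminated.
    have key : ∀ (y : X) (e : c.σ p.1.1 • (show X from p.2.proj) = y) (u : E.Fib (p.2.proj)),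
        (⟨c.σ p.1.1 • (show X from p.2.proj), (p.1.2 : ℂ) • E.act (c.σ p.1.1) rfl u⟩ : E.Tot) =
          ⟨y, (p.1.2 : ℂ) • E.act (c.σ p.1.1) e u⟩ := by
      rintro _ rfl _
      rfl
    exact key _ (c.σ_smul hX rfl) _

/-- `Hom_A(V_τ, -)` on isomorphisms. -/
def homAIso {E F : EqFamily X} (i : E.Iso F) : (homA c hX E).Iso (homA c hX F) where
  toEquiv x := homAFibCongr hX i x
  comm p _ _ e f := homAFibMap_homAAct c hX (fun x => (i.toEquiv x).toLinearMap)
    (fun g _ _ e v => i.comm g e v) p.1 p.2 (c.σ_smul hX e) f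
  continuous_toFun := continuous_homA_mk c hX (continuous_homA_proj c hX E) fun v =>
    i.continuous_toFun.comp (continuous_homA_eval c hX E v)
  continuous_invFun := continuous_homA_mk c hX (continuous_homA_proj c hX F) fun v =>
    i.continuous_invFun.comp (continuous_homA_eval c hX F v)

/-- `Hom_A(V_τ, -)` commutes with direct sums. -/
def homASum (E F : EqFamily X) :
    (homA c hX (E.sum F)).Iso ((homA c hX E).sum (homA c hX F)) where
  toEquiv x := homAFibSum hX E F x
  comm _ _ _ _ _ := rfl
  continuous_toFun := EqFamily.continuous_sum_mk
    (continuous_homA_mk c hX (continuous_homA_proj c hX (E.sum F)) fun v =>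
      (EqFamily.continuous_sum_fst E F).comp (continuous_homA_eval c hX (E.sum F) v))
    (continuous_homA_mk c hX (continuous_homA_proj c hX (E.sum F)) fun v =>
      (EqFamily.continuous_sum_snd E F).comp (continuous_homA_eval c hX (E.sum F) v))
  continuous_invFun := continuous_homA_mk c hX
    ((continuous_homA_proj c hX E).comp (EqFamily.continuous_sum_fst _ _)) fun v =>
    EqFamily.continuous_sum_mk
      ((continuous_homA_eval c hX E v).comp (EqFamily.continuous_sum_fst _ _))
      ((continuous_homA_eval c hX F v).comp (EqFamily.continuous_sum_snd _ _))

/-- `Hom_A(V_τ, 0) = 0`. -/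
def homAZero : (homA c hX (EqFamily.zero X)).Iso (EqFamily.zero _) where
  toEquiv _ :=
    { toFun := fun _ => PUnit.unit
      invFun := fun _ => 0
      map_add' := fun _ _ => rfl
      map_smul' := fun _ _ => rfl
      left_inv := fun _ => rfl
      right_inv := fun _ => rfl }
  comm _ _ _ _ _ := rfl
  continuous_toFun := continuous_induced_rng.2 (continuous_homA_proj c hX (EqFamily.zero X))
  continuous_invFun := continuous_homA_mk c hX continuous_induced_dom fun _ =>
    continuous_induced_rng.2 continuous_induced_dom

/-- `Hom_A(V_τ, -)` commutes with pullbacks. -/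
def homAPullback (hY : Y.TrivialOn A) (f : GMap X Y) (E : EqFamily Y) :
    (homA c hX (E.pullback f)).Iso ((homA c hY E).pullback
      ((f.res hX hY τ).comap (Ext.proj c.cocycle) (Ext.continuous_proj c.cocycle))) where
  toEquiv x := LinearEquiv.refl ℂ (homAFib hY τ E (f.toFun x))
  comm _ _ _ _ _ := rfl
  continuous_toFun := EqFamily.continuous_pullback_mk
    (continuous_homA_proj c hX (E.pullback f))
    (continuous_homA_mk c hY (f.continuous.comp (continuous_homA_proj c hX (E.pullback f)))
      fun v => (EqFamily.continuous_pullback_lift f E).comp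
        (continuous_homA_eval c hX (E.pullback f) v))
  continuous_invFun := continuous_homA_mk c hX (EqFamily.continuous_pullback_proj _ _) fun v =>
    EqFamily.continuous_pullback_mk (EqFamily.continuous_pullback_proj _ _)
      ((continuous_homA_eval c hY E v).comp (EqFamily.continuous_pullback_lift _ _))

/-- `E ↦ Hom_A(V_τ, E)` on isomorphism classes. -/
def homVec [Finite A] : Vec X →+ TwVec c.cocycle (X.res hX τ) where
  toFun := Quotient.lift (fun E : EqBundle X => (⟨Vec.mk ⟨homA c hX E.fam,
      homA_isBundle c hX E.isBundle⟩, _, homA_isScalar c hX E.fam, rfl⟩ :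
        TwVec c.cocycle (X.res hX τ)))
    (by rintro E F ⟨i⟩; exact Subtype.ext (Quotient.sound ⟨homAIso c hX i⟩))
  map_zero' := Subtype.ext (Quotient.sound ⟨homAZero c hX⟩)
  map_add' := by
    rintro ⟨E⟩ ⟨F⟩
    exact Subtype.ext (Quotient.sound ⟨homASum c hX E.fam F.fam⟩)

theorem homVec_map [Finite A] (hY : Y.TrivialOn A) (f : GMap X Y) (k : Vec Y) :
    homVec c hX (Vec.map f k) = TwVec.map c.cocycle (f.res hX hY τ) (homVec c hY k) := by
  rcases k with ⟨E⟩
  exact Subtype.ext (Quotient.sound ⟨homAPullback c hX hY f E.fam⟩)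

end HomBundle

/-! ## Bundles induced from twisted bundles -/

section CosetIndex

variable {G : Type v} [Group G]

/-- A transitive finite `G`-set in `Type` with point stabiliser `S`, and a section of
`G → G / S`. -/
structure CosetIndex (S : Subgroup G) where
  J : Type
  [fintype : Fintype J]
  [decEq : DecidableEq J]
  [act : MulAction G J]
  base : J
  t : J → G
  t_base : t base = 1
  t_smul : ∀ j, t j • base = j
  stab : ∀ g : G, g • base = base ↔ g ∈ S

attribute [instance] CosetIndex.fintype CosetIndex.decEq CosetIndex.act

theorem exists_cosetIndex [Finite G] (S : Subgroup G) : Nonempty (CosetIndex S) := by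
  classical
  let e : Fin (Nat.card (G ⧸ S)) ≃ G ⧸ S := (Finite.equivFin _).symm
  let act : MulAction G (Fin (Nat.card (G ⧸ S))) := e.mulAction G
  let b : Fin (Nat.card (G ⧸ S)) := e.symm ((1 : G) : G ⧸ S)
  have hs : ∀ (g : G) j, g • j = e.symm (g • e j) := fun _ _ => rfl
  have hb : ∀ g : G, g • b = e.symm (g : G ⧸ S) := fun g => by
    rw [hs, e.apply_symm_apply]
    congr 1
    change ((g * 1 : G) : G ⧸ S) = _
    rw [mul_one]
  -- The chosen representative of the trivial coset need not be `1`, hence the override of `t` at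
  -- the base point.
  refine ⟨{ J := Fin (Nat.card (G ⧸ S)), base := b, t := fun j => if j = b then 1 else (e j).out,
            t_base := if_pos rfl, t_smul := fun j => ?_, stab := fun g => ?_ }⟩
  · by_cases hj : j = b
    · rw [if_pos hj, one_smul, hj]
    · simp only [if_neg hj]
      rw [hb, QuotientGroup.out_eq', e.symm_apply_apply]
  · rw [hb, e.symm.injective.eq_iff, eq_comm, QuotientGroup.eq]
    simp

namespace CosetIndex

variable {S : Subgroup G} (I : CosetIndex S)

/-- The element of the stabiliser by which `g` acts on the component of `j`. -/
def k (g : G) (j : I.J) : S :=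
  ⟨(I.t j)⁻¹ * g * I.t (g⁻¹ • j), by
    rw [← I.stab, mul_smul, mul_smul, I.t_smul, smul_inv_smul, inv_smul_eq_iff, I.t_smul]⟩

/-- The identity k(g, j) t_{g⁻¹j}⁻¹ = t_j⁻¹ g, applied to a point. It makes `k` map the fibre stored
in component g⁻¹j over x to the fibre stored in component j over gx. -/
theorem k_smul {X : Type*} [MulAction G X] (g : G) (j : I.J) {x y : X} (e : g • x = y) :
    (I.k g j : G) • (I.t (g⁻¹ • j))⁻¹ • x = (I.t j)⁻¹ • y := by
  simp only [k, mul_smul, smul_inv_smul, e]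

/-- Normality puts `A` inside every conjugate of `S`, and these are the stabilisers of the points of
`J`. -/
theorem smul_eq_self {A : Subgroup G} [A.Normal] (hA : A ≤ S) (a : A) (j : I.J) :
    (a : G) • j = j := by
  have h1 : (I.t j)⁻¹ * a * I.t j ∈ S :=
    hA (by simpa using ‹A.Normal›.conj_mem a a.2 (I.t j)⁻¹)
  have h2 := (I.stab _).2 h1
  rwa [mul_smul, mul_smul, I.t_smul, inv_smul_eq_iff, I.t_smul] at h2

theorem conjNormal_t_base {A : Subgroup G} [A.Normal] (a : A) :
    (MulAut.conjNormal (I.t I.base)⁻¹ : MulAut A) a = a := by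
  rw [I.t_base, inv_one, map_one]
  rfl

theorem t_mem_iff (j : I.J) : I.t j ∈ S ↔ j = I.base := by
  rw [← I.stab, I.t_smul]

end CosetIndex
end CosetIndex

/-! ### The projective extension of τ to G_[τ] -/

section Twist

variable {G : Type v} [Group G] {A : Subgroup G} [A.Normal]

/-- The operator τ(a) intertwines a · τ with τ. -/
theorem le_stabilizer_irr (τ : IrrRep A) : A ≤ MulAction.stabilizer G (Irr.mk τ) := by
  intro a ha
  refine Quotient.sound ⟨.mk (LinearEquiv.ofLinearMap (unitaryRep τ.ρ ⟨a, ha⟩)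
    (unitaryRep τ.ρ ⟨a, ha⟩⁻¹) ?_ ?_) fun b => ?_⟩
  · exact (map_mul (unitaryRep τ.ρ) _ _).symm.trans (by rw [mul_inv_cancel, map_one]; rfl)
  · exact (map_mul (unitaryRep τ.ρ) _ _).symm.trans (by rw [inv_mul_cancel, map_one]; rfl)
  · change unitaryRep τ.ρ ⟨a, ha⟩ * unitaryRep τ.ρ (MulAut.conjNormal a⁻¹ b) =
      unitaryRep τ.ρ b * unitaryRep τ.ρ ⟨a, ha⟩
    rw [← map_mul, ← map_mul]
    congr 1
    ext
    simp [mul_assoc]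

variable {τ : IrrRep A} (c : TwistChoice τ)

namespace TwistChoice

/-- The class in `Q_[τ]` of an element of `G_[τ]`. -/
def cls (τ : IrrRep A) : MulAction.stabilizer G (Irr.mk τ) →* τ.isotropy where
  toFun k := ⟨((k : G) : G ⧸ A), k, k.2, rfl⟩
  map_one' := rfl
  map_mul' _ _ := rfl

/-- The element `σ(q)⁻¹ k` of `A`, where `q` is the class of `k`. -/
def rem (k : MulAction.stabilizer G (Irr.mk τ)) : A :=
  ⟨(c.σ (cls τ k))⁻¹ * k, by
    rw [← QuotientGroup.eq, c.mk_σ]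
    rfl⟩

/-- The unitary matrix `M_q τ(σ(q)⁻¹ k)`, where `q` is the class of `k`. -/
def R (k : MulAction.stabilizer G (Irr.mk τ)) : Matrix.unitaryGroup (Fin τ.d) ℂ :=
  c.M (cls τ k) * τ.ρ (c.rem k)

/-- `R` is projective with multiplier inverse to α_τ: conjugation by σ moves τ(`rem k`) past `M`,
and `α_mul` does the rest. -/
theorem R_mul (k l : MulAction.stabilizer G (Irr.mk τ)) :
    (c.α (cls τ k) (cls τ l) : ℂ) • ((c.R k).1 * (c.R l).1) = (c.R (k * l)).1 := by
  have h1 : c.R k * c.R l = c.M (cls τ k) * c.M (cls τ l) *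
      (τ.ρ (MulAut.conjNormal (c.σ (cls τ l))⁻¹ (c.rem k)) * τ.ρ (c.rem l)) := by
    have := c.ρ_mul_M (cls τ l) (c.rem k)
    unfold R
    rw [mul_assoc, ← mul_assoc (τ.ρ (c.rem k)), this]
    group
  have h2 := congrArg Subtype.val h1
  simp only [Submonoid.coe_mul] at h2
  rw [h2, ← smul_mul_assoc, c.α_mul]
  have h3 : c.rem (k * l) = c.χ (cls τ k) (cls τ l) *
      ((MulAut.conjNormal (c.σ (cls τ l))⁻¹ : MulAut A) (c.rem k) * c.rem l) := by
    ext
    simp [χ, rem, mul_assoc]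
  rw [R, h3, map_mul, map_mul, map_mul]
  simp only [Submonoid.coe_mul, mul_assoc]

theorem R_of_mem {k : MulAction.stabilizer G (Irr.mk τ)} {a : A} (hk : (k : G) = a) :
    c.R k = τ.ρ a := by
  have h1 : cls τ k = 1 := Subtype.ext (by
    change ((k : G) : G ⧸ A) = 1
    rw [hk, QuotientGroup.eq_one_iff]
    exact a.2)
  have h2 : c.rem k = a := by
    ext
    simp [rem, h1, c.σ_one, hk]
  rw [R, h1, h2, c.M_one, one_mul]

/-- A `TwistChoice` only asks that σ(q) lie in the coset q. That coset also contains an element of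
G_[τ], and G_[τ] contains `A`. -/
theorem σ_mem (q : τ.isotropy) : c.σ q ∈ MulAction.stabilizer G (Irr.mk τ) := by
  obtain ⟨g, hg, h⟩ := q.2
  have h1 : g⁻¹ * c.σ q ∈ A := by
    rw [← QuotientGroup.eq, c.mk_σ]
    exact h
  have h2 := mul_mem hg (le_stabilizer_irr τ h1)
  rwa [mul_inv_cancel_left] at h2

theorem cls_σ {k : MulAction.stabilizer G (Irr.mk τ)} {q : τ.isotropy} (hk : (k : G) = c.σ q) :
    cls τ k = q := Subtype.ext (by
  change ((k : G) : G ⧸ A) = q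
  rw [hk, c.mk_σ])

theorem R_σ {k : MulAction.stabilizer G (Irr.mk τ)} {q : τ.isotropy} (hk : (k : G) = c.σ q) :
    c.R k = c.M q := by
  have h2 : c.rem k = 1 := by
    ext
    simp [rem, c.cls_σ hk, hk]
  rw [R, c.cls_σ hk, h2, map_one, mul_one]

/-- The element `(q, 1)` of the central extension, where `q` is the class of `k`. -/
def lift (k : MulAction.stabilizer G (Irr.mk τ)) : Ext c.cocycle := (cls τ k, 1)

/-- The lifts multiply with multiplier α_τ, written as a central element so that the scalar
condition applies to it. -/
theorem lift_mul (k l : MulAction.stabilizer G (Irr.mk τ)) :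
    c.lift k * c.lift l = Ext.central c.cocycle (c.α (cls τ k) (cls τ l)) * c.lift (k * l) := by
  refine Prod.ext ?_ ?_
  · change cls τ k * cls τ l = 1 * cls τ (k * l)
    rw [map_mul, one_mul]
  · change c.α (cls τ k) (cls τ l) * 1 * 1 =
      c.cocycle.toFun 1 (cls τ (k * l)) * c.α (cls τ k) (cls τ l) * 1
    rw [c.cocycle.one_left, one_mul, mul_one]

/-- Elements of `A` have trivial class; for this reason `A` will act on V_τ ⊗ F through V_τ alone.
-/
theorem lift_of_mem {k : MulAction.stabilizer G (Irr.mk τ)} {a : A} (hk : (k : G) = a) :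
    c.lift k = 1 := by
  refine Prod.ext (Subtype.ext ?_) rfl
  change ((k : G) : G ⧸ A) = 1
  rw [hk, QuotientGroup.eq_one_iff]
  exact a.2

/-- Reduces the action of the whole extension on a twisted bundle to scalars and lifts. -/
theorem ext_eq_central_mul (p : Ext c.cocycle) {k : MulAction.stabilizer G (Irr.mk τ)}
    (hk : (k : G) = c.σ p.1) : p = Ext.central c.cocycle p.2 * c.lift k := by
  refine Prod.ext ?_ ?_
  · change p.1 = 1 * cls τ k
    rw [c.cls_σ hk, one_mul]
  · change p.2 = c.cocycle.toFun 1 _ * p.2 * 1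
    rw [c.cocycle.one_left, one_mul, mul_one]

end TwistChoice
end Twist

/-! ### The honest action of G_[τ] on V_τ ⊗ F -/

section TwistAction

variable {G : Type v} [Group G] [TopologicalSpace G] [DiscreteTopology G] {A : Subgroup G}
  [A.Normal] {τ : IrrRep A} (c : TwistChoice τ) {X : GSpace.{u, v} G} (hX : X.TrivialOn A)

/-- A point of `X` as a point of the corresponding space over the central extension. -/
def TwistChoice.pt (x : X) : (X.res hX τ).ext c.cocycle := x

theorem TwistChoice.continuous_pt : Continuous (c.pt hX) := continuous_id

theorem TwistChoice.central_smul (z : Circle) (x : X) :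
    Ext.central c.cocycle z • c.pt hX x = c.pt hX x :=
  one_smul τ.isotropy (show X.res hX τ from x)

theorem TwistChoice.lift_smul (k : MulAction.stabilizer G (Irr.mk τ)) {x y : X}
    (e : (k : G) • x = y) : c.lift k • c.pt hX x = c.pt hX y :=
  (GSpace.quot_smul hX (k : G) x).trans e

variable (F : EqFamily ((X.res hX τ).ext c.cocycle))

/-- The action of `G_[τ]` on `V_τ ⊗ F`. -/
def twAct (k : MulAction.stabilizer G (Irr.mk τ)) {x y : X} (e : (k : G) • x = y) :
    (Fin τ.d → F.Fib (c.pt hX x)) →ₗ[ℂ] (Fin τ.d → F.Fib (c.pt hX y)) :=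
  LinearMap.pi fun i => ∑ l, (c.R k).1 i l • (F.act (c.lift k) (c.lift_smul hX k e) ∘ₗ
    LinearMap.proj l)

theorem twAct_apply (k : MulAction.stabilizer G (Irr.mk τ)) {x y : X} (e : (k : G) • x = y)
    (s : Fin τ.d → F.Fib (c.pt hX x)) (i : Fin τ.d) :
    twAct c hX F k e s i = ∑ l, (c.R k).1 i l • F.act (c.lift k) (c.lift_smul hX k e) (s l) := by
  simp [twAct, LinearMap.sum_apply]

theorem twAct_of_mem {k : MulAction.stabilizer G (Irr.mk τ)} {a : A} (hk : (k : G) = a) {x : X}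
    (e : (k : G) • x = x) (s : Fin τ.d → F.Fib (c.pt hX x)) (i : Fin τ.d) :
    twAct c hX F k e s i = ∑ l, (τ.ρ a).1 i l • s l := by
  rw [twAct_apply, c.R_of_mem hk]
  refine Finset.sum_congr rfl fun l _ => ?_
  rw [F.act_congr (c.lift_of_mem hk) (c.lift_smul hX k e) (one_smul _ _), F.act_one]

theorem act_ext_eq_smul (hF : F.IsScalar) (p : Ext c.cocycle)
    {k : MulAction.stabilizer G (Irr.mk τ)} (hk : (k : G) = c.σ p.1) {x y : X}
    (e : (k : G) • x = y) (e' : p • c.pt hX x = c.pt hX y) (v : F.Fib (c.pt hX x)) :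
    F.act p e' v = (p.2 : ℂ) • F.act (c.lift k) (c.lift_smul hX k e) v := by
  have e₂ : (Ext.central c.cocycle p.2 * c.lift k) • c.pt hX x = c.pt hX y := by
    rw [← c.ext_eq_central_mul p hk, e']
  rw [F.act_congr (c.ext_eq_central_mul p hk) e' e₂,
    F.act_mul _ _ (c.lift_smul hX k e) (c.central_smul hX p.2 y) e₂, hF]

/-- The multipliers of `R` and of the lifts are inverse to each other. The scalar condition turns
the central element of `TwistChoice.lift_mul` into the number that `TwistChoice.R_mul` absorbs. -/
theorem twAct_mul (hF : F.IsScalar) (k l : MulAction.stabilizer G (Irr.mk τ)) {x y z : X}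
    (e : (l : G) • x = y) (e' : (k : G) • y = z) (e'' : ((k * l : MulAction.stabilizer G
      (Irr.mk τ)) : G) • x = z) (s : Fin τ.d → F.Fib (c.pt hX x)) :
    twAct c hX F (k * l) e'' s = twAct c hX F k e' (twAct c hX F l e s) := by
  funext i
  have h1 : ∀ v : F.Fib (c.pt hX x), F.act (c.lift k) (c.lift_smul hX k e')
      (F.act (c.lift l) (c.lift_smul hX l e) v) = (c.α (TwistChoice.cls τ k)
        (TwistChoice.cls τ l) : ℂ) • F.act (c.lift (k * l)) (c.lift_smul hX (k * l) e'') v :=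
    fun v => by
      have e₁ : (c.lift k * c.lift l) • c.pt hX x = c.pt hX z := by
        rw [mul_smul, c.lift_smul hX l e, c.lift_smul hX k e']
      have e₂ := e₁
      rw [c.lift_mul] at e₂
      rw [← F.act_mul _ _ _ _ e₁, F.act_congr (c.lift_mul k l) e₁ e₂,
        F.act_mul _ _ (c.lift_smul hX (k * l) e'') (c.central_smul hX _ z) e₂, hF]
  simp only [twAct_apply, map_sum, map_smul, h1, Finset.smul_sum, smul_smul]
  rw [Finset.sum_comm]
  refine Finset.sum_congr rfl fun m _ => ?_
  rw [← Finset.sum_smul]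
  congr 1
  have h2 := congrFun (congrFun (c.R_mul k l) i) m
  rw [← h2, Matrix.smul_apply, Matrix.mul_apply, smul_eq_mul, Finset.mul_sum]
  exact Finset.sum_congr rfl fun _ _ => by ring

end TwistAction

/-! ### The induced bundle -/

section Induced

variable {G : Type v} [Group G] [TopologicalSpace G] [DiscreteTopology G] {A : Subgroup G}
  [A.Normal] {O : Type} {τ : O → IrrRep A} (c : ∀ o, TwistChoice (τ o))
  (I : ∀ o, CosetIndex (MulAction.stabilizer G (Irr.mk (τ o))))
  {X : GSpace.{u, v} G} (hX : X.TrivialOn A)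
  (F : ∀ o, EqFamily ((X.res hX (τ o)).ext (c o).cocycle))

/-- The set of pairs of an element `j` of the orbit of `[τ_o]` and an index of a coordinate of
`V_{τ_o}`, for varying `o`. -/
abbrev IndIndex : Type := Σ o, (I o).J × Fin (τ o).d

/-- The fibre `⨁_o ⨁_j V_{τ_o} ⊗ F_o` of the induced bundle, with `F_o` taken at `t_j⁻¹ x`. -/
abbrev indFib (x : X) : Type u :=
  ∀ p : IndIndex I, (F p.1).Fib ((c p.1).pt hX (((I p.1).t p.2.1)⁻¹ • x))

-- The spaces holding the components depend on `j`, so equal indices cannot be exchanged by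
-- rewriting; here `j` and `k` are substituted at once.
variable {c hX F} in
theorem twAct_indFib_congr {x y : X} {o : O} {j₁ j₂ : (I o).J} (hj : j₁ = j₂)
    {k₁ k₂ : MulAction.stabilizer G (Irr.mk (τ o))} (hk : k₁ = k₂) (s : indFib c I hX F x)
    (e₁ : (k₁ : G) • ((I o).t j₁)⁻¹ • x = y) (e₂ : (k₂ : G) • ((I o).t j₂)⁻¹ • x = y) :
    twAct (c o) hX (F o) k₁ e₁ (fun l => s ⟨o, j₁, l⟩) =
      twAct (c o) hX (F o) k₂ e₂ (fun l => s ⟨o, j₂, l⟩) := by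
  subst hj
  subst hk
  rfl

/-- The action of `G` on the induced bundle. -/
def indAct (g : G) {x y : X} (e : g • x = y) : indFib c I hX F x →ₗ[ℂ] indFib c I hX F y :=
  LinearMap.pi fun p => LinearMap.proj p.2.2 ∘ₗ
    twAct (c p.1) hX (F p.1) ((I p.1).k g p.2.1) ((I p.1).k_smul g p.2.1 e) ∘ₗ
      LinearMap.pi fun l => LinearMap.proj (⟨p.1, g⁻¹ • p.2.1, l⟩ : IndIndex I)

theorem indAct_apply (g : G) {x y : X} (e : g • x = y) (s : indFib c I hX F x) (o : O)
    (j : (I o).J) (i : Fin (τ o).d) :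
    indAct c I hX F g e s ⟨o, j, i⟩ = twAct (c o) hX (F o) ((I o).k g j) ((I o).k_smul g j e)
      (fun l => s ⟨o, g⁻¹ • j, l⟩) i := rfl

/-- An element `a` fixes every `j`, and k(a, j) = t_j⁻¹ a t_j lies in `A`. So `A` acts on the
component of `j` through the conjugate t_j · τ_o, which is what Schur's lemma will distinguish. -/
theorem indAct_of_mem (a : A) (x : X) (s : indFib c I hX F x) (o : O)
    (j : (I o).J) (i : Fin (τ o).d) :
    indAct c I hX F (a : G) (hX a x) s ⟨o, j, i⟩ =
      ∑ l, ((τ o).ρ (MulAut.conjNormal ((I o).t j)⁻¹ a)).1 i l • s ⟨o, j, l⟩ := by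
  have hj : (a : G)⁻¹ • j = j := by
    rw [inv_smul_eq_iff, (I o).smul_eq_self (le_stabilizer_irr (τ o))]
  have hk : (((I o).k (a : G) j : MulAction.stabilizer G (Irr.mk (τ o))) : G) =
      (MulAut.conjNormal ((I o).t j)⁻¹ a : A) := by
    simp [CosetIndex.k, hj]
  have e₁ : (((I o).k (a : G) j : MulAction.stabilizer G (Irr.mk (τ o))) : G) •
      ((I o).t j)⁻¹ • x = ((I o).t j)⁻¹ • x := by
    rw [hk, hX]
  rw [indAct_apply, twAct_indFib_congr I hj rfl s _ e₁, twAct_of_mem _ _ _ hk]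

/-- The bundle induced from twisted bundles. -/
def ind (hF : ∀ o, (F o).IsScalar) : EqFamily X where
  Fib := indFib c I hX F
  top := TopologicalSpace.induced (fun t => (t.proj, fun p : IndIndex I =>
    (⟨(c p.1).pt hX (((I p.1).t p.2.1)⁻¹ • t.proj), t.snd p⟩ : (F p.1).Tot))) inferInstance
  act g _ _ e := indAct c I hX F g e
  act_one {x} e s := by
    funext ⟨o, j, i⟩
    have hj : (1 : G)⁻¹ • j = j := by rw [inv_one, one_smul]
    have hk : (I o).k 1 j = 1 := Subtype.ext (by simp [CosetIndex.k])
    have e₁ : ((1 : MulAction.stabilizer G (Irr.mk (τ o))) : G) • ((I o).t j)⁻¹ • x =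
      ((I o).t j)⁻¹ • x := one_smul G _
    rw [indAct_apply, twAct_indFib_congr I hj hk s _ e₁,
      twAct_of_mem (c o) hX (F o) (a := 1) rfl e₁]
    simp [Matrix.one_apply]
  act_mul g h x y z hxy hyz hxz s := by
    funext ⟨o, j, i⟩
    have hj : (g * h)⁻¹ • j = h⁻¹ • g⁻¹ • j := by rw [mul_inv_rev, mul_smul]
    -- The cocycle identity of `k`: it makes permuting the components and acting by `k` an action of
    -- `G`.
    have hk : (I o).k (g * h) j = (I o).k g j * (I o).k h (g⁻¹ • j) := Subtype.ext (by
      simp [CosetIndex.k, mul_smul, mul_assoc])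
    have e₁ : (((I o).k g j * (I o).k h (g⁻¹ • j) : MulAction.stabilizer G (Irr.mk (τ o))) : G) •
        ((I o).t (h⁻¹ • g⁻¹ • j))⁻¹ • x = ((I o).t j)⁻¹ • z := by
      rw [Subgroup.coe_mul, mul_smul, (I o).k_smul h (g⁻¹ • j) hxy, (I o).k_smul g j hyz]
    rw [indAct_apply, twAct_indFib_congr I hj hk s _ e₁,
      twAct_mul (c o) hX (F o) (hF o) _ _ ((I o).k_smul h (g⁻¹ • j) hxy) ((I o).k_smul g j hyz) e₁]
    rfl

variable (hF : ∀ o, (F o).IsScalar)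

theorem isInducing_ind : IsInducing fun t : (ind c I hX F hF).Tot =>
    (t.proj, fun p : IndIndex I =>
      (⟨(c p.1).pt hX (((I p.1).t p.2.1)⁻¹ • t.proj), t.snd p⟩ : (F p.1).Tot)) := ⟨rfl⟩

theorem continuous_ind_proj : Continuous fun t : (ind c I hX F hF).Tot => t.proj :=
  (isInducing_ind c I hX F hF).continuous.fst

theorem continuous_ind_component (p : IndIndex I) : Continuous fun t : (ind c I hX F hF).Tot =>
    (⟨(c p.1).pt hX (((I p.1).t p.2.1)⁻¹ • t.proj), t.snd p⟩ : (F p.1).Tot) :=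
  (continuous_apply p).comp (isInducing_ind c I hX F hF).continuous.snd

theorem continuous_ind_mk {Z : Type*} [TopologicalSpace Z] {g : Z → (ind c I hX F hF).Tot}
    (h₁ : Continuous fun z => (g z).proj)
    (h₂ : ∀ p : IndIndex I, Continuous fun z =>
      (⟨(c p.1).pt hX (((I p.1).t p.2.1)⁻¹ • (g z).proj), (g z).snd p⟩ : (F p.1).Tot)) :
    Continuous g :=
  (isInducing_ind c I hX F hF).continuous_iff.2 (h₁.prodMk (continuous_pi h₂))

/-- The family is a finite fibre product of pullbacks of the F_o along x ↦ t_j⁻¹x, so `HasCharts.pi`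
gives charts. As `G` is discrete, the action is checked one `g` at a time. -/
theorem ind_isBundle [Finite O] (hB : ∀ o, (F o).IsBundle) : (ind c I hX F hF).IsBundle := by
  refine EqFamily.isBundle_of_hasCharts ?_ ?_
  · exact HasCharts.pi (D := fun p : IndIndex I => (F p.1).Fib) (fun p => (hB p.1).hasCharts)
      (fun p x => (c p.1).pt hX (((I p.1).t p.2.1)⁻¹ • x))
      (fun p => ((c p.1).continuous_pt hX).comp (continuous_const_smul _))
      (fun x => LinearEquiv.refl ℂ (indFib c I hX F x)) (isInducing_ind c I hX F hF)
  · refine continuous_prod_of_discrete_left.2 fun g => ?_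
    have hp := continuous_ind_proj c I hX F hF
    refine continuous_ind_mk c I hX F hF (hp.const_smul g) ?_
    rintro ⟨o, j, i⟩
    have h1 : ∀ t : (ind c I hX F hF).Tot, ((ind c I hX F hF).act g rfl t.snd) ⟨o, j, i⟩ =
        ∑ l, ((c o).R ((I o).k g j)).1 i l • (F o).act ((c o).lift ((I o).k g j))
          ((c o).lift_smul hX ((I o).k g j) ((I o).k_smul g j rfl))
          (t.snd ⟨o, g⁻¹ • j, l⟩) := fun t =>
      twAct_apply (c o) hX (F o) ((I o).k g j) ((I o).k_smul g j rfl) _ i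
    simp only [h1]
    refine (hB o).hasCharts.continuous_sum
      (p := fun t : (ind c I hX F hF).Tot => (c o).pt hX (((I o).t j)⁻¹ • g • t.proj))
      (((c o).continuous_pt hX).comp ((hp.const_smul g).const_smul _)) _ fun l => ?_
    refine (hB o).hasCharts.continuous_smul continuous_const ?_
    exact (hB o).continuous_act_apply ((c o).lift ((I o).k g j))
      (fun t : (ind c I hX F hF).Tot => (c o).lift_smul hX ((I o).k g j) ((I o).k_smul g j rfl))
      (continuous_ind_component c I hX F hF ⟨o, g⁻¹ • j, l⟩)

end Induced

/-- Acting by `1` serves as transport between fibres over points that are equal but written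
differently. -/
theorem EqFamily.bijective_act_one {H : Type v} [Group H] [TopologicalSpace H]
    {X : GSpace.{u, v} H} (E : EqFamily X) {x y : X} (e : (1 : H) • x = y) :
    Function.Bijective (E.act 1 e) := by
  have hxy : x = y := (one_smul H x).symm.trans e
  subst hxy
  have : ⇑(E.act 1 e) = id := funext fun v => E.act_one e v
  rw [this]
  exact Function.bijective_id

/-! ### Recovering the twisted bundles from the induced bundle -/

section InducedHom

variable {G : Type v} [Group G] [TopologicalSpace G] [DiscreteTopology G] {A : Subgroup G}
  [A.Normal] {O : Type} {τ : O → IrrRep A} (c : ∀ o, TwistChoice (τ o))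
  (I : ∀ o, CosetIndex (MulAction.stabilizer G (Irr.mk (τ o))))
  {X : GSpace.{u, v} G} (hX : X.TrivialOn A)
  (F : ∀ o, EqFamily ((X.res hX (τ o)).ext (c o).cocycle))

theorem one_smul_pt (o : O) (x : X) : (1 : Ext (c o).cocycle) • (c o).pt hX x =
    (c o).pt hX (((I o).t (I o).base)⁻¹ • x) := by
  rw [one_smul, (I o).t_base, inv_one, one_smul]

/-- The identification of `F_o` at `x` and at `t_j⁻¹ x`, where `j` is the base point. -/
def toBase (o : O) (x : X) : (F o).Fib ((c o).pt hX x) →ₗ[ℂ]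
    (F o).Fib ((c o).pt hX (((I o).t (I o).base)⁻¹ • x)) :=
  (F o).act 1 (one_smul_pt c I hX o x)

variable [DecidableEq O]

/-- The map `F_o → Hom(V_{τ_o}, Ind F)`, `u ↦ (w ↦ w ⊗ u)`. -/
def indEmb (o : O) (x : X) : (F o).Fib ((c o).pt hX x) →ₗ[ℂ]
    ((Fin (τ o).d → ℂ) →ₗ[ℂ] indFib c I hX F x) :=
  ∑ i, (LinearMap.smulRightₗ (LinearMap.proj i : (Fin (τ o).d → ℂ) →ₗ[ℂ] ℂ)) ∘ₗ
    LinearMap.single ℂ (fun p : IndIndex I =>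
      (F p.1).Fib ((c p.1).pt hX (((I p.1).t p.2.1)⁻¹ • x))) ⟨o, (I o).base, i⟩ ∘ₗ
    toBase c I hX F o x

theorem indEmb_apply (o : O) (x : X) (u : (F o).Fib ((c o).pt hX x)) (w : Fin (τ o).d → ℂ)
    (p : IndIndex I) : indEmb c I hX F o x u w p =
      ∑ i, w i • (Pi.single (M := fun p : IndIndex I =>
        (F p.1).Fib ((c p.1).pt hX (((I p.1).t p.2.1)⁻¹ • x))) (⟨o, (I o).base, i⟩ : IndIndex I)
        (toBase c I hX F o x u)) p := by
  simp [indEmb, LinearMap.sum_apply, Finset.sum_apply]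

theorem indEmb_base (o : O) (x : X) (u : (F o).Fib ((c o).pt hX x)) (w : Fin (τ o).d → ℂ)
    (i : Fin (τ o).d) :
    indEmb c I hX F o x u w ⟨o, (I o).base, i⟩ = w i • toBase c I hX F o x u := by
  rw [indEmb_apply, Finset.sum_eq_single i]
  · rw [Pi.single_eq_same]
  · intro l _ hl
    rw [Pi.single_eq_of_ne, smul_zero]
    intro h
    simp only [Sigma.mk.injEq, heq_eq_eq, Prod.mk.injEq, true_and] at h
    exact hl h.symm
  · intro h
    exact absurd (Finset.mem_univ i) h

theorem indEmb_of_ne {o o' : O} {j : (I o').J}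
    (h : (⟨o', j⟩ : Σ o, (I o).J) ≠ ⟨o, (I o).base⟩) (x : X) (u : (F o).Fib ((c o).pt hX x))
    (w : Fin (τ o).d → ℂ) (i : Fin (τ o').d) :
    indEmb c I hX F o x u w ⟨o', j, i⟩ = 0 := by
  rw [indEmb_apply]
  refine Finset.sum_eq_zero fun l _ => ?_
  rw [Pi.single_eq_of_ne, smul_zero]
  intro h'
  exact h (congrArg (fun p : IndIndex I => (⟨p.1, p.2.1⟩ : Σ o, (I o).J)) h')

/-- The image sits in the base component of `o`, where `t` is `1` and `A` acts by τ_o itself. -/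
theorem indEmb_unitaryRep (o : O) (x : X) (u : (F o).Fib ((c o).pt hX x)) (a : A)
    (w : Fin (τ o).d → ℂ) : indEmb c I hX F o x u (unitaryRep (τ o).ρ a w) =
      indAct c I hX F (a : G) (hX a x) (indEmb c I hX F o x u w) := by
  funext ⟨o', j, i⟩
  rw [indAct_of_mem]
  rcases eq_or_ne (⟨o', j⟩ : Σ o, (I o).J) ⟨o, (I o).base⟩ with h | h
  · obtain ⟨rfl, h⟩ := Sigma.mk.inj_iff.1 h
    obtain rfl := eq_of_heq h
    rw [CosetIndex.conjNormal_t_base]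
    simp only [indEmb_base, smul_smul, ← Finset.sum_smul]
    rfl
  · simp only [indEmb_of_ne c I hX F h, smul_zero, Finset.sum_const_zero]

variable (hF : ∀ o, (F o).IsScalar)

/-- The map `F_o → Hom_A(V_{τ_o}, Ind F)`. -/
def indHom (o : O) (x : X) : (F o).Fib ((c o).pt hX x) →ₗ[ℂ]
    homAFib hX (τ o) (ind c I hX F hF) x :=
  (indEmb c I hX F o x).codRestrict _ fun u a w => indEmb_unitaryRep c I hX F o x u a w

theorem indHom_coe (o : O) (x : X) (u : (F o).Fib ((c o).pt hX x)) (w : Fin (τ o).d → ℂ) :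
    (indHom c I hX F hF o x u).1 w = indEmb c I hX F o x u w := rfl

theorem indHom_injective (o : O) (x : X) : Function.Injective (indHom c I hX F hF o x) := by
  intro u u' h
  have h1 := congrArg (fun f : homAFib hX (τ o) (ind c I hX F hF) x =>
    (f.1 (Pi.single ⟨0, (τ o).d_pos⟩ 1) : indFib c I hX F x)
      ⟨o, (I o).base, ⟨0, (τ o).d_pos⟩⟩) h
  simp only [indHom_coe] at h1
  rw [indEmb_base, indEmb_base, Pi.single_eq_same, one_smul, one_smul] at h1
  exact ((F o).bijective_act_one _).1 h1

/-- The representations `τ_o` lie in different orbits. -/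
def DistinctOrbits {O : Type*} (τ : O → IrrRep A) : Prop :=
  ∀ (o o' : O) (g : G), Irr.mk (τ o) = g • Irr.mk (τ o') → o = o'

/-- The component of `j` over `o'` is a multiple of t_j · τ_{o'}. It receives a nonzero map from τ_o
only if `o' = o`, the orbits being distinct, and t_j fixes [τ_o], so that `j` is the base point.
There Schur's lemma gives the form w ↦ w ⊗ u. -/
theorem indHom_surjective (hτ : DistinctOrbits τ) (o : O) (x : X) :
    Function.Surjective (indHom c I hX F hF o x) := by
  intro f
  let φ : ∀ (o' : O) (j : (I o').J), (Fin (τ o).d → ℂ) →ₗ[ℂ]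
      (Fin (τ o').d → (F o').Fib ((c o').pt hX (((I o').t j)⁻¹ • x))) := fun o' j =>
    (LinearMap.pi fun i => LinearMap.proj (R := ℂ) (φ := fun p : IndIndex I =>
      (F p.1).Fib ((c p.1).pt hX (((I p.1).t p.2.1)⁻¹ • x))) (⟨o', j, i⟩ : IndIndex I)) ∘ₗ f.1
  have hφ : ∀ o' j w i, φ o' j w i = (f.1 w : indFib c I hX F x) ⟨o', j, i⟩ :=
    fun _ _ _ _ => rfl
  have hφa : ∀ o' j (a : A) w i, φ o' j (unitaryRep (τ o).ρ a w) i =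
      ∑ l, ((τ o').ρ (MulAut.conjNormal ((I o').t j)⁻¹ a)).1 i l • φ o' j w l :=
    fun o' j a w i => (congrFun (f.2 a w) ⟨o', j, i⟩).trans (indAct_of_mem c I hX F a x (f.1 w) o' j i)
  have hzero : ∀ o' j, (⟨o', j⟩ : Σ o, (I o).J) ≠ ⟨o, (I o).base⟩ → φ o' j = 0 := by
    intro o' j h
    by_contra h0
    have h1 := irr_mk_eq_of_hom_ne_zero (τ o) (τ o') ((I o').t j) (φ o' j) (hφa o' j) h0
    obtain rfl := hτ _ _ _ h1
    exact h (by rw [((I o).t_mem_iff j).1 h1.symm])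
  obtain ⟨u', hu'⟩ := exists_eq_smul_of_hom (τ o) (φ o (I o).base) fun a w i => by
    rw [hφa, CosetIndex.conjNormal_t_base]
  obtain ⟨u, rfl⟩ := ((F o).bijective_act_one (one_smul_pt c I hX o x)).2 u'
  refine ⟨u, Subtype.ext (LinearMap.ext fun w => funext fun ⟨o', j, i⟩ => ?_)⟩
  rw [indHom_coe, ← hφ]
  rcases eq_or_ne (⟨o', j⟩ : Σ o, (I o).J) ⟨o, (I o).base⟩ with h | h
  · obtain ⟨rfl, h⟩ := Sigma.mk.inj_iff.1 h
    obtain rfl := eq_of_heq h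
    rw [indEmb_base, hu']
    rfl
  · rw [indEmb_of_ne c I hX F h, hzero _ _ h]
    rfl

/-- On the base component k(σ(q), base) = σ(q), and `R` equals M_q there, cancelling the M_q⁻¹ in
the action on homomorphisms; what remains is z times the lift of q, the action of (q, z) on F_o. As
σ(q) fixes the base point, the other components stay zero. -/
theorem indHom_act (o : O) (p : Ext (c o).cocycle) {x y : X}
    (e : p • (c o).pt hX x = (c o).pt hX y) (e' : (c o).σ p.1 • x = y)
    (u : (F o).Fib ((c o).pt hX x)) :
    indHom c I hX F hF o y ((F o).act p e u) =
      homAAct (c o) hX (ind c I hX F hF) p.1 p.2 e' (indHom c I hX F hF o x u) := by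
  refine Subtype.ext (LinearMap.ext fun w => funext fun ⟨o', j, i⟩ => ?_)
  rw [indHom_coe]
  change _ = (p.2 : ℂ) • indAct c I hX F ((c o).σ p.1) e' (indEmb c I hX F o x u
    (Matrix.toLin' (((c o).M p.1)⁻¹).1 w)) ⟨o', j, i⟩
  rw [indAct_apply]
  have hσ := (c o).σ_mem p.1
  rcases eq_or_ne (⟨o', j⟩ : Σ o, (I o).J) ⟨o, (I o).base⟩ with h | h
  · obtain ⟨rfl, h⟩ := Sigma.mk.inj_iff.1 h
    obtain rfl := eq_of_heq h
    have hj : ((c o').σ p.1)⁻¹ • (I o').base = (I o').base := ((I o').stab _).2 (inv_mem hσ)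
    have hk : (((I o').k ((c o').σ p.1) (I o').base :
        MulAction.stabilizer G (Irr.mk (τ o'))) : G) = (c o').σ p.1 := by
      simp [CosetIndex.k, hj, (I o').t_base]
    have e₁ : (((I o').k ((c o').σ p.1) (I o').base :
        MulAction.stabilizer G (Irr.mk (τ o'))) : G) • ((I o').t (I o').base)⁻¹ • x =
        ((I o').t (I o').base)⁻¹ • y := by
      rw [hk, (I o').t_base, inv_one, one_smul, one_smul, e']
    have e₂ : p • (c o').pt hX (((I o').t (I o').base)⁻¹ • x) =
        (c o').pt hX (((I o').t (I o').base)⁻¹ • y) := by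
      simp only [(I o').t_base, inv_one, one_smul, e]
    rw [twAct_indFib_congr I hj rfl _ _ e₁, twAct_apply, (c o').R_σ hk, indEmb_base]
    simp only [indEmb_base, map_smul, smul_smul, ← Finset.sum_smul]
    have h1 : ∑ l, ((c o').M p.1).1 i l * Matrix.toLin' (((c o').M p.1)⁻¹).1 w l = w i := by
      have h2 : ((c o').M p.1).1 * (((c o').M p.1)⁻¹).1 = 1 := by
        rw [← Submonoid.coe_mul, mul_inv_cancel]; rfl
      have h3 := congrArg (fun N : Matrix _ _ ℂ => N.mulVec w i) h2
      simp only [Matrix.one_mulVec, ← Matrix.mulVec_mulVec] at h3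
      exact h3
    rw [h1, mul_comm, ← smul_smul, ← act_ext_eq_smul (c o') hX (F o') (hF o') p hk e₁ e₂]
    congr 1
    -- `toBase` is action by `1`, so it commutes with `p` inside the extension.
    have e₃ : (1 * p) • (c o').pt hX x = (c o').pt hX (((I o').t (I o').base)⁻¹ • y) := by
      rw [mul_smul, e, one_smul_pt c I hX]
    have e₄ : (p * 1) • (c o').pt hX x = (c o').pt hX (((I o').t (I o').base)⁻¹ • y) := by
      rw [mul_one, ← e₃, one_mul]
    change (F o').act 1 _ ((F o').act p e u) = (F o').act p e₂ ((F o').act 1 _ u)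
    rw [← (F o').act_mul 1 p e _ e₃, ← (F o').act_mul p 1 _ e₂ e₄]
    exact (F o').act_congr (by rw [one_mul, mul_one]) e₃ e₄ u
  · have h' : (⟨o', ((c o).σ p.1)⁻¹ • j⟩ : Σ o, (I o).J) ≠ ⟨o, (I o).base⟩ := by
      intro h''
      apply h
      obtain ⟨rfl, h''⟩ := Sigma.mk.inj_iff.1 h''
      have h1 := eq_of_heq h''
      rw [inv_smul_eq_iff, ((I o').stab _).2 hσ] at h1
      rw [h1]
    rw [indEmb_of_ne c I hX F h]
    have h0 : (fun l => indEmb c I hX F o x u (Matrix.toLin' (((c o).M p.1)⁻¹).1 w)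
        ⟨o', ((c o).σ p.1)⁻¹ • j, l⟩) = 0 := funext fun l => indEmb_of_ne c I hX F h' x u _ l
    rw [h0, map_zero, Pi.zero_apply, smul_zero]

theorem continuous_indEmb (hB : ∀ o, (F o).IsBundle) (o : O) (w : Fin (τ o).d → ℂ)
    (p : IndIndex I) : Continuous fun t : (F o).Tot =>
      (⟨(c p.1).pt hX (((I p.1).t p.2.1)⁻¹ • (show X from t.proj)),
        indEmb c I hX F o t.proj t.snd w p⟩ : (F p.1).Tot) := by
  obtain ⟨o', j, i⟩ := p
  rcases eq_or_ne (⟨o', j⟩ : Σ o, (I o).J) ⟨o, (I o).base⟩ with h | h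
  · obtain ⟨rfl, h⟩ := Sigma.mk.inj_iff.1 h
    obtain rfl := eq_of_heq h
    have h1 : Continuous fun t : (F o').Tot => (⟨(c o').pt hX (((I o').t (I o').base)⁻¹ •
        (show X from t.proj)), toBase c I hX F o' t.proj t.snd⟩ : (F o').Tot) :=
      (hB o').continuous_act_apply 1 (fun t : (F o').Tot => one_smul_pt c I hX o' t.proj)
        (p := fun t => t.proj) (s := fun t => t.snd) continuous_id
    refine ((hB o').hasCharts.continuous_smul (continuous_const (y := w i)) h1).congr fun t => ?_
    exact congrArg (Bundle.TotalSpace.mk _) (indEmb_base c I hX F o' t.proj t.snd w i).symm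
  · have hm : Continuous fun x : X => (c o').pt hX (((I o').t j)⁻¹ • x) :=
      ((c o').continuous_pt hX).comp (continuous_const_smul _)
    have hp : Continuous fun t : (F o).Tot =>
        (c o').pt hX (((I o').t j)⁻¹ • (show X from t.proj)) := hm.comp (hB o).continuous_proj
    refine ((hB o').hasCharts.continuous_zero hp).congr fun t => ?_
    exact congrArg (Bundle.TotalSpace.mk _) (indEmb_of_ne c I hX F h t.proj t.snd w i).symm

theorem continuous_indHom (hB : ∀ o, (F o).IsBundle) (o : O) :
    Continuous fun t : (F o).Tot =>
      (⟨t.proj, indHom c I hX F hF o t.proj t.snd⟩ : (homA (c o) hX (ind c I hX F hF)).Tot) :=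
  continuous_homA_mk (c o) hX (hB o).continuous_proj fun w =>
    continuous_ind_mk c I hX F hF (hB o).continuous_proj fun p =>
      continuous_indEmb c I hX F hB o w p

/-- `F_o` is isomorphic to `Hom_A(V_{τ_o}, Ind F)`. -/
def indHomIso [Finite O] [Finite A] (hτ : DistinctOrbits τ) (hB : ∀ o, (F o).IsBundle) (o : O) :
    (F o).Iso (homA (c o) hX (ind c I hX F hF)) :=
  (hB o).isoOfBijective (homA_isBundle (c o) hX (ind_isBundle c I hX F hF hB))
    (fun x => indHom c I hX F hF o x)
    (fun x => ⟨indHom_injective c I hX F hF o x, indHom_surjective c I hX F hF hτ o x⟩)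
    (fun p _ _ e u => indHom_act c I hX F hF o p e ((c o).σ_smul hX e) u)
    (continuous_indHom c I hX F hF hB o)

end InducedHom

/-! ## Detecting isomorphisms on the bundles `Hom_A(V_τ, -)` -/

section Detect

variable {G : Type v} [Group G] [TopologicalSpace G] {A : Subgroup G} [A.Normal]
  {X : GSpace.{u, v} G} (hX : X.TrivialOn A)

theorem EqFamily.act_act_inv (E : EqFamily X) (g : G) {x y : X} (e : g⁻¹ • x = y)
    (e' : g • y = x) (v : E.Fib x) : E.act g e' (E.act g⁻¹ e v) = v := by
  have e₁ : (g * g⁻¹) • x = x := by rw [mul_inv_cancel, one_smul]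
  rw [← E.act_mul g g⁻¹ e e' e₁, E.act_congr (mul_inv_cancel g) e₁ (one_smul G x), E.act_one]

/-- If `π ≅ gτ`, then `g⁻¹` carries `Hom_A(V_π, E_x)` to `Hom_A(V_τ, E_{g⁻¹x})`. -/
theorem exists_homAFib_translate (E : EqFamily X) {π τ : IrrRep A} {g : G}
    (h : Irr.mk π = g • Irr.mk τ) {x : X} (f : homAFib hX π E x) :
    ∃ (f' : homAFib hX τ E (g⁻¹ • x)) (ε : (Fin τ.d → ℂ) ≃ₗ[ℂ] (Fin π.d → ℂ)),
      ∀ w, f'.1 w = E.act g⁻¹ rfl (f.1 (ε w)) := by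
  obtain ⟨i⟩ : Nonempty ((unitaryRep π.ρ).Equiv (unitaryRep (τ.conj g).ρ)) := Quotient.exact h
  let ε : (Fin τ.d → ℂ) ≃ₗ[ℂ] (Fin π.d → ℂ) := i.toLinearEquiv.symm
  have hε : ∀ (b : A) w, ε (unitaryRep τ.ρ b w) = unitaryRep π.ρ (MulAut.conjNormal g b) (ε w) :=
    fun b w => by
      have h1 : ∀ (a : A) v, i.toLinearEquiv (unitaryRep π.ρ a v) =
          unitaryRep τ.ρ (MulAut.conjNormal g⁻¹ a) (i.toLinearEquiv v) := fun a v =>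
        LinearMap.congr_fun (i.isIntertwining' a) v
      have h2 : (MulAut.conjNormal g⁻¹ : MulAut A) (MulAut.conjNormal g b) = b := by ext; simp
      have h3 := h1 (MulAut.conjNormal g b) (ε w)
      rw [h2] at h3
      have h4 : i.toLinearEquiv (ε w) = w := i.toLinearEquiv.apply_symm_apply w
      rw [h4] at h3
      exact (LinearEquiv.symm_apply_eq _).2 h3.symm
  refine ⟨⟨E.act g⁻¹ rfl ∘ₗ f.1 ∘ₗ ε.toLinearMap, fun b w => ?_⟩, ε, fun w => rfl⟩
  change E.act g⁻¹ rfl (f.1 (ε (unitaryRep τ.ρ b w))) =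
    E.act (b : G) (hX b _) (E.act g⁻¹ rfl (f.1 (ε w)))
  rw [hε, f.2]
  have e₁ : (g⁻¹ * ((MulAut.conjNormal g b : A) : G)) • x = g⁻¹ • x := by rw [mul_smul, hX]
  have e₂ : ((b : G) * g⁻¹) • x = g⁻¹ • x := by rw [mul_smul, hX]
  rw [← E.act_mul _ _ _ _ e₁, ← E.act_mul _ _ _ _ e₂]
  exact E.act_congr (by simp [mul_assoc]) e₁ e₂ _

/-- Every irreducible representation of `A` is conjugate to one of the `τ_o`. -/
def MeetsAllOrbits {O : Type*} (τ : O → IrrRep A) : Prop :=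
  ∀ π : IrrRep A, ∃ (o : O) (g : G), Irr.mk π = g • Irr.mk (τ o)

variable [Finite A] {O : Type*} {τ : O → IrrRep A} {E E' : EqFamily X}
  (Φ : ∀ x, E.Fib x →ₗ[ℂ] E'.Fib x)

/-- A nonzero kernel contains the image of a nonzero map from some irreducible π ≅ gτ_o. Translation
by g⁻¹ gives a homomorphism out of V_{τ_o} at g⁻¹x, still killed by `Φ`; it vanishes by `h`, and so
does the original map. -/
theorem injective_of_homAFib
    (hΦ : ∀ (g : G) {x y : X} (e : g • x = y) v, Φ y (E.act g e v) = E'.act g e (Φ x v))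
    (hτ : MeetsAllOrbits τ)
    (h : ∀ o x (f : homAFib hX (τ o) E x), (∀ w, Φ x (f.1 w) = 0) → f = 0) (x : X)
    [FiniteDimensional ℂ (E.Fib x)] : Function.Injective (Φ x) := by
  rw [← LinearMap.ker_eq_bot]
  by_contra h0
  obtain ⟨π, f, hf0, hfk, hfa⟩ := exists_irrRep_hom (fibRep hX E x) (LinearMap.ker (Φ x))
    (fun a v hv => (hΦ a (hX a x) v).trans (by rw [LinearMap.mem_ker.1 hv, map_zero])) h0
  obtain ⟨o, g, hg⟩ := hτ π
  obtain ⟨f', ε, hf'⟩ := exists_homAFib_translate hX E hg ⟨f, hfa⟩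
  have h1 : f' = 0 := h o _ f' fun w => by
    rw [hf', hΦ, LinearMap.mem_ker.1 (hfk _), map_zero]
  refine hf0 (LinearMap.ext fun v => ?_)
  have h2 := hf' (ε.symm v)
  rw [h1, LinearEquiv.apply_symm_apply] at h2
  rw [← E.act_act_inv g rfl (smul_inv_smul g x) (f v)]
  exact (congrArg _ h2.symm).trans (map_zero _)

/-- By Maschke the range has a stable complement. If that is nonzero, an irreducible π ≅ gτ_o maps
nontrivially to it; after translation by g⁻¹ its values lie in the range by `h`, so the original
values lie in both the range and its complement. -/
theorem surjective_of_homAFib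
    (hΦ : ∀ (g : G) {x y : X} (e : g • x = y) v, Φ y (E.act g e v) = E'.act g e (Φ x v))
    (hτ : MeetsAllOrbits τ)
    (h : ∀ o x (f : homAFib hX (τ o) E' x) w, ∃ v, Φ x v = f.1 w) (x : X)
    [FiniteDimensional ℂ (E'.Fib x)] : Function.Surjective (Φ x) := by
  have : NeZero (Nat.card A : ℂ) := ⟨Nat.cast_ne_zero.2 Nat.card_pos.ne'⟩
  let r : Subrepresentation (fibRep hX E' x) := ⟨LinearMap.range (Φ x), by
    rintro a _ ⟨v, rfl⟩
    exact ⟨_, hΦ a (hX a x) v⟩⟩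
  obtain ⟨q, hq⟩ := exists_isCompl r
  by_cases hq0 : q.toSubmodule = ⊥
  · have h1 : r = ⊤ := by
      have h2 : q = ⊥ := Subrepresentation.toSubmodule_injective hq0
      rw [h2] at hq
      exact hq.sup_eq_top ▸ (sup_bot_eq r).symm
    exact LinearMap.range_eq_top.1 (congrArg Subrepresentation.toSubmodule h1)
  · exfalso
    obtain ⟨π, f, hf0, hfq, hfa⟩ := exists_irrRep_hom (fibRep hX E' x) q.toSubmodule
      (fun a v hv => q.apply_mem_toSubmodule a hv) hq0
    obtain ⟨o, g, hg⟩ := hτ π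
    obtain ⟨f', ε, hf'⟩ := exists_homAFib_translate hX E' hg ⟨f, hfa⟩
    refine hf0 (LinearMap.ext fun v => ?_)
    obtain ⟨u, hu⟩ := h o _ f' (ε.symm v)
    have h2 := hf' (ε.symm v)
    rw [← hu, LinearEquiv.apply_symm_apply] at h2
    have h3 : f v = Φ x (E.act g (smul_inv_smul g x) u) := by
      rw [hΦ, h2, E'.act_act_inv]
    have h4 : f v ∈ (r ⊓ q).toSubmodule := ⟨⟨_, h3.symm⟩, hfq v⟩
    rw [hq.inf_eq_bot] at h4
    exact h4

end Detect

/-! ### Recovering a bundle by evaluating homomorphisms -/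

section Evaluation

variable {G : Type v} [Group G] [TopologicalSpace G] [DiscreteTopology G] {A : Subgroup G}
  [A.Normal] {X : GSpace.{u, v} G} (hX : X.TrivialOn A) (E : EqFamily X)

/-- Evaluation `Hom_A(V_τ, E_x) → E_x` at a vector of `V_τ`. -/
def homAEv {τ : IrrRep A} (c : TwistChoice τ) (x : X) (w : Fin τ.d → ℂ) :
    (homA c hX E).Fib (c.pt hX x) →ₗ[ℂ] E.Fib x :=
  LinearMap.applyₗ w ∘ₗ (homAFib hX τ E x).subtype

theorem homAEv_act {τ : IrrRep A} (c : TwistChoice τ) (p : Ext c.cocycle) {x y : X}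
    (e : p • c.pt hX x = c.pt hX y) (e' : c.σ p.1 • x = y) (f : (homA c hX E).Fib (c.pt hX x))
    (w : Fin τ.d → ℂ) : homAEv hX E c y w ((homA c hX E).act p e f) =
      (p.2 : ℂ) • E.act (c.σ p.1) e' (homAEv hX E c x (Matrix.toLin' ((c.M p.1)⁻¹).1 w) f) := rfl

theorem homAEv_sum {τ : IrrRep A} (c : TwistChoice τ) (x : X) (f : (homA c hX E).Fib (c.pt hX x))
    {ι : Type*} (s : Finset ι) (z : ι → ℂ) (w : ι → Fin τ.d → ℂ) :
    homAEv hX E c x (∑ i ∈ s, z i • w i) f = ∑ i ∈ s, z i • homAEv hX E c x (w i) f := by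
  let f₀ : homAFib hX τ E x := f
  change f₀.1 (∑ i ∈ s, z i • w i) = ∑ i ∈ s, z i • f₀.1 (w i)
  rw [map_sum]
  exact Finset.sum_congr rfl fun i _ => map_smul _ _ _

theorem homAEv_unitaryRep {τ : IrrRep A} (c : TwistChoice τ) (x : X)
    (f : (homA c hX E).Fib (c.pt hX x)) (a : A) (w : Fin τ.d → ℂ) :
    homAEv hX E c x (unitaryRep τ.ρ a w) f = E.act (a : G) (hX a x) (homAEv hX E c x w f) :=
  (show homAFib hX τ E x from f).2 a w

/-- The evaluation `V_τ ⊗ Hom_A(V_τ, E_x) → E_x`. -/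
def twEv {τ : IrrRep A} (c : TwistChoice τ) (x : X) :
    (Fin τ.d → (homA c hX E).Fib (c.pt hX x)) →ₗ[ℂ] E.Fib x :=
  ∑ i, homAEv hX E c x (Pi.single i 1) ∘ₗ LinearMap.proj i

theorem twEv_apply {τ : IrrRep A} (c : TwistChoice τ) (x : X)
    (s : Fin τ.d → (homA c hX E).Fib (c.pt hX x)) :
    twEv hX E c x s = ∑ i, homAEv hX E c x (Pi.single i 1) (s i) := by
  simp [twEv, LinearMap.sum_apply]

theorem twEv_smul {τ : IrrRep A} (c : TwistChoice τ) (x : X) (w : Fin τ.d → ℂ)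
    (f : (homA c hX E).Fib (c.pt hX x)) :
    twEv hX E c x (fun i => w i • f) = homAEv hX E c x w f := by
  rw [twEv_apply]
  simp only [map_smul]
  rw [← homAEv_sum, ← pi_eq_sum_univ' w]

/-- Moving the matrix R_k to the argument of the homomorphism leaves M_q⁻¹R_k = τ(σ(q)⁻¹k), which
passes through by `A`-equivariance; σ(q) and σ(q)⁻¹k then recombine to k. -/
theorem twEv_twAct {τ : IrrRep A} (c : TwistChoice τ) (k : MulAction.stabilizer G (Irr.mk τ))
    {x y : X} (e : (k : G) • x = y) (s : Fin τ.d → (homA c hX E).Fib (c.pt hX x)) :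
    twEv hX E c y (twAct c hX (homA c hX E) k e s) = E.act (k : G) e (twEv hX E c x s) := by
  have hrem : (c.σ (TwistChoice.cls τ k)) * (c.rem k : G) = k := by
    simp [TwistChoice.rem]
  have e₁ : c.σ (TwistChoice.cls τ k) • x = y := by
    rw [← hX (c.rem k) x, ← mul_smul, hrem, e]
  rw [twEv_apply, twEv_apply, map_sum]
  simp only [twAct_apply, map_sum, map_smul]
  rw [Finset.sum_comm]
  refine Finset.sum_congr rfl fun l _ => ?_
  have h1 : ∀ i : Fin τ.d, homAEv hX E c y (Pi.single i 1)
      ((homA c hX E).act (c.lift k) (c.lift_smul hX k e) (s l)) =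
      E.act (c.σ (TwistChoice.cls τ k)) e₁ (homAEv hX E c x
        (Matrix.toLin' ((c.M (TwistChoice.cls τ k))⁻¹).1 (Pi.single i 1)) (s l)) := fun i => by
    rw [homAEv_act hX E c (c.lift k) _ e₁]
    change ((1 : Circle) : ℂ) • _ = _
    rw [Circle.coe_one, one_smul]
    rfl
  simp only [h1, ← map_smul]
  rw [← map_sum]
  simp only [map_smul]
  rw [← homAEv_sum]
  have h2 : ∑ i, (c.R k).1 i l • Matrix.toLin' ((c.M (TwistChoice.cls τ k))⁻¹).1
      (Pi.single i 1) = unitaryRep τ.ρ (c.rem k) (Pi.single l 1) := by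
    simp only [← map_smul]
    rw [← map_sum]
    have h3 : ∑ i, (c.R k).1 i l • (Pi.single i 1 : Fin τ.d → ℂ) =
        (c.R k).1.mulVec (Pi.single l 1) := by
      rw [Matrix.mulVec_single_one]
      exact (pi_eq_sum_univ' ((c.R k).1.col l)).symm
    have h4 : (c.M (TwistChoice.cls τ k))⁻¹ * c.R k = τ.ρ (c.rem k) := by
      rw [TwistChoice.R, inv_mul_cancel_left]
    rw [h3, Matrix.toLin'_apply, Matrix.mulVec_mulVec, ← Submonoid.coe_mul, h4]
    rfl
  rw [h2, homAEv_unitaryRep]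
  have e₂ : (c.σ (TwistChoice.cls τ k) * (c.rem k : G)) • x = y := by rw [hrem, e]
  rw [← E.act_mul _ _ _ _ e₂]
  exact E.act_congr hrem e₂ e _

variable {O : Type} [Fintype O] {τ : O → IrrRep A} (c : ∀ o, TwistChoice (τ o))
  (I : ∀ o, CosetIndex (MulAction.stabilizer G (Irr.mk (τ o))))

/-- The evaluation map from the bundle induced from the bundles `Hom_A(V_{τ_o}, E)` to `E`. -/
def indEv (x : X) : indFib c I hX (fun o => homA (c o) hX E) x →ₗ[ℂ] E.Fib x :=
  ∑ o, ∑ j, E.act ((I o).t j) (smul_inv_smul _ x) ∘ₗ twEv hX E (c o) (((I o).t j)⁻¹ • x) ∘ₗ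
    LinearMap.pi fun l => LinearMap.proj (⟨o, j, l⟩ : IndIndex I)

theorem indEv_apply (x : X) (s : indFib c I hX (fun o => homA (c o) hX E) x) :
    indEv hX E c I x s = ∑ o, ∑ j, E.act ((I o).t j) (smul_inv_smul _ x)
      (twEv hX E (c o) (((I o).t j)⁻¹ • x) fun l => s ⟨o, j, l⟩) := by
  simp only [indEv, LinearMap.sum_apply]
  rfl

/-- Reindex the components by j ↦ g⁻¹j and use t_j k(g, j) = g t_{g⁻¹j}. -/
theorem indEv_act (g : G) {x y : X} (e : g • x = y)
    (s : indFib c I hX (fun o => homA (c o) hX E) x) :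
    indEv hX E c I y (indAct c I hX (fun o => homA (c o) hX E) g e s) =
      E.act g e (indEv hX E c I x s) := by
  rw [indEv_apply, indEv_apply, map_sum]
  refine Finset.sum_congr rfl fun o _ => ?_
  rw [map_sum]
  refine Eq.trans ?_ (Equiv.sum_comp (MulAction.toPerm g⁻¹) fun j =>
    E.act g e (E.act ((I o).t j) (smul_inv_smul _ x)
      (twEv hX E (c o) (((I o).t j)⁻¹ • x) fun l => s ⟨o, j, l⟩)))
  refine Finset.sum_congr rfl fun j _ => ?_
  change E.act ((I o).t j) (smul_inv_smul _ y) (twEv hX E (c o) (((I o).t j)⁻¹ • y)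
      (twAct (c o) hX (homA (c o) hX E) ((I o).k g j) ((I o).k_smul g j e)
        fun l => s ⟨o, g⁻¹ • j, l⟩)) =
    E.act g e (E.act ((I o).t (g⁻¹ • j)) (smul_inv_smul _ x)
      (twEv hX E (c o) (((I o).t (g⁻¹ • j))⁻¹ • x) fun l => s ⟨o, g⁻¹ • j, l⟩))
  rw [twEv_twAct]
  have hk : (I o).t j * ((I o).k g j : G) = g * (I o).t (g⁻¹ • j) := by
    simp [CosetIndex.k, mul_assoc]
  have e₁ : ((I o).t j * ((I o).k g j : G)) • ((I o).t (g⁻¹ • j))⁻¹ • x = y := by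
    rw [hk, mul_smul, smul_inv_smul, e]
  have e₂ : (g * (I o).t (g⁻¹ • j)) • ((I o).t (g⁻¹ • j))⁻¹ • x = y := by rw [← hk, e₁]
  rw [← E.act_mul _ _ _ _ e₁, ← E.act_mul _ _ _ _ e₂]
  exact E.act_congr hk e₁ e₂ _

/-- Only the base component contributes, with `t` equal to `1`. This triangle identity between
induction and Hom_A verifies the hypotheses of both detection lemmas for the evaluation map. -/
theorem indEv_indEmb [DecidableEq O] (o : O) (x : X) (f : (homA (c o) hX E).Fib ((c o).pt hX x))
    (w : Fin (τ o).d → ℂ) :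
    indEv hX E c I x (indEmb c I hX (fun o => homA (c o) hX E) o x f w) =
      homAEv hX E (c o) x w f := by
  rw [indEv_apply, Finset.sum_eq_single o, Finset.sum_eq_single (I o).base]
  · simp only [indEmb_base]
    rw [twEv_smul]
    have e₁ : (c o).σ 1 • x = ((I o).t (I o).base)⁻¹ • x := by
      rw [(c o).σ_one, (I o).t_base, inv_one]
    have h1 : homAEv hX E (c o) (((I o).t (I o).base)⁻¹ • x) w
        (toBase c I hX (fun o => homA (c o) hX E) o x f) = E.act ((c o).σ 1) e₁
          (homAEv hX E (c o) x w f) := by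
      refine (homAEv_act hX E (c o) 1 (one_smul_pt c I hX o x) e₁ f w).trans ?_
      change ((1 : Circle) : ℂ) • E.act ((c o).σ 1) e₁ (homAEv hX E (c o) x
        (Matrix.toLin' (((c o).M 1)⁻¹).1 w) f) = _
      rw [Circle.coe_one, one_smul, (c o).M_one, inv_one]
      simp
    rw [h1]
    have e₂ : ((I o).t (I o).base * (c o).σ 1) • x = x := by
      rw [(c o).σ_one, (I o).t_base, one_mul, one_smul]
    rw [← E.act_mul _ _ _ _ e₂, E.act_congr (by rw [(c o).σ_one, (I o).t_base, one_mul]) e₂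
      (one_smul G x), E.act_one]
  · intro j _ hj
    have h : (⟨o, j⟩ : Σ o, (I o).J) ≠ ⟨o, (I o).base⟩ := fun h =>
      hj (eq_of_heq (Sigma.mk.inj_iff.1 h).2)
    have h0 : (fun l => indEmb c I hX (fun o => homA (c o) hX E) o x f w ⟨o, j, l⟩) = 0 :=
      funext fun l => indEmb_of_ne c I hX (fun o => homA (c o) hX E) h x f w l
    rw [h0, map_zero, map_zero]
  · exact fun h => absurd (Finset.mem_univ _) h
  · intro o' _ ho
    refine Finset.sum_eq_zero fun j _ => ?_
    have h : (⟨o', j⟩ : Σ o, (I o).J) ≠ ⟨o, (I o).base⟩ := fun h => ho (Sigma.mk.inj_iff.1 h).1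
    have h0 : (fun l => indEmb c I hX (fun o => homA (c o) hX E) o x f w ⟨o', j, l⟩) = 0 :=
      funext fun l => indEmb_of_ne c I hX (fun o => homA (c o) hX E) h x f w l
    rw [h0, map_zero, map_zero]
  · exact fun h => absurd (Finset.mem_univ _) h

/-- The bundle induced from the bundles `Hom_A(V_{τ_o}, E)`. -/
abbrev indHomA : EqFamily X :=
  ind c I hX (fun o => homA (c o) hX E) fun o => homA_isScalar (c o) hX E

theorem continuous_indEv [Finite A] (hE : E.IsBundle) :
    Continuous fun t : (indHomA hX E c I).Tot =>
      (⟨t.proj, indEv hX E c I t.proj t.snd⟩ : E.Tot) := by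
  have hp := continuous_ind_proj c I hX (fun o => homA (c o) hX E)
    fun o => homA_isScalar (c o) hX E
  have h1 : ∀ o j, Continuous fun t : (indHomA hX E c I).Tot =>
      (⟨t.proj, E.act ((I o).t j) (smul_inv_smul _ t.proj)
        (twEv hX E (c o) (((I o).t j)⁻¹ • t.proj) fun l => t.snd ⟨o, j, l⟩)⟩ : E.Tot) := by
    intro o j
    refine hE.continuous_act_apply ((I o).t j)
      (fun t : (indHomA hX E c I).Tot => smul_inv_smul _ t.proj) ?_
    refine (hE.hasCharts.continuous_sum (hp.const_smul ((I o).t j)⁻¹) Finset.univ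
      (s := fun i t => homAEv hX E (c o) (((I o).t j)⁻¹ • t.proj) (Pi.single i 1)
        (t.snd ⟨o, j, i⟩)) fun i => ?_).congr fun t =>
        congrArg (Bundle.TotalSpace.mk _) (twEv_apply hX E (c o) _ _).symm
    exact (continuous_homA_eval (c o) hX E (Pi.single i 1)).comp
      (continuous_ind_component c I hX (fun o => homA (c o) hX E)
        (fun o => homA_isScalar (c o) hX E) ⟨o, j, i⟩)
  exact (hE.hasCharts.continuous_sum hp _ fun o =>
    hE.hasCharts.continuous_sum hp _ fun j => h1 o j).congr fun t =>
      congrArg (Bundle.TotalSpace.mk _) (indEv_apply hX E c I t.proj t.snd).symm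

/-- A bundle is induced from the bundles `Hom_A(V_{τ_o}, E)`. -/
def indEvIso [DecidableEq O] [Finite A] (hτ : DistinctOrbits τ) (hτ' : MeetsAllOrbits τ)
    (hE : E.IsBundle) : (indHomA hX E c I).Iso E := by
  have hB := ind_isBundle c I hX (fun o => homA (c o) hX E) (fun o => homA_isScalar (c o) hX E)
    fun o => homA_isBundle (c o) hX hE
  refine hB.isoOfBijective hE (indEv hX E c I) (fun x => ⟨?_, ?_⟩)
    (fun g x y e v => indEv_act hX E c I g e v) (continuous_indEv hX E c I hE)
  · have := hB.hasCharts.finiteDimensional x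
    refine injective_of_homAFib hX (E := indHomA hX E c I) (indEv hX E c I)
      (fun g x y e v => indEv_act hX E c I g e v) hτ' (fun o x f hf => ?_) x
    -- Every homomorphism into the induced fibre comes from some `u` in Hom_A(V_{τ_o}, E_x), and
    -- evaluation turns it back into `u`.
    obtain ⟨u, rfl⟩ := indHom_surjective c I hX _ (fun o => homA_isScalar (c o) hX E) hτ o x f
    have h0 : ∀ u' : homAFib hX (τ o) E x, (∀ w, u'.1 w = 0) → u' = 0 := fun u' hu =>
      Subtype.ext (LinearMap.ext hu)
    have h1 : u = 0 := h0 u fun w => (indEv_indEmb hX E c I o x u w).symm.trans (hf w)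
    rw [h1, map_zero]
  · have := hE.hasCharts.finiteDimensional x
    exact surjective_of_homAFib hX (E := indHomA hX E c I) (indEv hX E c I)
      (fun g x y e v => indEv_act hX E c I g e v) hτ'
      (fun o x f w => ⟨_, indEv_indEmb hX E c I o x f w⟩) x

end Evaluation

/-! ## The isomorphism in K-theory -/

section IndIso

variable {G : Type v} [Group G] [TopologicalSpace G] [DiscreteTopology G] {A : Subgroup G}
  [A.Normal] {O : Type} {τ : O → IrrRep A} (c : ∀ o, TwistChoice (τ o))
  (I : ∀ o, CosetIndex (MulAction.stabilizer G (Irr.mk (τ o))))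
  {X : GSpace.{u, v} G} (hX : X.TrivialOn A)
  {F F' : ∀ o, EqFamily ((X.res hX (τ o)).ext (c o).cocycle)}

/-- Isomorphic twisted bundles induce isomorphic bundles. -/
def indIso (hF : ∀ o, (F o).IsScalar) (hF' : ∀ o, (F' o).IsScalar)
    (i : ∀ o, (F o).Iso (F' o)) : (ind c I hX F hF).Iso (ind c I hX F' hF') where
  toEquiv x := LinearEquiv.piCongrRight fun p : IndIndex I =>
    (i p.1).toEquiv ((c p.1).pt hX (((I p.1).t p.2.1)⁻¹ • x))
  comm g x y e s := by
    funext ⟨o, j, l⟩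
    refine (congrArg ((i o).toEquiv _) (twAct_apply (c o) hX (F o) ((I o).k g j)
      ((I o).k_smul g j e) _ l)).trans ?_
    refine Eq.trans ?_ (twAct_apply (c o) hX (F' o) ((I o).k g j) ((I o).k_smul g j e) _ l).symm
    rw [map_sum]
    refine Finset.sum_congr rfl fun m _ => ?_
    rw [map_smul, (i o).comm]
    rfl
  continuous_toFun := continuous_ind_mk c I hX F' hF' (continuous_ind_proj c I hX F hF) fun p =>
    (i p.1).continuous_toFun.comp (continuous_ind_component c I hX F hF p)
  continuous_invFun := continuous_ind_mk c I hX F hF (continuous_ind_proj c I hX F' hF') fun p =>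
    (i p.1).continuous_invFun.comp (continuous_ind_component c I hX F' hF' p)

/-- Injectivity: a bundle is induced from its own homomorphism bundles (`indEvIso`). Surjectivity:
induction realises any prescribed family (`indHomIso`). The index set lies in universe zero so that
induced fibres stay in `Type u`. -/
theorem homVec_bijective_of_small [Fintype O] [Finite G] (hτ : DistinctOrbits τ)
    (hτ' : MeetsAllOrbits τ) :
    Function.Bijective fun (k : Vec X) (o : O) => homVec (c o) hX k := by
  classical
  have I : ∀ o, CosetIndex (MulAction.stabilizer G (Irr.mk (τ o))) := fun o =>
    (exists_cosetIndex _).some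
  constructor
  · rintro ⟨E⟩ ⟨E'⟩ h
    have h1 : ∀ o, Nonempty ((homA (c o) hX E.fam).Iso (homA (c o) hX E'.fam)) := fun o =>
      Quotient.exact (congrArg Subtype.val (congrFun h o))
    exact Quotient.sound ⟨((indEvIso hX E.fam c I hτ hτ' E.isBundle).symm.trans
      (indIso c I hX _ _ fun o => (h1 o).some)).trans
        (indEvIso hX E'.fam c I hτ hτ' E'.isBundle)⟩
  · intro k
    choose F hF hk using fun o => (k o).2
    have hB : ∀ o, (F o).fam.IsBundle := fun o => (F o).isBundle
    refine ⟨Vec.mk ⟨ind c I hX (fun o => (F o).fam) hF, ind_isBundle c I hX _ hF hB⟩,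
      funext fun o => Subtype.ext ?_⟩
    rw [← hk o]
    exact Quotient.sound ⟨(indHomIso c I hX (fun o => (F o).fam) hF hτ hB o).symm⟩

end IndIso

/-- A bundle is determined, up to isomorphism, by the twisted bundles `Hom_A(V_{τ_o}, E)`, which
can be prescribed. -/
theorem homVec_bijective {G : Type v} [Group G] [TopologicalSpace G] [DiscreteTopology G]
    {A : Subgroup G} [A.Normal] [Finite G] {O : Type*} [Finite O] {τ : O → IrrRep A}
    (c : ∀ o, TwistChoice (τ o)) {X : GSpace.{u, v} G} (hX : X.TrivialOn A)
    (hτ : DistinctOrbits τ) (hτ' : MeetsAllOrbits τ) :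
    Function.Bijective fun (k : Vec X) (o : O) => homVec (c o) hX k := by
  -- The index set may live in any universe; being finite, it is replaced by `Fin n`.
  obtain ⟨n, ⟨ε⟩⟩ := Finite.exists_equiv_fin O
  have h := homVec_bijective_of_small (fun i => c (ε.symm i)) hX
    (fun i j g hg => ε.symm.injective (hτ _ _ g hg))
    (fun π => by
      obtain ⟨o, g, hg⟩ := hτ' π
      exact ⟨ε o, g, by simpa only [ε.symm_apply_apply] using hg⟩)
  refine ⟨fun k k' hk => h.1 (funext fun i => congrFun hk (ε.symm i)), fun k => ?_⟩
  obtain ⟨l, hl⟩ := h.2 fun i => k (ε.symm i)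
  refine ⟨l, funext fun o => ?_⟩
  obtain ⟨i, rfl⟩ := ε.symm.surjective o
  exact congrFun hl i

/-! ### Grothendieck groups and finite products -/

section Grothendieck

open Algebra

theorem grothendieckAddGroup_hom_ext {M B : Type*} [AddCommMonoid M] [AddCommGroup B]
    {f g : GrothendieckAddGroup M →+ B}
    (h : ∀ m, f (GrothendieckAddGroup.of m) = g (GrothendieckAddGroup.of m)) : f = g :=
  GrothendieckAddGroup.lift.symm.injective (AddMonoidHom.ext h)

/-- The homomorphism of Grothendieck groups induced by a homomorphism of monoids. -/
def grothendieckMap {M N : Type*} [AddCommMonoid M] [AddCommMonoid N] (f : M →+ N) :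
    GrothendieckAddGroup M →+ GrothendieckAddGroup N :=
  GrothendieckAddGroup.lift (GrothendieckAddGroup.of.comp f)

theorem grothendieckMap_of {M N : Type*} [AddCommMonoid M] [AddCommMonoid N] (f : M →+ N) (m : M) :
    grothendieckMap f (GrothendieckAddGroup.of m) = GrothendieckAddGroup.of (f m) :=
  DFunLike.congr_fun (GrothendieckAddGroup.lift.symm_apply_apply (GrothendieckAddGroup.of.comp f)) m

variable {O : Type*} [Finite O] {M : Type*} [AddCommMonoid M] {N : O → Type*}
  [∀ o, AddCommMonoid (N o)]

/-- The inverse `B` adds the maps induced by including each factor in the product and going back to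
`M`; this sum needs finitely many factors. Both composites are checked on classes of monoid
elements. -/
theorem grothendieckMap_bijective (θ : ∀ o, M →+ N o)
    (hθ : Function.Bijective fun (m : M) (o : O) => θ o m) :
    Function.Bijective fun (k : GrothendieckAddGroup M) (o : O) => grothendieckMap (θ o) k := by
  classical
  have := Fintype.ofFinite O
  let e : M ≃+ ∀ o, N o := AddEquiv.ofBijective (AddMonoidHom.pi θ) hθ
  let F : GrothendieckAddGroup M →+ ∀ o, GrothendieckAddGroup (N o) :=
    AddMonoidHom.pi fun o => grothendieckMap (θ o)
  let B : (∀ o, GrothendieckAddGroup (N o)) →+ GrothendieckAddGroup M :=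
    ∑ o, (grothendieckMap (e.symm.toAddMonoidHom.comp (AddMonoidHom.single N o))).comp
      (Pi.evalAddMonoidHom _ o)
  have hB : ∀ x, B x = ∑ o, grothendieckMap
      (e.symm.toAddMonoidHom.comp (AddMonoidHom.single N o)) (x o) := fun x =>
    AddMonoidHom.finsetSum_apply _ _ _
  have h1 : B.comp F = AddMonoidHom.id _ := by
    refine grothendieckAddGroup_hom_ext fun m => ?_
    have h2 : ∀ o, F (GrothendieckAddGroup.of m) o = GrothendieckAddGroup.of (θ o m) := fun o =>
      grothendieckMap_of (θ o) m
    rw [AddMonoidHom.comp_apply, hB]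
    simp only [h2, grothendieckMap_of]
    rw [← map_sum]
    refine congrArg GrothendieckAddGroup.of (e.injective ?_)
    simp only [AddMonoidHom.comp_apply, map_sum]
    refine Eq.trans (Finset.sum_congr rfl fun o _ => e.apply_symm_apply _) ?_
    exact Finset.univ_sum_single (e m)
  have h3 : F.comp B = AddMonoidHom.id _ := by
    refine AddMonoidHom.functions_ext' _ _ _ fun o => grothendieckAddGroup_hom_ext fun n => ?_
    have h4 : B (Pi.single o (GrothendieckAddGroup.of n)) =
        GrothendieckAddGroup.of (e.symm (Pi.single o n)) := by
      rw [hB, Finset.sum_eq_single o]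
      · rw [Pi.single_eq_same, grothendieckMap_of]
        rfl
      · intro o' _ ho
        rw [Pi.single_eq_of_ne ho, map_zero]
      · exact fun h => absurd (Finset.mem_univ o) h
    change F (B (Pi.single o (GrothendieckAddGroup.of n))) = Pi.single o (GrothendieckAddGroup.of n)
    rw [h4]
    funext o'
    have h5 : F (GrothendieckAddGroup.of (e.symm (Pi.single o n))) o' =
        GrothendieckAddGroup.of (e (e.symm (Pi.single o n)) o') := grothendieckMap_of (θ o') _
    rw [h5, e.apply_symm_apply]
    exact Pi.apply_single (fun o => (GrothendieckAddGroup.of : N o →+ _)) (fun _ => map_zero _)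
      o n o'
  exact Function.bijective_iff_has_inverse.2
    ⟨B, DFunLike.congr_fun h1, DFunLike.congr_fun h3⟩

/-- Homomorphisms `f_o` from `K` which together identify `K` with the product of the `L_o`
identify it with the direct sum. -/
def directSumEquiv {K : Type*} [AddCommGroup K] {L : O → Type*} [∀ o, AddCommGroup (L o)]
    (f : ∀ o, K →+ L o) (hf : Function.Bijective fun (k : K) (o : O) => f o k) : K ≃+ ⨁ o, L o :=
  have := Fintype.ofFinite O
  (AddEquiv.ofBijective (AddMonoidHom.pi f) hf).trans (DirectSum.addEquivProd L).symm

end Grothendieck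

theorem GSpace.trivialOn_point {G : Type v} [Group G] [TopologicalSpace G] {A : Subgroup G} :
    (GSpace.point.{u, v} G).TrivialOn A := fun _ _ => rfl

/-! ### Passage to K⁰ and to the reduced groups -/

section Main

variable {G : Type v} [Group G] [Finite G] [TopologicalSpace G] [DiscreteTopology G]
  {A : Subgroup G} [A.Normal]

instance : Finite (IrrOrbits A) :=
  have : Finite (Irr A) := finite_irr
  inferInstance

/-- `K_G^0(X) → ^{α_τ}K^0_{Q_[τ]}(X)`, `[E] ↦ [Hom_A(V_τ, E)]`. -/
def homK0 {τ : IrrRep A} (c : TwistChoice τ) {X : GSpace.{u, v} G} (hX : X.TrivialOn A) :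
    K0 X →+ TwK0 c.cocycle (X.res hX τ) := grothendieckMap (homVec c hX)

theorem homK0_map {τ : IrrRep A} (c : TwistChoice τ) {X Y : GSpace.{u, v} G} (hX : X.TrivialOn A)
    (hY : Y.TrivialOn A) (f : GMap X Y) (k : K0 Y) :
    homK0 c hX (K0.map f k) = TwK0.map c.cocycle (f.res hX hY τ) (homK0 c hY k) := by
  have h : (homK0 c hX).comp (K0.map f) =
      (TwK0.map c.cocycle (f.res hX hY τ)).comp (homK0 c hY) := by
    refine grothendieckAddGroup_hom_ext fun m => ?_
    change homK0 c hX (K0.map f (Algebra.GrothendieckAddGroup.of m)) =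
      TwK0.map c.cocycle (f.res hX hY τ) (homK0 c hY (Algebra.GrothendieckAddGroup.of m))
    rw [K0.map_of, homK0, homK0, grothendieckMap_of, grothendieckMap_of, TwK0.map_of, homVec_map]
  exact DFunLike.congr_fun h k

/-- `K_G^n(X) → ^{α_τ}K^n_{Q_[τ]}(X)`, the restriction of `homK0` for `Σⁿ(X₊)`. -/
def homKn {τ : IrrRep A} (c : TwistChoice τ) (n : ℕ) {X : GSpace.{u, v} G} (hX : X.TrivialOn A) :
    Kn n X →+ TwKn c.cocycle n (X.res hX τ) :=
  AddMonoidHom.codRestrict ((homK0 c (hX.susp n)).comp (Kn n X).subtype)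
    (TwKn c.cocycle n (X.res hX τ)) fun k =>
      -- Naturality for the inclusion of the base point keeps the class in the kernel. Suspending
      -- and passing to Q_[τ]-spaces commute definitionally.
      (homK0_map c GSpace.trivialOn_point (hX.susp n) (X.base n) k).symm.trans
        ((congrArg (homK0 c GSpace.trivialOn_point) k.2).trans (map_zero _))

variable {O : Type*} [Finite O] {τ : O → IrrRep A} (c : ∀ o, TwistChoice (τ o))

theorem homK0_bijective {X : GSpace.{u, v} G} (hX : X.TrivialOn A) (hτ : DistinctOrbits τ)
    (hτ' : MeetsAllOrbits τ) :
    Function.Bijective fun (k : K0 X) (o : O) => homK0 (c o) hX k :=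
  grothendieckMap_bijective (fun o => homVec (c o) hX) (homVec_bijective c hX hτ hτ')

/-- For surjectivity, a preimage exists over Σⁿ(X₊). Its restriction to the base point has all
components zero, so it vanishes by injectivity over a point. -/
theorem homKn_bijective (n : ℕ) {X : GSpace.{u, v} G} (hX : X.TrivialOn A)
    (hτ : DistinctOrbits τ) (hτ' : MeetsAllOrbits τ) :
    Function.Bijective fun (k : Kn n X) (o : O) => homKn (c o) n hX k := by
  constructor
  · intro k k' h
    exact Subtype.ext ((homK0_bijective c (hX.susp n) hτ hτ').1
      (funext fun o => congrArg Subtype.val (congrFun h o)))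
  · intro l
    obtain ⟨k, hk⟩ := (homK0_bijective c (hX.susp n) hτ hτ').2 fun o => (l o).1
    refine ⟨⟨k, (homK0_bijective c GSpace.trivialOn_point hτ hτ').1 (funext fun o => ?_)⟩,
      funext fun o => Subtype.ext (congrFun hk o)⟩
    refine (homK0_map (c o) GSpace.trivialOn_point (hX.susp n) (X.base n) k).trans ?_
    refine (congrArg _ (congrFun hk o)).trans ?_
    exact (l o).2.trans (map_zero (homK0 (c o) GSpace.trivialOn_point)).symm

end Main

end EqK

end

theorem theorem3p4 {G : Type v} [Group G] [Finite G] [TopologicalSpace G] [DiscreteTopology G]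
    (A : Subgroup G) [A.Normal]
    -- a representative `τ o` of each orbit `o` of `G` on `Irr(A)`
    (τ : EqK.IrrOrbits A → EqK.IrrRep A)
    (hτ : ∀ o, Quotient.mk (MulAction.orbitRel G (EqK.Irr A)) (EqK.Irr.mk (τ o)) = o)
    -- the choices in the construction of the cocycles `α_τ`
    (c : ∀ o, EqK.TwistChoice (τ o)) :
    ∃ (Ψ₀ : ∀ (X : EqK.GSpace.{u, v} G) (hX : X.TrivialOn A),
        EqK.K0 X ≃+ ⨁ o, EqK.TwK0 (c o).cocycle (X.res hX (τ o)))
      (Ψ : ∀ (n : ℕ) (X : EqK.GSpace.{u, v} G) (hX : X.TrivialOn A),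
        EqK.Kn n X ≃+ ⨁ o, EqK.TwKn (c o).cocycle n (X.res hX (τ o))),
      -- in degree `0`, the component at `τ` of the image of `[E]` is `[Hom_A(V_τ, E)]`
      (∀ X hX (E : EqK.EqBundle X) o, ∃ h : (EqK.homA (c o) hX E.fam).IsBundle,
        Ψ₀ X hX (EqK.K0.mk E) o =
          EqK.TwK0.mk (c o).cocycle ⟨EqK.homA (c o) hX E.fam, h⟩
            (EqK.homA_isScalar (c o) hX E.fam)) ∧
      -- in degree `n`, the map is the restriction of the map for `Σⁿ(X₊)`
      (∀ n X (hX : X.TrivialOn A) (k : EqK.Kn n X) o,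
        ((Ψ n X hX k o : EqK.TwKn (c o).cocycle n (X.res hX (τ o))) :
          EqK.TwK0 (c o).cocycle ((X.res hX (τ o)).susp n)) =
          Ψ₀ (X.susp n) (hX.susp n) k o) ∧
      -- functoriality
      (∀ X Y (hX : X.TrivialOn A) (hY : Y.TrivialOn A) (f : EqK.GMap X Y) (k : EqK.K0 Y) o,
        Ψ₀ X hX (EqK.K0.map f k) o =
          EqK.TwK0.map (c o).cocycle (f.res hX hY (τ o)) (Ψ₀ Y hY k o)) ∧
      (∀ n X Y (hX : X.TrivialOn A) (hY : Y.TrivialOn A) (f : EqK.GMap X Y) (k : EqK.Kn n Y) o,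
        Ψ n X hX (EqK.Kn.map n f k) o =
          EqK.TwKn.map (c o).cocycle n (f.res hX hY (τ o)) (Ψ n Y hY k o)) := by
  have h1 : EqK.DistinctOrbits τ := fun o o' g h => by
    rw [← hτ o, ← hτ o']
    exact Quotient.sound ⟨g, h.symm⟩
  have h2 : EqK.MeetsAllOrbits τ := fun π => by
    -- For the orbit of [π], `hτ` yields `g` carrying [π] to the chosen representative, so `g⁻¹`
    -- leads back.
    obtain ⟨g, hg⟩ := Quotient.exact (hτ (Quotient.mk _ (EqK.Irr.mk π)))
    exact ⟨_, g⁻¹, eq_inv_smul_iff.2 hg⟩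
  refine ⟨fun X hX => EqK.directSumEquiv (fun o => EqK.homK0 (c o) hX)
      (EqK.homK0_bijective c hX h1 h2),
    fun n X hX => EqK.directSumEquiv (fun o => EqK.homKn (c o) n hX)
      (EqK.homKn_bijective c n hX h1 h2), ?_, ?_, ?_, ?_⟩
  · exact fun X hX E o => ⟨EqK.homA_isBundle (c o) hX E.isBundle,
      EqK.grothendieckMap_of (EqK.homVec (c o) hX) (EqK.Vec.mk E)⟩
  · exact fun n X hX k o => rfl
  · exact fun X Y hX hY f k o => EqK.homK0_map (c o) hX hY f k
  · exact fun n X Y hX hY f k o => Subtype.ext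
      (EqK.homK0_map (c o) (hX.susp n) (hY.susp n) (f.susp n) k)
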